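/- Let $\Gamma$ be a compact connected metrized graph (finitely many edges of positive length; loops and multiple edges allowed) with total length $\ell(\Gamma)$, and let $q:\Gamma\to\mathbb R_{\ge 0}$ be a function of finite support such that the canonical divisor $K=\sum_{x}(v(x)+2q(x)-2)\,x$ is effective, where $v(x)$ is the valency of $x$. (The reduction graph of a semistable curve over a discrete valuation ring is of this form, with all edges of length $1$.) Let $g=\sum_x q(x)+b_1(\Gamma)$ be the genus. An *admissible pair* of $(\Gamma,q)$ consists of a probability measure $\mu$ on $\Gamma$ and a continuous symmetric function $G$ on $\Gamma\times\Gamma$ such that $\Delta_yG(x,y)=\delta_x-\mu$ for all $x$ (with $\Delta f=-f''dx-\sum_p(\text{sum of the outgoing slopes of }f\text{ at }p)\,\delta_p$, in the sense of distributions), $\int G(x,y)\,d\mu(y)=0$ for all $x$, and $G(x,x)+G(K,x)$ is constant in $x$. Put $$\varphi(\Gamma)=-\tfrac14\ell(\Gamma)+\tfrac14\int_\Gamma G(x,x)\big((10g+2)\,d\mu-\delta_K\big),\qquad \epsilon(\Gamma)=\int_\Gamma G(x,x)\big((2g-2)\,d\mu+\delta_K\big),$$ $$\lambda(\Gamma)=\frac{g-1}{6(2g+1)}\varphi(\Gamma)+\frac1{12}\big(\epsilon(\Gamma)+\ell(\Gamma)\big).$$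 A point $p$ outside the support of $K$ is of type $0$ if cutting $\Gamma$ at $p$ leaves it connected; otherwise the two pieces have genera $i$ and $g-i$ with $i\in(0,g/2]$, and $p$ is of type $i$. Let $\ell_i=\ell_i(\Gamma)$ be the length of the set of points of type $i$. For a circle $C$ in $\Gamma$, let $V_C$ (the vertices of $C$) be the set of points of $C$ in the support of $K$, i.e. with valency at least $3$ or $q>0$. For $A\in V_C$ let $g_A$ be the genus of the connected component of $A$ in $\Gamma\setminus(C\setminus V_C)$, and let $r_C(A,B)$ be the effective resistance between $A$ and $B$ in the circle $C$. **Theorem.** Assume that $\Gamma$ is elementary, i.e. every edge lies in at most one circle. Then an admissible pair exists, and for every admissible pair the following hold. 1. $$\varphi(\Gamma)\ \ge\ \frac{g-1}{6g}\,\ell_0+\sum_{i\in(0,g/2]}\frac{2i(g-i)}g\,\ell_i,$$ with equality if and only if every circle $C$ in $\Gamma$ has at most one vertex, i.e. $|V_C|\le 1$. 2. With $C$ running over the circles in $\Gamma$, and $(A,B)$ over the ordered pairs of points of $V_C$, $$\varphi(\Gamma)=\frac{g-1}{6g}\,\ell_0+\sum_{i\in(0,g/2]}\frac{2i(g-i)}g\,\ell_i+\sum_{C}\sum_{A,B\in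 V_C}\frac{g_Ag_B}{g}\,r_C(A,B),$$ $$\lambda(\Gamma)=\frac{g}{8g+4}\,\ell_0+\sum_{i\in(0,g/2]}\frac{i(g-i)}{2g+1}\,\ell_i+\sum_{C}\sum_{A,B\in V_C}\frac{g_Ag_B}{4g+2}\,r_C(A,B).$$ -/

import Mathlib

open MeasureTheory Set
open scoped Classical

noncomputable section

universe u v

/-- A compact connected metrized graph, given by a finite set `V` of vertices (any finite set of
points containing all points of valency different from `2` may serve), a finite set `E` of edges
(loops and multiple edges are allowed), and the lengths of the edges. The edge `e` is a segment of
length `len e` whose ends are glued to `src e` and `tgt e`. -/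
structure MetrizedGraph (V : Type u) (E : Type v) [Fintype V] [Fintype E] where
  src : E → V
  tgt : E → V
  len : E → ℝ
  len_pos : ∀ e, 0 < len e
  nonempty : Nonempty V
  connected : ∀ a b : V, Relation.ReflTransGen
    (fun x y => ∃ e, (src e = x ∧ tgt e = y) ∨ (src e = y ∧ tgt e = x)) a b

namespace MetrizedGraph

variable {V : Type u} {E : Type v} [Fintype V] [Fintype E] (Γ : MetrizedGraph V E)

/-! ### Points, measurable sets, continuity -/

/-- The points of the metrized graph: the vertices and the inner points of the edges. -/
def Pt : Type (max u v) := V ⊕ (Σ e : E, Ioo (0 : ℝ) (Γ.len e))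

/-- A vertex as a point. -/
def vert (x : V) : Γ.Pt := Sum.inl x

/-- The arc length parametrization `[0, len e] → Γ` of the closed edge `e`, extended to `ℝ` by
constants. -/
def edgePt (e : E) (t : ℝ) : Γ.Pt :=
  if h : t ∈ Ioo (0 : ℝ) (Γ.len e) then Sum.inr ⟨e, t, h⟩
  else if t ≤ 0 then Γ.vert (Γ.src e) else Γ.vert (Γ.tgt e)

/-- The Borel sets of the graph: those whose preimages in all edges are Borel. -/
instance instMeasurableSpacePt : MeasurableSpace Γ.Pt :=
  ⨅ e : E, MeasurableSpace.map (Γ.edgePt e) (borel ℝ)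

/-- Continuity of a function on `Γ × Γ`, expressed on products of closed edges. -/
def JointlyContinuous (G : Γ.Pt → Γ.Pt → ℝ) : Prop :=
  ∀ e e' : E, Continuous fun p : ℝ × ℝ => G (Γ.edgePt e p.1) (Γ.edgePt e' p.2)

/-! ### The Laplacian -/

/-- Test functions: functions on `Γ` (single valued at the vertices) that are `C²` on every closed
edge, with one-sided derivatives at the ends. -/
def IsTest (f : Γ.Pt → ℝ) : Prop :=
  ∀ e, ContDiffOn ℝ 2 (fun t => f (Γ.edgePt e t)) (Icc 0 (Γ.len e))

/-- First derivative of `f` along the edge `e`. -/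
def edgeDeriv (f : Γ.Pt → ℝ) (e : E) (t : ℝ) : ℝ :=
  derivWithin (fun s => f (Γ.edgePt e s)) (Icc 0 (Γ.len e)) t

/-- Second derivative of `f` along the edge `e`. -/
def edgeDeriv2 (f : Γ.Pt → ℝ) (e : E) (t : ℝ) : ℝ :=
  iteratedDerivWithin 2 (fun s => f (Γ.edgePt e s)) (Icc 0 (Γ.len e)) t

/-- The integral `∫ h Δf` of `h` against the measure
`Δf = -f'' dx - ∑_x (sum of the outgoing slopes of f at x) δ_x`. -/
def laplacePairing (h f : Γ.Pt → ℝ) : ℝ :=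
  ∑ e, (-(∫ t in (0 : ℝ)..(Γ.len e), h (Γ.edgePt e t) * Γ.edgeDeriv2 f e t)
    - h (Γ.vert (Γ.src e)) * Γ.edgeDeriv f e 0
    + h (Γ.vert (Γ.tgt e)) * Γ.edgeDeriv f e (Γ.len e))

/-- `Δh = δ_x - μ` in the sense of distributions. -/
def LaplacianEq (h : Γ.Pt → ℝ) (x : Γ.Pt) (μ : Measure Γ.Pt) : Prop :=
  ∀ f : Γ.Pt → ℝ, Γ.IsTest f → Γ.laplacePairing h f = f x - ∫ y, f y ∂μ

/-! ### Combinatorics: valency, connected components, circles, resistance -/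

/-- The number of ends at `x` of edges in `F`; loops count twice. -/
def degIn (F : Finset E) (x : V) : ℕ :=
  (F.filter fun e => Γ.src e = x).card + (F.filter fun e => Γ.tgt e = x).card

/-- The valency of a vertex. -/
def valency (x : V) : ℕ := Γ.degIn Finset.univ x

/-- `a` and `b` are joined by a path made of edges in `F`. -/
def Reach (F : Finset E) (a b : V) : Prop :=
  Relation.ReflTransGen
    (fun x y => ∃ e ∈ F, (Γ.src e = x ∧ Γ.tgt e = y) ∨ (Γ.src e = y ∧ Γ.tgt e = x)) a b

/-- The vertices of the connected component of `a` in the subgraph with all vertices and edge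
set `F`. -/
def compVerts (F : Finset E) (a : V) : Finset V := Finset.univ.filter fun x => Γ.Reach F a x

/-- The edges of that connected component. -/
def compEdges (F : Finset E) (a : V) : Finset E := F.filter fun e => Γ.Reach F a (Γ.src e)

/-- The set of edges `C` forms a circle: a nonempty connected subgraph in which every vertex has
valency `2`. -/
def IsCircle (C : Finset E) : Prop :=
  C.Nonempty ∧ (∀ x, Γ.degIn C x = 0 ∨ Γ.degIn C x = 2) ∧
    ∀ x y, Γ.degIn C x = 2 → Γ.degIn C y = 2 → Γ.Reach C x y

/-- The finite set of all circles in `Γ`. -/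
def circles : Finset (Finset E) := Finset.univ.filter fun C => Γ.IsCircle C

/-- Every edge lies in at most one circle. -/
def IsElementary : Prop :=
  ∀ C ∈ Γ.circles, ∀ C' ∈ Γ.circles, ∀ e, e ∈ C → e ∈ C' → C = C'

/-- Removing an inner point of `e` (equivalently, the open edge `e`) disconnects the graph. -/
def IsBridge (e : E) : Prop := ¬ Γ.Reach (Finset.univ.erase e) (Γ.src e) (Γ.tgt e)

/-- The net flow out of the vertex `x` of a flow `θ` (counted positively from source to target). -/
def netFlow (θ : E → ℝ) (x : V) : ℝ :=
  (∑ e ∈ Finset.univ.filter fun e => Γ.src e = x, θ e)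
    - ∑ e ∈ Finset.univ.filter fun e => Γ.tgt e = x, θ e

/-- The effective resistance between `a` and `b` in the electric network with edge set `C`, the
edge `e` having resistance `len e`: the least energy dissipated by a unit flow from `a` to `b`
inside `C`. -/
def resistance (C : Finset E) (a b : V) : ℝ :=
  sInf {w : ℝ | ∃ θ : E → ℝ, (∀ e, e ∉ C → θ e = 0) ∧
    (∀ x, Γ.netFlow θ x = (if x = a then 1 else 0) - (if x = b then 1 else 0)) ∧
    w = ∑ e, Γ.len e * θ e ^ 2}

/-- The total length. -/
def length : ℝ := ∑ e, Γ.len e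

end MetrizedGraph

/-- A polarized metrized graph: a metrized graph with a nonnegative function `q` of finite support
(the vertex set is chosen to contain its support) such that the canonical divisor
`K = ∑ (v(x) + 2 q(x) - 2) x` is effective. -/
structure PolarizedGraph (V : Type u) (E : Type v) [Fintype V] [Fintype E] extends
    MetrizedGraph V E where
  q : V → ℝ
  q_nonneg : ∀ x, 0 ≤ q x
  effective : ∀ x, 0 ≤ (toMetrizedGraph.valency x : ℝ) + 2 * q x - 2

namespace PolarizedGraph

variable {V : Type u} {E : Type v} [Fintype V] [Fintype E] (Γ : PolarizedGraph V E)

/-- The multiplicity of the canonical divisor at a vertex (it is `0` at all other points). -/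
def K (x : V) : ℝ := (Γ.valency x : ℝ) + 2 * Γ.q x - 2

/-- The genus of the connected component of `a` in the subgraph with edge set `F`: the sum of `q`
over the component plus its first Betti number `#edges - #vertices + 1`. -/
def compGenus (F : Finset E) (a : V) : ℝ :=
  (∑ x ∈ Γ.compVerts F a, Γ.q x) +
    (((Γ.compEdges F a).card : ℝ) - ((Γ.compVerts F a).card : ℝ) + 1)

/-- The genus `g = ∑ q(x) + b(Γ)`. -/
def genus : ℝ :=
  (∑ x, Γ.q x) + ((Fintype.card E : ℝ) - (Fintype.card V : ℝ) + 1)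

/-- For an edge `e` whose inner points disconnect the graph: the smaller of the genera `i` and
`g - i` of the two components obtained by cutting `e` at an inner point. -/
def bridgeType (e : E) : ℝ :=
  min (Γ.compGenus (Finset.univ.erase e) (Γ.src e))
    (Γ.compGenus (Finset.univ.erase e) (Γ.tgt e))

/-- The length `ℓ_0` of the set of points of type `0`. -/
def ell0 : ℝ := ∑ e ∈ Finset.univ.filter fun e => ¬ Γ.IsBridge e, Γ.len e

/-- The length `ℓ_i`, for `i > 0`, of the set of points of type `i`. -/
def ell (i : ℝ) : ℝ :=
  ∑ e ∈ Finset.univ.filter fun e => Γ.IsBridge e ∧ Γ.bridgeType e = i, Γ.len e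

/-- The vertices of a circle `C`: the points of `C` that lie in the support of the canonical
divisor, that is, that have valency at least `3` or `q > 0`. -/
def circleVerts (C : Finset E) : Finset V :=
  Finset.univ.filter fun x => Γ.degIn C x = 2 ∧ Γ.K x ≠ 0

/-- For a point `a` of a circle `C`, the genus `g_a` of the connected component of `a` in what
remains of `Γ` when the edges of `C` are removed. -/
def hangingGenus (C : Finset E) (a : V) : ℝ := Γ.compGenus (Finset.univ \ C) a

/-- `μ` and `G` are the admissible measure and the admissible Green's function of `(Γ, q)`:
`μ` has mass one, `G` is continuous and symmetric, `Δ_y G(x, y) = δ_x - μ`,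
`∫ G(x, y) dμ(y) = 0`, and `G(x, x) + G(K, x)` is constant. -/
structure IsAdmissible (μ : Measure Γ.Pt) (G : Γ.Pt → Γ.Pt → ℝ) : Prop where
  isProb : IsProbabilityMeasure μ
  continuous : Γ.JointlyContinuous G
  symm : ∀ x y, G x y = G y x
  laplacian : ∀ x, Γ.LaplacianEq (G x) x μ
  integral_eq_zero : ∀ x, ∫ y, G x y ∂μ = 0
  adjunction : ∃ c : ℝ, ∀ x, G x x + ∑ p, Γ.K p * G (Γ.vert p) x = c

/-- `φ = -ℓ/4 + (1/4) ∫ G(x,x) ((10g+2) dμ - δ_K)`. -/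
def phi (μ : Measure Γ.Pt) (G : Γ.Pt → Γ.Pt → ℝ) : ℝ :=
  -(1 / 4) * Γ.length + (1 / 4) *
    ((10 * Γ.genus + 2) * (∫ x, G x x ∂μ) - ∑ p, Γ.K p * G (Γ.vert p) (Γ.vert p))

/-- `ε = ∫ G(x,x) ((2g-2) dμ + δ_K)`. -/
def eps (μ : Measure Γ.Pt) (G : Γ.Pt → Γ.Pt → ℝ) : ℝ :=
  (2 * Γ.genus - 2) * (∫ x, G x x ∂μ) + ∑ p, Γ.K p * G (Γ.vert p) (Γ.vert p)

/-- `λ = (g-1)/(6(2g+1)) φ + (ε + ℓ)/12`. -/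
def lam (μ : Measure Γ.Pt) (G : Γ.Pt → Γ.Pt → ℝ) : ℝ :=
  (Γ.genus - 1) / (6 * (2 * Γ.genus + 1)) * Γ.phi μ G + (1 / 12) * (Γ.eps μ G + Γ.length)

end PolarizedGraph

end

/-!
The proof computes both invariants in terms of effective resistances, for any graph, and then
evaluates the resistances of an elementary graph.

*Existence and uniqueness.* The discrete Laplacian on the vertices has a symmetric inverse modulo
constants (`exists_green`). Interpolating it affinely along the edges and adding the Dirichlet Green
function of each edge gives a Green function `greenFn` of the whole graph for the uniform measure on
the vertices (`laplacePairing_greenFn`). Correcting it by the potential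
`a(x) = (greenFn(x, x) + greenFn(K, x)) / 2g`, whose Laplacian is the difference of the admissible
measure and the uniform one, gives an admissible pair (`exists_isAdmissible`). Conversely, a
continuous function that is harmonic in the sense of distributions is constant
(`eq_of_weaklyHarmonic`), so the function `G(x, x) + G(y, y) - 2 G(x, y)` is the same for all
Green functions `G`: it is the effective resistance `r(x, y)`.

*Reduction to resistances.* For an admissible pair, `∫ G(x, x) dμ` is the constant in the adjunction
formula. This constant and `G(K, K)` are determined by two numbers: the sum `S` of
`K(x) K(y) r(x, y)` over pairs of vertices, and the energy `T` of the function `r(p, ·)` for a fixed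
vertex `p`. This expresses `φ` and `ε` through `g`, `ℓ`, `S` and `T` (`IsAdmissible.phi_eps_eq`).

*Elementary graphs.* Every circulation is a sum of circulations around circles
(`IsCirculation.induction`). If each edge lies in at most one circle, then restricting a circulation
to a circle `C` gives a circulation (`IsElementary.restrict_circulation`). Consequently the current
between two vertices restricts on `C` to the current in `C` between their projections to `C`; its
energy is the resistance in `C`, and the projections carry the degree `2 g_A` of the part of `K`
attached at `A`. A bridge carries the current `0` or `±1`. Summing over bridges and circles gives
`S` (`canonicalRes_eq`). A bridge of length `L` contributes `L` to `T`, and a circle of length `L`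
contributes `L / 3` (`IsElementary.resEnergy_eq`). The formulas for `φ` and `λ` follow, and the last
sum in them is nonnegative and vanishes only if no circle has two vertices, since the `g_A` and the
resistances of distinct points are positive.
-/

noncomputable section

namespace MetrizedGraph

variable {V : Type*} {E : Type*} [Fintype V] [Fintype E] (Γ : MetrizedGraph V E)

/-! ### Flows and potentials on the vertices -/

lemma sum_mul_netFlow (h : V → ℝ) (θ : E → ℝ) :
    ∑ x, h x * Γ.netFlow θ x = ∑ e, (h (Γ.src e) - h (Γ.tgt e)) * θ e := by
  have key : ∀ s : E → V, ∑ x, h x * ∑ e ∈ Finset.univ.filter (fun e => s e = x), θ e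
      = ∑ e, h (s e) * θ e := by
    intro s
    rw [← Finset.sum_fiberwise Finset.univ s (fun e => h (s e) * θ e)]
    refine Finset.sum_congr rfl fun x _ => ?_
    rw [Finset.mul_sum]
    refine Finset.sum_congr rfl fun e he => ?_
    rw [(Finset.mem_filter.1 he).2]
  simp only [netFlow, mul_sub, sub_mul, Finset.sum_sub_distrib, key]

lemma netFlow_add (θ η : E → ℝ) (x : V) :
    Γ.netFlow (θ + η) x = Γ.netFlow θ x + Γ.netFlow η x := by
  simp only [netFlow, Pi.add_apply, Finset.sum_add_distrib]; ring

lemma netFlow_smul (c : ℝ) (θ : E → ℝ) (x : V) :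
    Γ.netFlow (c • θ) x = c * Γ.netFlow θ x := by
  simp only [netFlow, Pi.smul_apply, smul_eq_mul, ← Finset.mul_sum]; ring

lemma netFlow_sub (θ η : E → ℝ) (x : V) :
    Γ.netFlow (θ - η) x = Γ.netFlow θ x - Γ.netFlow η x := by
  simp only [netFlow, Pi.sub_apply, Finset.sum_sub_distrib]; ring

lemma netFlow_zero (x : V) : Γ.netFlow 0 x = 0 := by simp [netFlow]

lemma sum_netFlow (θ : E → ℝ) : ∑ x, Γ.netFlow θ x = 0 := by
  simpa using Γ.sum_mul_netFlow (fun _ => 1) θ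

/-- The flow driven by the potential `h`: on each edge, the drop of `h` divided by the length. -/
def grad (h : V → ℝ) (e : E) : ℝ := (h (Γ.src e) - h (Γ.tgt e)) / Γ.len e

lemma len_mul_grad (h : V → ℝ) (e : E) :
    Γ.len e * Γ.grad h e = h (Γ.src e) - h (Γ.tgt e) := by
  have := (Γ.len_pos e).ne'
  rw [grad]; field_simp

lemma grad_add (h k : V → ℝ) : Γ.grad (h + k) = Γ.grad h + Γ.grad k := by
  ext e; simp only [grad, Pi.add_apply]; ring

lemma grad_smul (c : ℝ) (h : V → ℝ) : Γ.grad (c • h) = c • Γ.grad h := by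
  ext e; simp only [grad, Pi.smul_apply, smul_eq_mul]; ring

lemma eq_of_grad_eq_zero {h : V → ℝ} (hh : ∀ e, Γ.grad h e = 0) (a b : V) : h a = h b := by
  induction Γ.connected a b with
  | refl => rfl
  | tail _ hstep ih =>
    obtain ⟨e, he⟩ := hstep
    have := Γ.len_mul_grad h e
    rw [hh e, mul_zero] at this
    rcases he with ⟨rfl, rfl⟩ | ⟨rfl, rfl⟩ <;> linarith

lemma card_pos (Γ : MetrizedGraph V E) : (0 : ℝ) < Fintype.card V := by
  have := Γ.nonempty
  exact_mod_cast Fintype.card_pos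

/-- The discrete Laplacian has a symmetric inverse modulo constants. -/
lemma exists_green : ∃ A : V → V → ℝ, (∀ p q, A p q = A q p) ∧
    ∀ p x, Γ.netFlow (Γ.grad (A p)) x = (if x = p then 1 else 0) - 1 / (Fintype.card V : ℝ) := by
  -- The Laplacian plus the projection to the constants is injective, hence bijective.
  let T : (V → ℝ) →ₗ[ℝ] (V → ℝ) :=
    { toFun := fun h x => Γ.netFlow (Γ.grad h) x + ∑ y, h y
      map_add' := fun h k => by
        ext x
        simp only [grad_add, netFlow_add, Pi.add_apply, Finset.sum_add_distrib]; ring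
      map_smul' := fun c h => by
        ext x
        simp only [grad_smul, netFlow_smul, Pi.smul_apply, smul_eq_mul, ← Finset.mul_sum,
          RingHom.id_apply]; ring }
  have hinj : Function.Injective T := by
    rw [injective_iff_map_eq_zero]
    intro h hT
    have h0 : ∑ x, h x * T h x = 0 := by simp [hT]
    have h1 : ∑ x, h x * T h x = ∑ e, Γ.len e * Γ.grad h e ^ 2 + (∑ y, h y) ^ 2 := by
      have : ∀ x, T h x = Γ.netFlow (Γ.grad h) x + ∑ y, h y := fun _ => rfl
      simp only [this, mul_add, Finset.sum_add_distrib, sum_mul_netFlow, ← Finset.sum_mul]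
      congr 1
      · refine Finset.sum_congr rfl fun e _ => ?_
        rw [← len_mul_grad]; ring
      · ring
    have h2 : 0 ≤ ∑ e, Γ.len e * Γ.grad h e ^ 2 :=
      Finset.sum_nonneg fun e _ => mul_nonneg (Γ.len_pos e).le (sq_nonneg _)
    have h3 : ∑ e, Γ.len e * Γ.grad h e ^ 2 = 0 := by nlinarith [sq_nonneg (∑ y, h y)]
    have h4 : ∑ y, h y = 0 := by
      have : (∑ y, h y) ^ 2 = 0 := by linarith
      exact pow_eq_zero_iff two_ne_zero |>.1 this
    have h5 : ∀ e, Γ.grad h e = 0 := by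
      intro e
      have := (Finset.sum_eq_zero_iff_of_nonneg (fun e _ =>
        mul_nonneg (Γ.len_pos e).le (sq_nonneg (Γ.grad h e)))).1 h3 e (Finset.mem_univ _)
      rcases mul_eq_zero.1 this with h | h
      · exact absurd h (Γ.len_pos e).ne'
      · exact pow_eq_zero_iff two_ne_zero |>.1 h
    ext x
    have h6 : ∑ y, h y = Fintype.card V * h x := by
      rw [Finset.sum_congr rfl (fun y _ => Γ.eq_of_grad_eq_zero h5 y x)]; simp
    have h7 : Fintype.card V * h x = 0 := by rw [← h6, h4]
    simpa [Γ.card_pos.ne'] using h7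
  have hsurj : Function.Surjective T := LinearMap.injective_iff_surjective.1 hinj
  choose A hA using fun p : V => hsurj (fun x => if x = p then 1 else 0)
  have hA' : ∀ p x, Γ.netFlow (Γ.grad (A p)) x + ∑ y, A p y = if x = p then 1 else 0 :=
    fun p x => congrFun (hA p) x
  have hsum : ∀ p, ∑ y, A p y = 1 / (Fintype.card V : ℝ) := by
    intro p
    have : ∑ x, (Γ.netFlow (Γ.grad (A p)) x + ∑ y, A p y) = 1 := by simp [hA']
    rw [Finset.sum_add_distrib, sum_netFlow] at this
    have hc := Γ.card_pos.ne'
    simp only [Finset.sum_const, Finset.card_univ, nsmul_eq_mul, zero_add] at this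
    field_simp; linarith
  have hflow : ∀ p x, Γ.netFlow (Γ.grad (A p)) x
      = (if x = p then 1 else 0) - 1 / (Fintype.card V : ℝ) := by
    intro p x
    rw [← hA' p x, hsum]; ring
  refine ⟨A, ?_, hflow⟩
  have hform : ∀ p q, A p q
      = ∑ e, Γ.len e * (Γ.grad (A p) e * Γ.grad (A q) e)
        + 1 / (Fintype.card V : ℝ) * (1 / (Fintype.card V : ℝ)) := by
    intro p q
    have : A p q = ∑ x, A p x * (Γ.netFlow (Γ.grad (A q)) x + 1 / (Fintype.card V : ℝ)) := by
      simp [hflow]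
    rw [this]
    simp only [mul_add, Finset.sum_add_distrib, sum_mul_netFlow, ← Finset.sum_mul, hsum]
    congr 1
    refine Finset.sum_congr rfl fun e _ => ?_
    rw [← len_mul_grad]; ring
  intro p q
  rw [hform p q, hform q p]
  simp only [mul_comm]

/-- A Green function of the network on the vertices, with respect to the uniform measure. -/
def green : V → V → ℝ := Γ.exists_green.choose

lemma green_symm (p q : V) : Γ.green p q = Γ.green q p := Γ.exists_green.choose_spec.1 p q

lemma netFlow_grad_green (p x : V) : Γ.netFlow (Γ.grad (Γ.green p)) x
    = (if x = p then 1 else 0) - 1 / (Fintype.card V : ℝ) := Γ.exists_green.choose_spec.2 p x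

/-- The electric current when a unit current enters at `a` and leaves at `b`. -/
def current (a b : V) : E → ℝ := Γ.grad (Γ.green a) - Γ.grad (Γ.green b)

lemma netFlow_current (a b x : V) : Γ.netFlow (Γ.current a b) x
    = (if x = a then 1 else 0) - (if x = b then 1 else 0) := by
  rw [current, netFlow_sub, netFlow_grad_green, netFlow_grad_green]; ring

lemma current_add (a b c : V) : Γ.current a b + Γ.current b c = Γ.current a c := by
  simp [current]

/-- Kirchhoff's voltage law: the current is orthogonal to every circulation. -/
lemma sum_len_current_mul (a b : V) (z : E → ℝ) :
    ∑ e, Γ.len e * (Γ.current a b e * z e)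
      = ∑ x, (Γ.green a x - Γ.green b x) * Γ.netFlow z x := by
  rw [sum_mul_netFlow]
  refine Finset.sum_congr rfl fun e _ => ?_
  have h1 := Γ.len_mul_grad (Γ.green a) e
  have h2 := Γ.len_mul_grad (Γ.green b) e
  simp only [current, Pi.sub_apply]
  linear_combination z e * h1 - z e * h2

/-- The effective resistance of the whole network between two vertices. -/
def effRes (a b : V) : ℝ := Γ.green a a + Γ.green b b - 2 * Γ.green a b

lemma effRes_eq_energy (a b : V) :
    Γ.effRes a b = ∑ e, Γ.len e * Γ.current a b e ^ 2 := by
  simp only [pow_two, sum_len_current_mul, netFlow_current]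
  simp only [mul_sub, mul_ite, mul_one, mul_zero, Finset.sum_sub_distrib, Finset.sum_ite_eq',
    Finset.mem_univ, if_true, effRes, Γ.green_symm b a]
  ring

lemma two_mul_len_mul_current_src (p : V) (e : E) :
    2 * (Γ.len e * Γ.current p (Γ.src e) e)
      = Γ.effRes p (Γ.tgt e) - Γ.effRes p (Γ.src e) - Γ.effRes (Γ.src e) (Γ.tgt e) := by
  simp only [current, Pi.sub_apply, mul_sub, len_mul_grad, effRes]
  ring

lemma two_mul_len_mul_current_tgt (p : V) (e : E) :
    2 * (Γ.len e * Γ.current p (Γ.tgt e) e)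
      = Γ.effRes p (Γ.tgt e) - Γ.effRes p (Γ.src e) + Γ.effRes (Γ.src e) (Γ.tgt e) := by
  simp only [current, Pi.sub_apply, mul_sub, len_mul_grad, effRes,
    Γ.green_symm (Γ.tgt e) (Γ.src e)]
  ring

lemma len_mul_current_self (e : E) :
    Γ.len e * Γ.current (Γ.src e) (Γ.tgt e) e = Γ.effRes (Γ.src e) (Γ.tgt e) := by
  simp only [current, Pi.sub_apply, mul_sub, len_mul_grad, effRes,
    Γ.green_symm (Γ.tgt e) (Γ.src e)]
  ring

/-- The mass of the canonical measure on an edge: `1 - r(e)/len e = len e / (len e + R_e)`, with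
`R_e` the resistance between the ends of `e` in the network without `e`. -/
def edgeMass (e : E) : ℝ := 1 - Γ.effRes (Γ.src e) (Γ.tgt e) / Γ.len e

lemma effRes_src_tgt (e : E) :
    Γ.effRes (Γ.src e) (Γ.tgt e) = Γ.len e * (1 - Γ.edgeMass e) := by
  have := (Γ.len_pos e).ne'
  simp only [edgeMass]; field_simp; ring

lemma edgeMass_eq (e : E) : Γ.edgeMass e = 1 - Γ.current (Γ.src e) (Γ.tgt e) e := by
  have h := (Γ.len_pos e).ne'
  rw [edgeMass, ← len_mul_current_self]; field_simp

lemma edgeMass_nonneg (e : E) : 0 ≤ Γ.edgeMass e := by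
  have h := Γ.len_pos e
  have h1 : Γ.len e * Γ.current (Γ.src e) (Γ.tgt e) e ^ 2 ≤ Γ.effRes (Γ.src e) (Γ.tgt e) := by
    rw [effRes_eq_energy]
    exact Finset.single_le_sum
      (f := fun e' => Γ.len e' * Γ.current (Γ.src e) (Γ.tgt e) e' ^ 2)
      (fun e' _ => mul_nonneg (Γ.len_pos e').le (sq_nonneg _)) (Finset.mem_univ e)
  rw [← len_mul_current_self] at h1
  have h2 := le_of_mul_le_mul_left h1 h
  rw [edgeMass_eq]
  nlinarith

/-- Foster's theorem. -/
lemma sum_edgeMass :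
    ∑ e, Γ.edgeMass e = (Fintype.card E : ℝ) - (Fintype.card V : ℝ) + 1 := by
  have key : ∀ s : E → V, ∑ p, ∑ e ∈ Finset.univ.filter (fun e => s e = p), Γ.grad (Γ.green p) e
      = ∑ e, Γ.grad (Γ.green (s e)) e := by
    intro s
    rw [← Finset.sum_fiberwise Finset.univ s]
    refine Finset.sum_congr rfl fun x _ => Finset.sum_congr rfl fun e he => ?_
    rw [(Finset.mem_filter.1 he).2]
  have h1 : ∑ p, Γ.netFlow (Γ.grad (Γ.green p)) p = ∑ e, Γ.current (Γ.src e) (Γ.tgt e) e := by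
    simp only [netFlow, Finset.sum_sub_distrib, key, current, Pi.sub_apply]
  have h2 : ∑ p, Γ.netFlow (Γ.grad (Γ.green p)) p = (Fintype.card V : ℝ) - 1 := by
    have := Γ.card_pos.ne'
    simp only [netFlow_grad_green, if_true, Finset.sum_const, Finset.card_univ, nsmul_eq_mul]
    field_simp
  simp only [edgeMass_eq, Finset.sum_sub_distrib, ← h1, h2]
  simp; ring

end MetrizedGraph

namespace MetrizedGraph

variable {V : Type*} {E : Type*} [Fintype V] [Fintype E] (Γ : MetrizedGraph V E)

/-! ### Functions on the graph: continuity and integrability -/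

lemma edgePt_of_mem {e : E} {t : ℝ} (h : t ∈ Ioo (0 : ℝ) (Γ.len e)) :
    Γ.edgePt e t = Sum.inr ⟨e, t, h⟩ := dif_pos h

lemma edgePt_of_nonpos {e : E} {t : ℝ} (h : t ≤ 0) : Γ.edgePt e t = Γ.vert (Γ.src e) := by
  have : t ∉ Ioo (0 : ℝ) (Γ.len e) := fun h' => absurd h'.1 (not_lt.2 h)
  exact (dif_neg this).trans (if_pos h)

lemma edgePt_of_ge {e : E} {t : ℝ} (h : Γ.len e ≤ t) : Γ.edgePt e t = Γ.vert (Γ.tgt e) := by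
  have h1 : t ∉ Ioo (0 : ℝ) (Γ.len e) := fun h' => absurd h'.2 (not_lt.2 h)
  have h2 : ¬ t ≤ 0 := not_le.2 ((Γ.len_pos e).trans_le h)
  exact (dif_neg h1).trans (if_neg h2)

lemma edgePt_zero (e : E) : Γ.edgePt e 0 = Γ.vert (Γ.src e) := Γ.edgePt_of_nonpos le_rfl

lemma edgePt_len (e : E) : Γ.edgePt e (Γ.len e) = Γ.vert (Γ.tgt e) := Γ.edgePt_of_ge le_rfl

lemma clamp_mem (e : E) (t : ℝ) : max 0 (min t (Γ.len e)) ∈ Icc 0 (Γ.len e) :=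
  ⟨le_max_left _ _, max_le (Γ.len_pos e).le (min_le_right _ _)⟩

lemma edgePt_clamp (e : E) (t : ℝ) : Γ.edgePt e (max 0 (min t (Γ.len e))) = Γ.edgePt e t := by
  rcases le_total t 0 with h | h
  · have : min t (Γ.len e) ≤ 0 := (min_le_left _ _).trans h
    rw [max_eq_left this, Γ.edgePt_of_nonpos h, edgePt_zero]
  · rcases le_total t (Γ.len e) with h' | h'
    · rw [min_eq_left h', max_eq_right h]
    · rw [min_eq_right h', max_eq_right (Γ.len_pos e).le, Γ.edgePt_of_ge h', edgePt_len]

lemma pt_cases (x : Γ.Pt) :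
    (∃ p, x = Γ.vert p) ∨ ∃ e, ∃ t ∈ Ioo 0 (Γ.len e), x = Γ.edgePt e t := by
  rcases x with p | ⟨e, t, ht⟩
  · exact Or.inl ⟨p, rfl⟩
  · exact Or.inr ⟨e, t, ht, (Γ.edgePt_of_mem ht).symm⟩

/-- Continuity of a function on the graph, expressed on the closed edges. -/
def EdgeContinuous (f : Γ.Pt → ℝ) : Prop := ∀ e, Continuous fun t => f (Γ.edgePt e t)

variable {Γ}

lemma EdgeContinuous.of_continuousOn {f : Γ.Pt → ℝ}
    (h : ∀ e, ContinuousOn (fun t => f (Γ.edgePt e t)) (Icc 0 (Γ.len e))) :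
    Γ.EdgeContinuous f := by
  intro e
  have h1 : Continuous fun t : ℝ => max 0 (min t (Γ.len e)) := by fun_prop
  have h2 := (h e).comp_continuous h1 (Γ.clamp_mem e)
  simpa only [Function.comp_def, edgePt_clamp] using h2

lemma EdgeContinuous.of_eqOn {f : Γ.Pt → ℝ} {φ : E → ℝ → ℝ} (hφ : ∀ e, Continuous (φ e))
    (h : ∀ e, ∀ t ∈ Icc 0 (Γ.len e), f (Γ.edgePt e t) = φ e t) : Γ.EdgeContinuous f :=
  .of_continuousOn fun e => (hφ e).continuousOn.congr (h e)

lemma EdgeContinuous.add {f g : Γ.Pt → ℝ} (hf : Γ.EdgeContinuous f) (hg : Γ.EdgeContinuous g) :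
    Γ.EdgeContinuous (fun x => f x + g x) := fun e => (hf e).add (hg e)

lemma EdgeContinuous.const_mul {f : Γ.Pt → ℝ} (c : ℝ) (hf : Γ.EdgeContinuous f) :
    Γ.EdgeContinuous (fun x => c * f x) := fun e => (hf e).const_mul c

lemma EdgeContinuous.sub {f g : Γ.Pt → ℝ} (hf : Γ.EdgeContinuous f) (hg : Γ.EdgeContinuous g) :
    Γ.EdgeContinuous (fun x => f x - g x) := fun e => (hf e).sub (hg e)

lemma EdgeContinuous.const (c : ℝ) : Γ.EdgeContinuous (fun _ => c) := fun _ => continuous_const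

lemma EdgeContinuous.sum {ι : Type*} {s : Finset ι} {f : ι → Γ.Pt → ℝ}
    (hf : ∀ i ∈ s, Γ.EdgeContinuous (f i)) : Γ.EdgeContinuous (fun x => ∑ i ∈ s, f i x) :=
  fun e => continuous_finsetSum s fun i hi => hf i hi e

lemma IsTest.edgeContinuous {f : Γ.Pt → ℝ} (hf : Γ.IsTest f) : Γ.EdgeContinuous f :=
  .of_continuousOn fun e => (hf e).continuousOn

variable (Γ) in
lemma measurable_edgePt (e : E) : Measurable (Γ.edgePt e) := by
  intro s hs
  have h : MeasurableSet[MeasurableSpace.map (Γ.edgePt e) (borel ℝ)] s :=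
    (iInf_le (fun e : E => MeasurableSpace.map (Γ.edgePt e) (borel ℝ)) e) s hs
  rw [BorelSpace.measurable_eq (α := ℝ)]
  exact h

lemma EdgeContinuous.measurable {f : Γ.Pt → ℝ} (hf : Γ.EdgeContinuous f) : Measurable f := by
  intro s hs
  refine MeasurableSpace.measurableSet_iInf.2 fun e => ?_
  have h : MeasurableSet ((fun t => f (Γ.edgePt e t)) ⁻¹' s) := (hf e).measurable hs
  rw [BorelSpace.measurable_eq (α := ℝ)] at h
  exact h

lemma EdgeContinuous.bounded {f : Γ.Pt → ℝ} (hf : Γ.EdgeContinuous f) :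
    ∃ B, ∀ x, ‖f x‖ ≤ B := by
  have h1 : ∀ e, ∃ B, ∀ t ∈ Icc 0 (Γ.len e), ‖f (Γ.edgePt e t)‖ ≤ B := fun e =>
    isCompact_Icc.exists_bound_of_continuousOn (hf e).continuousOn
  choose B hB using h1
  refine ⟨∑ p, ‖f (Γ.vert p)‖ + ∑ e, |B e|, fun x => ?_⟩
  have h2 : 0 ≤ ∑ p, ‖f (Γ.vert p)‖ := Finset.sum_nonneg fun _ _ => norm_nonneg _
  have h3 : 0 ≤ ∑ e, |B e| := Finset.sum_nonneg fun _ _ => abs_nonneg _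
  rcases Γ.pt_cases x with ⟨p, rfl⟩ | ⟨e, t, ht, rfl⟩
  · have := Finset.single_le_sum (f := fun p => ‖f (Γ.vert p)‖)
      (fun _ _ => norm_nonneg _) (Finset.mem_univ p)
    linarith
  · have := Finset.single_le_sum (f := fun e => |B e|)
      (fun _ _ => abs_nonneg _) (Finset.mem_univ e)
    have := hB e t (Ioo_subset_Icc_self ht)
    have := le_abs_self (B e)
    linarith

lemma EdgeContinuous.integrable {f : Γ.Pt → ℝ} (hf : Γ.EdgeContinuous f) (μ : Measure Γ.Pt)
    [IsFiniteMeasure μ] : Integrable f μ := by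
  obtain ⟨B, hB⟩ := hf.bounded
  exact Integrable.of_bound hf.measurable.aestronglyMeasurable B (.of_forall hB)

/-! ### Test functions and the Laplacian -/

section Test

variable {f : Γ.Pt → ℝ}

lemma IsTest.contDiffOn_edgeDeriv (hf : Γ.IsTest f) (e : E) :
    ContDiffOn ℝ 1 (Γ.edgeDeriv f e) (Icc 0 (Γ.len e)) :=
  (hf e).derivWithin (uniqueDiffOn_Icc (Γ.len_pos e)) (by norm_num)

lemma edgeDeriv2_eq (f : Γ.Pt → ℝ) (e : E) (t : ℝ) : Γ.edgeDeriv2 f e t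
    = derivWithin (Γ.edgeDeriv f e) (Icc 0 (Γ.len e)) t := by
  rw [edgeDeriv2, iteratedDerivWithin_succ, iteratedDerivWithin_one]
  rfl

lemma IsTest.continuousOn_edgeDeriv2 (hf : Γ.IsTest f) (e : E) :
    ContinuousOn (Γ.edgeDeriv2 f e) (Icc 0 (Γ.len e)) := by
  have := (hf.contDiffOn_edgeDeriv e).continuousOn_derivWithin
    (uniqueDiffOn_Icc (Γ.len_pos e)) le_rfl
  exact this.congr fun t _ => edgeDeriv2_eq f e t

lemma IsTest.hasDerivAt (hf : Γ.IsTest f) {e : E} {t : ℝ} (ht : t ∈ Ioo 0 (Γ.len e)) :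
    HasDerivAt (fun s => f (Γ.edgePt e s)) (Γ.edgeDeriv f e t) t :=
  (((hf e).differentiableOn (by norm_num)) t
    (Ioo_subset_Icc_self ht)).hasDerivWithinAt.hasDerivAt (Icc_mem_nhds ht.1 ht.2)

lemma IsTest.hasDerivAt_edgeDeriv (hf : Γ.IsTest f) {e : E} {t : ℝ} (ht : t ∈ Ioo 0 (Γ.len e)) :
    HasDerivAt (Γ.edgeDeriv f e) (Γ.edgeDeriv2 f e t) t := by
  rw [edgeDeriv2_eq]
  exact (((hf.contDiffOn_edgeDeriv e).differentiableOn (by norm_num)) t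
    (Ioo_subset_Icc_self ht)).hasDerivWithinAt.hasDerivAt (Icc_mem_nhds ht.1 ht.2)

/-- Green's identity on a segment of an edge, against a quadratic polynomial `h` with
derivative `h₁` and second derivative `κ`. -/
lemma IsTest.green_identity (hf : Γ.IsTest f) (e : E) {a b : ℝ} (ha : 0 ≤ a) (hab : a ≤ b)
    (hb : b ≤ Γ.len e) {h h₁ : ℝ → ℝ} {κ : ℝ} (hh : ∀ t, HasDerivAt h (h₁ t) t)
    (hh₁ : ∀ t, HasDerivAt h₁ κ t) :
    ∫ t in a..b, h t * Γ.edgeDeriv2 f e t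
      = (h b * Γ.edgeDeriv f e b - h₁ b * f (Γ.edgePt e b))
        - (h a * Γ.edgeDeriv f e a - h₁ a * f (Γ.edgePt e a))
        + κ * ∫ t in a..b, f (Γ.edgePt e t) := by
  have hsub : Icc a b ⊆ Icc 0 (Γ.len e) := Icc_subset_Icc ha hb
  have hhc : Continuous h := continuous_iff_continuousAt.2 fun t => (hh t).continuousAt
  have hhc₁ : Continuous h₁ := continuous_iff_continuousAt.2 fun t => (hh₁ t).continuousAt
  have c0 : Continuous fun t => f (Γ.edgePt e t) := hf.edgeContinuous e
  have c1 := ((hf.contDiffOn_edgeDeriv e).continuousOn).mono hsub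
  have c2 := (hf.continuousOn_edgeDeriv2 e).mono hsub
  have i2 : IntervalIntegrable (fun t => h t * Γ.edgeDeriv2 f e t) volume a b :=
    (hhc.continuousOn.mul c2).intervalIntegrable_of_Icc hab
  have i0 : IntervalIntegrable (fun t => κ * f (Γ.edgePt e t)) volume a b :=
    (continuous_const.mul c0).intervalIntegrable _ _
  have key := intervalIntegral.integral_eq_sub_of_hasDerivAt_of_le hab
    (f := fun t => h t * Γ.edgeDeriv f e t - h₁ t * f (Γ.edgePt e t))
    (f' := fun t => h t * Γ.edgeDeriv2 f e t - κ * f (Γ.edgePt e t))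
    ((hhc.continuousOn.mul c1).sub (hhc₁.mul c0).continuousOn)
    (fun t ht => by
      have ht' : t ∈ Ioo 0 (Γ.len e) := ⟨ha.trans_lt ht.1, ht.2.trans_le hb⟩
      exact (((hh t).mul (hf.hasDerivAt_edgeDeriv ht')).sub
        ((hh₁ t).mul (hf.hasDerivAt ht'))).congr_deriv (by ring)) (i2.sub i0)
  rw [intervalIntegral.integral_sub i2 i0, intervalIntegral.integral_const_mul] at key
  linarith

lemma laplacePairing_add {h k : Γ.Pt → ℝ} (hh : Γ.EdgeContinuous h) (hk : Γ.EdgeContinuous k)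
    (hf : Γ.IsTest f) :
    Γ.laplacePairing (fun x => h x + k x) f = Γ.laplacePairing h f + Γ.laplacePairing k f := by
  simp only [laplacePairing, ← Finset.sum_add_distrib, add_mul]
  refine Finset.sum_congr rfl fun e _ => ?_
  rw [intervalIntegral.integral_add]
  · ring
  · exact ((hh e).continuousOn.mul (hf.continuousOn_edgeDeriv2 e)).intervalIntegrable_of_Icc
      (Γ.len_pos e).le
  · exact ((hk e).continuousOn.mul (hf.continuousOn_edgeDeriv2 e)).intervalIntegrable_of_Icc
      (Γ.len_pos e).le

lemma laplacePairing_const_mul (c : ℝ) (h f : Γ.Pt → ℝ) :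
    Γ.laplacePairing (fun x => c * h x) f = c * Γ.laplacePairing h f := by
  simp only [laplacePairing, Finset.mul_sum, mul_assoc, intervalIntegral.integral_const_mul]
  refine Finset.sum_congr rfl fun e _ => ?_
  ring

lemma laplacePairing_sub {h k : Γ.Pt → ℝ} (hh : Γ.EdgeContinuous h) (hk : Γ.EdgeContinuous k)
    (hf : Γ.IsTest f) :
    Γ.laplacePairing (fun x => h x - k x) f = Γ.laplacePairing h f - Γ.laplacePairing k f := by
  have := laplacePairing_add hh (hk.const_mul (-1)) hf
  rw [laplacePairing_const_mul] at this
  simpa [sub_eq_add_neg] using this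

lemma laplacePairing_const (c : ℝ) (hf : Γ.IsTest f) :
    Γ.laplacePairing (fun _ => c) f = 0 := by
  rw [laplacePairing]
  refine Finset.sum_eq_zero fun e _ => ?_
  have := hf.green_identity e le_rfl (Γ.len_pos e).le le_rfl (h := fun _ => c) (h₁ := fun _ => 0)
    (κ := 0) (fun t => hasDerivAt_const t c) (fun t => hasDerivAt_const t 0)
  rw [this]; ring

lemma laplacePairing_sum {ι : Type*} (s : Finset ι) {h : ι → Γ.Pt → ℝ}
    (hh : ∀ i ∈ s, Γ.EdgeContinuous (h i)) (hf : Γ.IsTest f) :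
    Γ.laplacePairing (fun x => ∑ i ∈ s, h i x) f = ∑ i ∈ s, Γ.laplacePairing (h i) f := by
  induction s using Finset.induction_on with
  | empty => simpa using laplacePairing_const 0 hf
  | insert a s ha ih =>
    simp only [Finset.sum_insert ha]
    rw [laplacePairing_add (hh a (Finset.mem_insert_self a s))
      (.sum fun i hi => hh i (Finset.mem_insert_of_mem hi)) hf,
      ih fun i hi => hh i (Finset.mem_insert_of_mem hi)]

/-- `f` is given on the edges by functions `φ e` with first and second derivatives `φ₁ e` and
`φ₂ e`. -/
structure HasEdgeDerivs (f : Γ.Pt → ℝ) (φ φ₁ φ₂ : E → ℝ → ℝ) : Prop where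
  eqOn : ∀ e, ∀ t ∈ Icc 0 (Γ.len e), f (Γ.edgePt e t) = φ e t
  deriv : ∀ e t, HasDerivAt (φ e) (φ₁ e t) t
  deriv₁ : ∀ e t, HasDerivAt (φ₁ e) (φ₂ e t) t
  cont : ∀ e, Continuous (φ₂ e)

variable {φ φ₁ φ₂ : E → ℝ → ℝ}

lemma HasEdgeDerivs.isTest (hf : HasEdgeDerivs f φ φ₁ φ₂) : Γ.IsTest f := by
  intro e
  have h1 : _root_.deriv (φ e) = φ₁ e := funext fun t => (hf.deriv e t).deriv
  have h2 : _root_.deriv (φ₁ e) = φ₂ e := funext fun t => (hf.deriv₁ e t).deriv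
  have h3 : ContDiff ℝ 1 (φ₁ e) :=
    contDiff_one_iff_deriv.2 ⟨fun t => (hf.deriv₁ e t).differentiableAt, h2 ▸ hf.cont e⟩
  have h4 : ContDiff ℝ 2 (φ e) := by
    rw [show (2 : WithTop ℕ∞) = 1 + 1 by norm_num, contDiff_succ_iff_deriv]
    exact ⟨fun t => (hf.deriv e t).differentiableAt, by simp, h1 ▸ h3⟩
  exact h4.contDiffOn.congr (hf.eqOn e)

lemma HasEdgeDerivs.edgeDeriv_eq (hf : HasEdgeDerivs f φ φ₁ φ₂) {e : E} {t : ℝ}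
    (ht : t ∈ Icc 0 (Γ.len e)) : Γ.edgeDeriv f e t = φ₁ e t :=
  ((hf.deriv e t).hasDerivWithinAt.congr_of_mem (hf.eqOn e) ht).derivWithin
    (uniqueDiffOn_Icc (Γ.len_pos e) t ht)

lemma HasEdgeDerivs.edgeDeriv2_eq (hf : HasEdgeDerivs f φ φ₁ φ₂) {e : E} {t : ℝ}
    (ht : t ∈ Icc 0 (Γ.len e)) : Γ.edgeDeriv2 f e t = φ₂ e t := by
  rw [MetrizedGraph.edgeDeriv2_eq]
  exact ((hf.deriv₁ e t).hasDerivWithinAt.congr_of_mem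
    (fun s hs => hf.edgeDeriv_eq hs) ht).derivWithin (uniqueDiffOn_Icc (Γ.len_pos e) t ht)

lemma HasEdgeDerivs.laplacePairing_eq (hf : HasEdgeDerivs f φ φ₁ φ₂) (h : Γ.Pt → ℝ) :
    Γ.laplacePairing h f = ∑ e, (-(∫ t in (0 : ℝ)..(Γ.len e), h (Γ.edgePt e t) * φ₂ e t)
      - h (Γ.vert (Γ.src e)) * φ₁ e 0 + h (Γ.vert (Γ.tgt e)) * φ₁ e (Γ.len e)) := by
  refine Finset.sum_congr rfl fun e _ => ?_
  have hL := (Γ.len_pos e).le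
  rw [hf.edgeDeriv_eq ⟨le_rfl, hL⟩, hf.edgeDeriv_eq ⟨hL, le_rfl⟩]
  congr 3
  refine intervalIntegral.integral_congr fun t ht => ?_
  rw [uIcc_of_le hL] at ht
  simp only [hf.edgeDeriv2_eq ht]

end Test

end MetrizedGraph

namespace MetrizedGraph

variable {V : Type*} {E : Type*} [Fintype V] [Fintype E] (Γ : MetrizedGraph V E)

/-! ### The Green function on the graph -/

/-- The extension of a function on the vertices that is affine on every edge. -/
def interp (h : V → ℝ) (x : Γ.Pt) : ℝ :=
  Sum.elim h (fun p : Σ e : E, Ioo (0 : ℝ) (Γ.len e) =>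
    (1 - p.2 / Γ.len p.1) * h (Γ.src p.1) + p.2 / Γ.len p.1 * h (Γ.tgt p.1)) x

/-- The Dirichlet Green function of the edges: on each edge, the Green function of the
segment that vanishes at the ends. -/
def bump (x y : Γ.Pt) : ℝ :=
  Sum.elim (fun _ => 0) (fun p : Σ e : E, Ioo (0 : ℝ) (Γ.len e) =>
    Sum.elim (fun _ => 0) (fun p' : Σ e : E, Ioo (0 : ℝ) (Γ.len e) =>
      if p.1 = p'.1 then min (p.2 : ℝ) p'.2 - p.2 * p'.2 / Γ.len p.1 else 0) y) x

/-- A Green function of the graph with respect to the uniform measure on the vertices: the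
interpolation of the Green function of the network, corrected inside the edges. -/
def greenFn (x y : Γ.Pt) : ℝ := Γ.interp (fun p => Γ.interp (Γ.green p) y) x + Γ.bump x y

variable {Γ}

@[simp] lemma interp_vert (h : V → ℝ) (p : V) : Γ.interp h (Γ.vert p) = h p := rfl

lemma interp_edgePt (h : V → ℝ) {e : E} {t : ℝ} (ht : t ∈ Icc 0 (Γ.len e)) :
    Γ.interp h (Γ.edgePt e t)
      = (1 - t / Γ.len e) * h (Γ.src e) + t / Γ.len e * h (Γ.tgt e) := by
  have hL := (Γ.len_pos e).ne'
  rcases ht.1.eq_or_lt with rfl | h0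
  · rw [edgePt_zero, interp_vert]; simp
  rcases ht.2.eq_or_lt with rfl | h1
  · rw [edgePt_len, interp_vert, div_self hL]; simp
  rw [Γ.edgePt_of_mem ⟨h0, h1⟩]; rfl

@[simp] lemma bump_vert_left (p : V) (y : Γ.Pt) : Γ.bump (Γ.vert p) y = 0 := rfl

@[simp] lemma bump_vert_right (p : V) (x : Γ.Pt) : Γ.bump x (Γ.vert p) = 0 := by
  rcases x with _ | _ <;> rfl

lemma bump_edgePt {e e' : E} {s t : ℝ} (hs : s ∈ Icc 0 (Γ.len e)) (ht : t ∈ Icc 0 (Γ.len e')) :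
    Γ.bump (Γ.edgePt e s) (Γ.edgePt e' t)
      = if e = e' then min s t - s * t / Γ.len e else 0 := by
  have hL := (Γ.len_pos e).ne'
  rcases hs.1.eq_or_lt with rfl | hs0
  · rw [edgePt_zero, bump_vert_left, min_eq_left ht.1]; simp
  rcases hs.2.eq_or_lt with rfl | hs1
  · rw [edgePt_len, bump_vert_left]
    split_ifs with h
    · subst h; rw [min_eq_right ht.2]; field_simp; ring
    · rfl
  rcases ht.1.eq_or_lt with rfl | ht0
  · rw [edgePt_zero, bump_vert_right, min_eq_right hs.1]; simp
  rcases ht.2.eq_or_lt with rfl | ht1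
  · rw [edgePt_len, bump_vert_right]
    split_ifs with h
    · subst h; rw [min_eq_left hs.2]; field_simp; ring
    · rfl
  rw [Γ.edgePt_of_mem ⟨hs0, hs1⟩, Γ.edgePt_of_mem ⟨ht0, ht1⟩]; rfl

lemma bump_symm (x y : Γ.Pt) : Γ.bump x y = Γ.bump y x := by
  rcases Γ.pt_cases x with ⟨p, rfl⟩ | ⟨e, s, hs, rfl⟩
  · simp
  rcases Γ.pt_cases y with ⟨p, rfl⟩ | ⟨e', t, ht, rfl⟩
  · simp
  rw [bump_edgePt (Ioo_subset_Icc_self hs) (Ioo_subset_Icc_self ht),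
    bump_edgePt (Ioo_subset_Icc_self ht) (Ioo_subset_Icc_self hs)]
  by_cases h : e = e'
  · subst h; simp only [if_true, min_comm s t]; ring
  · rw [if_neg h, if_neg (Ne.symm h)]

lemma interp_edgeContinuous (h : V → ℝ) : Γ.EdgeContinuous (Γ.interp h) :=
  .of_eqOn (φ := fun e t => (1 - t / Γ.len e) * h (Γ.src e) + t / Γ.len e * h (Γ.tgt e))
    (fun e => by fun_prop) fun e t ht => interp_edgePt h ht

lemma bump_edgeContinuous (x : Γ.Pt) : Γ.EdgeContinuous (Γ.bump x) := by
  rcases Γ.pt_cases x with ⟨p, rfl⟩ | ⟨e, s, hs, rfl⟩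
  · exact .const 0
  refine .of_eqOn (φ := fun e' t => if e = e' then min s t - s * t / Γ.len e else 0)
    (fun e' => ?_) fun e' t ht => bump_edgePt (Ioo_subset_Icc_self hs) ht
  by_cases h : e = e'
  · simp only [h, if_true]; fun_prop
  · simp only [h, if_false]; fun_prop

@[simp] lemma greenFn_vert_left (p : V) (y : Γ.Pt) :
    Γ.greenFn (Γ.vert p) y = Γ.interp (Γ.green p) y := by simp [greenFn]

lemma greenFn_edgePt {e : E} {s : ℝ} (hs : s ∈ Icc 0 (Γ.len e)) (y : Γ.Pt) :
    Γ.greenFn (Γ.edgePt e s) y = (1 - s / Γ.len e) * Γ.interp (Γ.green (Γ.src e)) y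
      + s / Γ.len e * Γ.interp (Γ.green (Γ.tgt e)) y + Γ.bump (Γ.edgePt e s) y := by
  rw [greenFn, interp_edgePt _ hs]

lemma greenFn_symm (x y : Γ.Pt) : Γ.greenFn x y = Γ.greenFn y x := by
  rw [greenFn, greenFn, bump_symm]
  congr 1
  rcases Γ.pt_cases x with ⟨p, rfl⟩ | ⟨e, s, hs, rfl⟩ <;>
  rcases Γ.pt_cases y with ⟨q, rfl⟩ | ⟨e', t, ht, rfl⟩
  · simp [Γ.green_symm]
  · simp only [interp_vert, interp_edgePt _ (Ioo_subset_Icc_self ht), Γ.green_symm p]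
  · simp only [interp_vert, interp_edgePt _ (Ioo_subset_Icc_self hs), Γ.green_symm q]
  · simp only [interp_edgePt _ (Ioo_subset_Icc_self hs), interp_edgePt _ (Ioo_subset_Icc_self ht),
      Γ.green_symm (Γ.src e'), Γ.green_symm (Γ.tgt e')]
    ring

lemma greenFn_edgeContinuous (x : Γ.Pt) : Γ.EdgeContinuous (Γ.greenFn x) := by
  rcases Γ.pt_cases x with ⟨p, rfl⟩ | ⟨e, s, hs, rfl⟩
  · simpa only [EdgeContinuous, greenFn_vert_left] using interp_edgeContinuous (Γ.green p)
  · have := ((interp_edgeContinuous (Γ.green (Γ.src e))).const_mul (1 - s / Γ.len e)).add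
      ((interp_edgeContinuous (Γ.green (Γ.tgt e))).const_mul (s / Γ.len e)) |>.add
      (bump_edgeContinuous (Γ.edgePt e s))
    simpa only [EdgeContinuous, greenFn_edgePt (Ioo_subset_Icc_self hs)] using this

lemma greenFn_jointlyContinuous : Γ.JointlyContinuous Γ.greenFn := by
  intro e e'
  have key : ∀ s ∈ Icc 0 (Γ.len e), ∀ t ∈ Icc 0 (Γ.len e'),
      Γ.greenFn (Γ.edgePt e s) (Γ.edgePt e' t)
        = (1 - s / Γ.len e) * ((1 - t / Γ.len e') * Γ.green (Γ.src e) (Γ.src e')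
            + t / Γ.len e' * Γ.green (Γ.src e) (Γ.tgt e'))
          + s / Γ.len e * ((1 - t / Γ.len e') * Γ.green (Γ.tgt e) (Γ.src e')
            + t / Γ.len e' * Γ.green (Γ.tgt e) (Γ.tgt e'))
          + if e = e' then min s t - s * t / Γ.len e else 0 := by
    intro s hs t ht
    rw [greenFn_edgePt hs, interp_edgePt _ ht, interp_edgePt _ ht, bump_edgePt hs ht]
  have h : ∀ p : ℝ × ℝ, Γ.greenFn (Γ.edgePt e p.1) (Γ.edgePt e' p.2)
      = Γ.greenFn (Γ.edgePt e (max 0 (min p.1 (Γ.len e))))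
          (Γ.edgePt e' (max 0 (min p.2 (Γ.len e')))) := fun p => by
    rw [edgePt_clamp, edgePt_clamp]
  simp only [h, key _ (Γ.clamp_mem e _) _ (Γ.clamp_mem e' _)]
  by_cases hee : e = e'
  · simp only [hee, if_true]; fun_prop
  · simp only [hee, if_false]; fun_prop

lemma laplacePairing_interp (h : V → ℝ) {f : Γ.Pt → ℝ} (hf : Γ.IsTest f) :
    Γ.laplacePairing (Γ.interp h) f = ∑ p, f (Γ.vert p) * Γ.netFlow (Γ.grad h) p := by
  rw [sum_mul_netFlow (Γ := Γ) (fun p => f (Γ.vert p))]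
  refine Finset.sum_congr rfl fun e _ => ?_
  have hL := Γ.len_pos e
  have h1 : ∫ t in (0 : ℝ)..(Γ.len e), Γ.interp h (Γ.edgePt e t) * Γ.edgeDeriv2 f e t
      = ∫ t in (0 : ℝ)..(Γ.len e), (h (Γ.src e) + t * -Γ.grad h e) * Γ.edgeDeriv2 f e t := by
    refine intervalIntegral.integral_congr fun t ht => ?_
    rw [uIcc_of_le hL.le] at ht
    simp only [interp_edgePt h ht, grad]
    field_simp
    ring
  rw [h1, hf.green_identity e le_rfl hL.le le_rfl
    (fun t => ((hasDerivAt_id' t).mul_const (-Γ.grad h e)).const_add (h (Γ.src e)))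
    (fun t => (hasDerivAt_const t _))]
  have h2 := Γ.len_mul_grad h e
  simp only [interp_vert, edgePt_zero, edgePt_len]

  linear_combination (Γ.edgeDeriv f e (Γ.len e)) * h2

lemma laplacePairing_bump {e : E} {s : ℝ} (hs : s ∈ Icc 0 (Γ.len e)) {f : Γ.Pt → ℝ}
    (hf : Γ.IsTest f) : Γ.laplacePairing (Γ.bump (Γ.edgePt e s)) f
      = f (Γ.edgePt e s) - Γ.interp (fun p => f (Γ.vert p)) (Γ.edgePt e s) := by
  have hL := Γ.len_pos e
  have hint : ∀ e', ∫ t in (0 : ℝ)..(Γ.len e'),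
      Γ.bump (Γ.edgePt e s) (Γ.edgePt e' t) * Γ.edgeDeriv2 f e' t
      = ∫ t in (0 : ℝ)..(Γ.len e'),
        (if e = e' then min s t - s * t / Γ.len e else 0) * Γ.edgeDeriv2 f e' t := fun e' => by
    refine intervalIntegral.integral_congr fun t ht => ?_
    rw [uIcc_of_le (Γ.len_pos e').le] at ht
    simp only [bump_edgePt hs ht]
  simp only [laplacePairing, bump_vert_right, hint, zero_mul, sub_zero, add_zero]
  rw [Finset.sum_eq_single e (fun e' _ h => by simp [Ne.symm h]) (by simp)]
  simp only [if_true]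
  have c : ContinuousOn (fun t => (min s t - s * t / Γ.len e) * Γ.edgeDeriv2 f e t)
      (Icc 0 (Γ.len e)) :=
    ContinuousOn.mul (by fun_prop) (hf.continuousOn_edgeDeriv2 e)
  rw [← intervalIntegral.integral_add_adjacent_intervals (b := s)
    ((c.mono (Icc_subset_Icc le_rfl hs.2)).intervalIntegrable_of_Icc hs.1)
    ((c.mono (Icc_subset_Icc hs.1 le_rfl)).intervalIntegrable_of_Icc hs.2)]
  have h1 : ∫ t in (0 : ℝ)..s, (min s t - s * t / Γ.len e) * Γ.edgeDeriv2 f e t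
      = ∫ t in (0 : ℝ)..s, (t * (1 - s / Γ.len e)) * Γ.edgeDeriv2 f e t := by
    refine intervalIntegral.integral_congr fun t ht => ?_
    rw [uIcc_of_le hs.1] at ht
    simp only [min_eq_right ht.2]; ring
  have h2 : ∫ t in s..(Γ.len e), (min s t - s * t / Γ.len e) * Γ.edgeDeriv2 f e t
      = ∫ t in s..(Γ.len e), (s + t * (-(s / Γ.len e))) * Γ.edgeDeriv2 f e t := by
    refine intervalIntegral.integral_congr fun t ht => ?_
    rw [uIcc_of_le hs.2] at ht
    simp only [min_eq_left ht.1]; ring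
  rw [h1, h2, hf.green_identity e le_rfl hs.1 hs.2
      (fun t => ((hasDerivAt_id' t).mul_const (1 - s / Γ.len e))) (fun t => hasDerivAt_const t _),
    hf.green_identity e hs.1 hs.2 le_rfl
      (fun t => ((hasDerivAt_id' t).mul_const (-(s / Γ.len e))).const_add s)
      (fun t => hasDerivAt_const t _)]
  rw [interp_edgePt _ hs, edgePt_zero, edgePt_len]

  field_simp
  ring

/-- The Laplace equation `Δ_y greenFn(x, y) = δ_x - (uniform measure on the vertices)`. -/
lemma laplacePairing_greenFn (x : Γ.Pt) {f : Γ.Pt → ℝ} (hf : Γ.IsTest f) :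
    Γ.laplacePairing (Γ.greenFn x) f
      = f x - 1 / (Fintype.card V : ℝ) * ∑ p, f (Γ.vert p) := by
  have hv : ∀ q, Γ.laplacePairing (Γ.interp (Γ.green q)) f
      = f (Γ.vert q) - 1 / (Fintype.card V : ℝ) * ∑ p, f (Γ.vert p) := by
    intro q
    rw [laplacePairing_interp _ hf]
    simp only [netFlow_grad_green, mul_sub, Finset.sum_sub_distrib, ← Finset.sum_mul]
    simp [mul_comm]
  rcases Γ.pt_cases x with ⟨p, rfl⟩ | ⟨e, s, hs, rfl⟩
  · rw [← hv p]
    congr 1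
    funext y
    simp
  · have hs' := Ioo_subset_Icc_self hs
    rw [show Γ.greenFn (Γ.edgePt e s) = fun y => _ from funext (greenFn_edgePt hs'),
      laplacePairing_add (((interp_edgeContinuous _).const_mul _).add
        ((interp_edgeContinuous _).const_mul _)) (bump_edgeContinuous _) hf,
      laplacePairing_add ((interp_edgeContinuous _).const_mul _)
        ((interp_edgeContinuous _).const_mul _) hf,
      laplacePairing_const_mul, laplacePairing_const_mul, hv, hv, laplacePairing_bump hs' hf,
      interp_edgePt _ hs']
    ring

end MetrizedGraph

namespace MetrizedGraph

variable {V : Type*} {E : Type*} [Fintype V] [Fintype E] {Γ : MetrizedGraph V E}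

/-! ### Uniqueness of Green functions -/

lemma interp_hasEdgeDerivs (h : V → ℝ) : HasEdgeDerivs (Γ.interp h)
    (fun e t => h (Γ.src e) + t * -Γ.grad h e) (fun e _ => -Γ.grad h e) (fun _ _ => 0) where
  eqOn e t ht := by
    have := Γ.len_pos e
    rw [interp_edgePt h ht, grad]; field_simp; ring
  deriv e t := (((hasDerivAt_id' t).mul_const _).const_add _).congr_deriv (by ring)
  deriv₁ e t := hasDerivAt_const t _
  cont e := continuous_const

lemma laplacePairing_interp_right (w : Γ.Pt → ℝ) (h : V → ℝ) :
    Γ.laplacePairing w (Γ.interp h) = ∑ p, w (Γ.vert p) * Γ.netFlow (Γ.grad h) p := by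
  rw [(interp_hasEdgeDerivs h).laplacePairing_eq, sum_mul_netFlow (Γ := Γ) (fun p => w (Γ.vert p))]
  refine Finset.sum_congr rfl fun e _ => ?_
  simp; ring

/-- A continuous function that is harmonic in the sense of distributions is constant. -/
lemma eq_of_weaklyHarmonic {w : Γ.Pt → ℝ} (hw : Γ.EdgeContinuous w)
    (h : ∀ f, Γ.IsTest f → Γ.laplacePairing w f = 0) (x y : Γ.Pt) : w x = w y := by
  obtain ⟨o⟩ := Γ.nonempty
  -- Testing with the Green functions of the network shows that `w` is constant on the vertices.
  have hv : ∀ p, w (Γ.vert p) = 1 / (Fintype.card V : ℝ) * ∑ q, w (Γ.vert q) := by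
    intro p
    have := h _ (interp_hasEdgeDerivs (Γ.green p)).isTest
    rw [laplacePairing_interp_right] at this
    simp only [netFlow_grad_green, mul_sub, Finset.sum_sub_distrib, ← Finset.sum_mul] at this
    simp at this
    rw [sub_eq_zero] at this
    rw [this]; ring
  have hv' : ∀ p, w (Γ.vert p) = w (Γ.vert o) := fun p => (hv p).trans (hv o).symm
  let u : Γ.Pt → ℝ := fun x => w x - w (Γ.vert o)
  have hu : Γ.EdgeContinuous u := hw.sub (.const _)
  -- Testing with a function `f` that vanishes at the vertices and has `f'' = u` gives `∫ u² = 0`.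
  let I : E → ℝ → ℝ := fun e t => ∫ s in (0 : ℝ)..t, u (Γ.edgePt e s)
  have hI : ∀ e t, HasDerivAt (I e) (u (Γ.edgePt e t)) t := fun e t =>
    intervalIntegral.integral_hasDerivAt_right ((hu e).intervalIntegrable _ _)
      ((hu e).stronglyMeasurableAtFilter _ _) (hu e).continuousAt
  have hIc : ∀ e, Continuous (I e) := fun e =>
    continuous_iff_continuousAt.2 fun t => (hI e t).continuousAt
  let c : E → ℝ := fun e => (∫ s in (0 : ℝ)..(Γ.len e), I e s) / Γ.len e
  let φ : E → ℝ → ℝ := fun e t => ∫ s in (0 : ℝ)..t, (I e s - c e)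
  have hφc : ∀ e, Continuous fun s => I e s - c e := fun e => (hIc e).sub continuous_const
  have hφ0 : ∀ e, φ e 0 = 0 := fun e => intervalIntegral.integral_same
  have hφL : ∀ e, φ e (Γ.len e) = 0 := fun e => by
    have := (Γ.len_pos e).ne'
    simp only [φ]
    rw [intervalIntegral.integral_sub ((hIc e).intervalIntegrable _ _)
      (continuous_const.intervalIntegrable _ _), intervalIntegral.integral_const]
    simp only [c, smul_eq_mul]; field_simp; ring
  let f : Γ.Pt → ℝ := fun x =>
    Sum.elim (fun _ => 0) (fun p : Σ e : E, Ioo (0 : ℝ) (Γ.len e) => φ p.1 p.2) x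
  have hf : HasEdgeDerivs f φ (fun e s => I e s - c e) (fun e s => u (Γ.edgePt e s)) := by
    refine ⟨fun e t ht => ?_, fun e t => ?_, fun e t => (hI e t).sub_const _, hu⟩
    · rcases ht.1.eq_or_lt with rfl | h0
      · rw [edgePt_zero, hφ0]; rfl
      rcases ht.2.eq_or_lt with rfl | h1
      · rw [edgePt_len, hφL]; rfl
      rw [Γ.edgePt_of_mem ⟨h0, h1⟩]; rfl
    · exact intervalIntegral.integral_hasDerivAt_right ((hφc e).intervalIntegrable _ _)
        ((hφc e).stronglyMeasurableAtFilter _ _) (hφc e).continuousAt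
  have hpair : Γ.laplacePairing u f = 0 := by
    rw [laplacePairing_sub hw (.const _) hf.isTest, h f hf.isTest,
      laplacePairing_const _ hf.isTest, sub_zero]
  have huv : ∀ p, u (Γ.vert p) = 0 := fun p => sub_eq_zero.2 (hv' p)
  rw [hf.laplacePairing_eq] at hpair
  simp only [huv, zero_mul, sub_zero, add_zero, Finset.sum_neg_distrib, neg_eq_zero] at hpair
  have hnn : ∀ e, 0 ≤ ∫ t in (0 : ℝ)..(Γ.len e), u (Γ.edgePt e t) * u (Γ.edgePt e t) := fun e =>
    intervalIntegral.integral_nonneg (Γ.len_pos e).le fun t _ => mul_self_nonneg _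
  have hzero : ∀ x, u x = 0 := by
    intro x
    rcases Γ.pt_cases x with ⟨p, rfl⟩ | ⟨e, t, ht, rfl⟩
    · exact huv p
    by_contra hne
    have h1 := (Finset.sum_eq_zero_iff_of_nonneg fun e _ => hnn e).1 hpair e (Finset.mem_univ e)
    have h2 := intervalIntegral.integral_pos (Γ.len_pos e)
      (((hu e).mul (hu e)).continuousOn) (fun t _ => mul_self_nonneg _)
      ⟨t, Ioo_subset_Icc_self ht, mul_self_pos.2 hne⟩
    exact h2.ne' h1
  have hx := hzero x
  have hy := hzero y
  simp only [u] at hx hy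
  linarith

lemma exists_edge_of_vertex (e₀ : E) (p : V) : ∃ e, Γ.src e = p ∨ Γ.tgt e = p := by
  rcases (Γ.connected p (Γ.src e₀)).cases_head with h | ⟨y, ⟨e, he⟩, _⟩
  · exact ⟨e₀, Or.inl h.symm⟩
  · rcases he with he | he
    · exact ⟨e, Or.inl he.1⟩
    · exact ⟨e, Or.inr he.2⟩

lemma JointlyContinuous.edgeContinuous {G : Γ.Pt → Γ.Pt → ℝ} (hG : Γ.JointlyContinuous G)
    (x : Γ.Pt) : Γ.EdgeContinuous (G x) := by
  intro e'
  obtain ⟨e, s, rfl⟩ : ∃ e s, x = Γ.edgePt e s := by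
    rcases Γ.pt_cases x with ⟨p, rfl⟩ | ⟨e, t, -, rfl⟩
    · obtain ⟨e, rfl | rfl⟩ := exists_edge_of_vertex (Γ := Γ) e' p
      · exact ⟨e, 0, (Γ.edgePt_zero e).symm⟩
      · exact ⟨e, Γ.len e, (Γ.edgePt_len e).symm⟩
    · exact ⟨e, t, rfl⟩
  exact (hG e e').comp (by fun_prop : Continuous fun t : ℝ => (s, t))

variable (Γ) in
/-- The effective resistance between two points of the graph. -/
def ptRes (x y : Γ.Pt) : ℝ := Γ.greenFn x x + Γ.greenFn y y - 2 * Γ.greenFn x y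

lemma effRes_self (p : V) : Γ.effRes p p = 0 := by rw [effRes]; ring

lemma ptRes_vert (p q : V) : Γ.ptRes (Γ.vert p) (Γ.vert q) = Γ.effRes p q := by
  simp [ptRes, effRes]

/-- Any two Green functions, even for different measures, differ by a function of the first variable
plus a function of the second, so they define the same resistance. -/
lemma ptRes_eq_of_laplacianEq {G : Γ.Pt → Γ.Pt → ℝ} {μ : Measure Γ.Pt}
    (hc : Γ.JointlyContinuous G) (hl : ∀ x, Γ.LaplacianEq (G x) x μ) (hs : ∀ x y, G x y = G y x)
    (x y : Γ.Pt) : G x x + G y y - 2 * G x y = Γ.ptRes x y := by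
  have h := eq_of_weaklyHarmonic
    (w := fun z => (G x z - G y z) - (Γ.greenFn x z - Γ.greenFn y z))
    (((hc.edgeContinuous x).sub (hc.edgeContinuous y)).sub
      ((greenFn_edgeContinuous x).sub (greenFn_edgeContinuous y)))
    (fun f hf => by
      rw [laplacePairing_sub ((hc.edgeContinuous x).sub (hc.edgeContinuous y))
          ((greenFn_edgeContinuous x).sub (greenFn_edgeContinuous y)) hf,
        laplacePairing_sub (hc.edgeContinuous x) (hc.edgeContinuous y) hf,
        laplacePairing_sub (greenFn_edgeContinuous x) (greenFn_edgeContinuous y) hf,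
        hl x f hf, hl y f hf, laplacePairing_greenFn x hf, laplacePairing_greenFn y hf]
      ring) x y
  have h1 := hs x y
  have h2 := greenFn_symm x y
  simp only [ptRes] at *
  linarith

/-! ### The resistance to a fixed vertex -/

lemma greenFn_self_edgePt {e : E} {t : ℝ} (ht : t ∈ Icc 0 (Γ.len e)) :
    Γ.greenFn (Γ.edgePt e t) (Γ.edgePt e t)
      = (1 - t / Γ.len e) * Γ.green (Γ.src e) (Γ.src e) + t / Γ.len e * Γ.green (Γ.tgt e) (Γ.tgt e)
        + Γ.edgeMass e * (t - t ^ 2 / Γ.len e) := by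
  have := (Γ.len_pos e).ne'
  rw [greenFn_edgePt ht, interp_edgePt _ ht, interp_edgePt _ ht, bump_edgePt ht ht, edgeMass,
    effRes, Γ.green_symm (Γ.tgt e) (Γ.src e)]
  simp only [if_true, min_self]
  field_simp
  ring

lemma ptRes_vert_edgePt (p : V) {e : E} {t : ℝ} (ht : t ∈ Icc 0 (Γ.len e)) :
    Γ.ptRes (Γ.vert p) (Γ.edgePt e t)
      = (1 - t / Γ.len e) * Γ.effRes p (Γ.src e) + t / Γ.len e * Γ.effRes p (Γ.tgt e)
        + Γ.edgeMass e * (t - t ^ 2 / Γ.len e) := by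
  rw [ptRes, greenFn_self_edgePt ht, greenFn_vert_left, greenFn_vert_left, interp_vert,
    interp_edgePt _ ht, effRes, effRes]
  ring

lemma hasDerivAt_quadratic (a b c t : ℝ) :
    HasDerivAt (fun t : ℝ => a + b * t + c * t ^ 2) (b + 2 * c * t) t := by
  have h1 := ((hasDerivAt_id' t).const_mul b).const_add a
  have h2 := (hasDerivAt_pow 2 t).const_mul c
  exact (h1.add h2).congr_deriv (by push_cast; ring)

lemma HasEdgeDerivs.of_quadratic {f : Γ.Pt → ℝ} (a b c : E → ℝ)
    (h : ∀ e, ∀ t ∈ Icc 0 (Γ.len e), f (Γ.edgePt e t) = a e + b e * t + c e * t ^ 2) :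
    HasEdgeDerivs f (fun e t => a e + b e * t + c e * t ^ 2) (fun e t => b e + 2 * c e * t)
      (fun e _ => 2 * c e) where
  eqOn := h
  deriv e t := hasDerivAt_quadratic _ _ _ t
  deriv₁ e t := (((hasDerivAt_id' t).const_mul (2 * c e)).const_add (b e)).congr_deriv (by ring)
  cont e := continuous_const

lemma integral_quadratic (a b c L : ℝ) :
    ∫ t in (0 : ℝ)..L, (a + b * t + c * t ^ 2) = a * L + b * L ^ 2 / 2 + c * L ^ 3 / 3 := by
  rw [intervalIntegral.integral_eq_sub_of_hasDerivAt
    (f := fun t => a * t + b * t ^ 2 / 2 + c * t ^ 3 / 3)]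
  · simp
  · intro t _
    have h1 := (hasDerivAt_id' t).const_mul a
    have h2 := ((hasDerivAt_pow 2 t).const_mul b).div_const 2
    have h3 := ((hasDerivAt_pow 3 t).const_mul c).div_const 3
    exact ((h1.add h2).add h3).congr_deriv (by push_cast; ring)
  · exact Continuous.intervalIntegrable (by fun_prop) _ _

variable (Γ) in
/-- The energy of the resistance to the vertex `p`. It is four times Baker and Rumely's
tau constant of the graph. -/
def resEnergy (p : V) : ℝ :=
  ∑ e, ((Γ.effRes p (Γ.tgt e) - Γ.effRes p (Γ.src e)) ^ 2 / Γ.len e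
    + Γ.edgeMass e ^ 2 * Γ.len e / 3)

lemma ptRes_hasEdgeDerivs (p : V) : HasEdgeDerivs (Γ.ptRes (Γ.vert p))
    (fun e t => Γ.effRes p (Γ.src e)
      + ((Γ.effRes p (Γ.tgt e) - Γ.effRes p (Γ.src e)) / Γ.len e + Γ.edgeMass e) * t
      + -Γ.edgeMass e / Γ.len e * t ^ 2)
    (fun e t => (Γ.effRes p (Γ.tgt e) - Γ.effRes p (Γ.src e)) / Γ.len e + Γ.edgeMass e
      + 2 * (-Γ.edgeMass e / Γ.len e) * t)
    (fun e _ => 2 * (-Γ.edgeMass e / Γ.len e)) :=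
  HasEdgeDerivs.of_quadratic _ _ _ fun e t ht => by
    rw [ptRes_vert_edgePt p ht]; ring

lemma laplacePairing_ptRes_self (p : V) :
    Γ.laplacePairing (Γ.ptRes (Γ.vert p)) (Γ.ptRes (Γ.vert p)) = Γ.resEnergy p := by
  rw [(ptRes_hasEdgeDerivs p).laplacePairing_eq]
  refine Finset.sum_congr rfl fun e _ => ?_
  have hL := Γ.len_pos e
  rw [intervalIntegral.integral_mul_const, ptRes_vert, ptRes_vert]
  have : ∫ t in (0 : ℝ)..(Γ.len e), Γ.ptRes (Γ.vert p) (Γ.edgePt e t) = _ :=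
    (intervalIntegral.integral_congr fun t ht => by
      rw [uIcc_of_le hL.le] at ht
      exact (ptRes_hasEdgeDerivs p).eqOn e t ht).trans (integral_quadratic _ _ _ _)
  rw [this]
  field_simp
  ring

/-! ### Counting ends of edges -/

lemma sum_degIn (F : Finset E) : ∑ x, Γ.degIn F x = 2 * F.card := by
  simp only [degIn, Finset.sum_add_distrib]
  have key : ∀ s : E → V, ∑ x, (F.filter fun e => s e = x).card = F.card := fun s =>
    (Finset.card_eq_sum_card_fiberwise fun _ _ => Finset.mem_coe.2 (Finset.mem_univ _)).symm
  rw [key, key]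
  ring

end MetrizedGraph

namespace PolarizedGraph

open MetrizedGraph

variable {V : Type*} {E : Type*} [Fintype V] [Fintype E] {Γ : PolarizedGraph V E}

lemma sum_K : ∑ x, Γ.K x = 2 * Γ.genus - 2 := by
  have h := sum_degIn (Γ := Γ.toMetrizedGraph) Finset.univ
  have h' : ∑ x, (Γ.valency x : ℝ) = 2 * Fintype.card E := by
    simp only [valency]; exact_mod_cast h
  simp only [K, Finset.sum_add_distrib, Finset.sum_sub_distrib, h', ← Finset.mul_sum, genus]
  simp; ring

lemma K_nonneg (x : V) : 0 ≤ Γ.K x := Γ.effective x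

lemma one_le_genus (Γ : PolarizedGraph V E) : 1 ≤ Γ.genus := by
  have h := Finset.sum_nonneg fun x (_ : x ∈ Finset.univ) => Γ.effective x
  have := sum_K (Γ := Γ)
  simp only [K] at this
  linarith

/-! ### Reduction of the invariants to resistances -/

variable (Γ) in
/-- The double sum of the resistances between the points of the canonical divisor. -/
def canonicalRes : ℝ := ∑ x, ∑ y, Γ.K x * Γ.K y * Γ.effRes x y

/-- The invariants `φ` and `ε` in terms of resistances: with `S` the value of `canonicalRes` and `T`
that of `resEnergy`, `φ = -ℓ/4 + (5 - 2/g) T/4 + S/(4g)` and `ε = (1 - 1/g) T + S/(2g)`. -/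
lemma IsAdmissible.phi_eps_eq {μ : Measure Γ.Pt} {G : Γ.Pt → Γ.Pt → ℝ} (h : Γ.IsAdmissible μ G)
    (p : V) :
    Γ.phi μ G = -(1 / 4) * Γ.length + (5 - 2 / Γ.genus) * (Γ.resEnergy p / 4)
        + Γ.canonicalRes / (4 * Γ.genus) ∧
      Γ.eps μ G = (1 - 1 / Γ.genus) * Γ.resEnergy p + Γ.canonicalRes / (2 * Γ.genus) := by
  have hg : Γ.genus ≠ 0 := (zero_lt_one.trans_le Γ.one_le_genus).ne'
  have := h.isProb
  obtain ⟨c, hc⟩ := h.adjunction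
  have hec : ∀ x, Γ.EdgeContinuous (G x) := h.continuous.edgeContinuous
  have hKec : Γ.EdgeContinuous fun y => ∑ q, Γ.K q * G (Γ.vert q) y :=
    .sum fun q _ => (hec (Γ.vert q)).const_mul (Γ.K q)
  have hKint : ∫ y, ∑ q, Γ.K q * G (Γ.vert q) y ∂μ = 0 := by
    rw [integral_finsetSum _ fun q _ => ((hec (Γ.vert q)).const_mul (Γ.K q)).integrable μ]
    simp [integral_const_mul, h.integral_eq_zero]
  have hdiag : ∀ x, G x x = c - ∑ q, Γ.K q * G (Γ.vert q) x := fun x => by linarith [hc x]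
  have hk : ∫ x, G x x ∂μ = c := by
    simp only [hdiag]
    rw [integral_sub (integrable_const _) (hKec.integrable μ), hKint]
    simp
  set g := Γ.genus with hgdef
  set D := ∑ q, Γ.K q * G (Γ.vert q) (Γ.vert q) with hD
  set N := ∑ x, ∑ q, Γ.K x * (Γ.K q * G (Γ.vert q) (Γ.vert x)) with hN
  have hsumK : ∑ x, Γ.K x = 2 * g - 2 := sum_K
  have hDN : D = (2 * g - 2) * c - N := by
    rw [hD, hN, ← hsumK, Finset.sum_mul, ← Finset.sum_sub_distrib]
    refine Finset.sum_congr rfl fun x _ => ?_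
    rw [hdiag, mul_sub, Finset.mul_sum]
  have hres : ∀ x y, G x x + G y y - 2 * G x y = Γ.ptRes x y :=
    ptRes_eq_of_laplacianEq h.continuous h.laplacian h.symm
  have hS : Γ.canonicalRes = 2 * (2 * g - 2) * D - 2 * N := by
    have h1 : ∀ x y, Γ.K x * Γ.K y * Γ.effRes x y = Γ.K y * (Γ.K x * G (Γ.vert x) (Γ.vert x))
        + Γ.K x * (Γ.K y * G (Γ.vert y) (Γ.vert y))
        - 2 * (Γ.K x * (Γ.K y * G (Γ.vert y) (Γ.vert x))) := fun x y => by
      rw [← ptRes_vert, ← hres, h.symm (Γ.vert y) (Γ.vert x)]; ring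
    simp only [canonicalRes, h1, Finset.sum_sub_distrib, Finset.sum_add_distrib, ← Finset.mul_sum,
      ← Finset.sum_mul, hsumK]
    rw [← hD, hN]
    simp only [← Finset.mul_sum]
    ring
  -- The energy of `R = r(p, ·)`, computed with the distributional Laplacian of `R`.
  have hT : Γ.resEnergy p = 4 * c + N := by
    have hR : Γ.ptRes (Γ.vert p) = fun y => (G (Γ.vert p) (Γ.vert p) + c)
        - ((∑ q, Γ.K q * G (Γ.vert q) y) + 2 * G (Γ.vert p) y) := by
      funext y
      rw [← hres, hdiag y]; ring
    have hsub : Γ.EdgeContinuous fun y => (∑ q, Γ.K q * G (Γ.vert q) y) + 2 * G (Γ.vert p) y :=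
      hKec.add ((hec _).const_mul 2)
    have hRint : ∫ y, Γ.ptRes (Γ.vert p) y ∂μ = G (Γ.vert p) (Γ.vert p) + c := by
      rw [hR, integral_sub (integrable_const _) (hsub.integrable μ),
        integral_add (hKec.integrable μ) (((hec _).const_mul 2).integrable μ), hKint,
        integral_const_mul, h.integral_eq_zero]
      simp
    have htest := (ptRes_hasEdgeDerivs (Γ := Γ.toMetrizedGraph) p).isTest
    have hpair : Γ.laplacePairing (Γ.ptRes (Γ.vert p)) (Γ.ptRes (Γ.vert p))
        = -(∑ q, Γ.K q * (Γ.effRes p q - (G (Γ.vert p) (Γ.vert p) + c))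
          + 2 * (0 - (G (Γ.vert p) (Γ.vert p) + c))) := by
      conv_lhs => enter [2]; rw [hR]
      rw [laplacePairing_sub (.const _) hsub htest, laplacePairing_const _ htest,
        laplacePairing_add hKec ((hec _).const_mul 2) htest,
        laplacePairing_sum _ (fun q _ => (hec _).const_mul _) htest]
      simp only [laplacePairing_const_mul, h.laplacian _ _ htest, hRint, ptRes_vert]
      rw [effRes_self]
      ring
    have hsum : ∑ q, Γ.K q * Γ.effRes p q
        = (2 * g - 2) * G (Γ.vert p) (Γ.vert p) + D - 2 * (c - G (Γ.vert p) (Γ.vert p)) := by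
      have h1 : c - G (Γ.vert p) (Γ.vert p) = ∑ q, Γ.K q * G (Γ.vert q) (Γ.vert p) := by
        rw [hdiag]; ring
      rw [h1, hD, ← hsumK, Finset.sum_mul, Finset.mul_sum, ← Finset.sum_add_distrib,
        ← Finset.sum_sub_distrib]
      refine Finset.sum_congr rfl fun q _ => ?_
      rw [← ptRes_vert, ← hres, h.symm (Γ.vert q) (Γ.vert p)]; ring
    rw [← laplacePairing_ptRes_self, hpair]
    simp only [mul_sub, Finset.sum_sub_distrib, hsum, ← Finset.sum_mul, hsumK, hDN]
    ring
  refine ⟨?_, ?_⟩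
  · rw [phi, hk, ← hD, ← hgdef, hS, hT, hDN]
    field_simp; ring
  · rw [eps, hk, ← hD, ← hgdef, hS, hT, hDN]
    field_simp; ring

end PolarizedGraph

namespace MetrizedGraph

variable {V : Type*} {E : Type*} [Fintype V] [Fintype E] {Γ : MetrizedGraph V E}

/-! ### Existence of the admissible pair -/

section

variable {f f' : Γ.Pt → ℝ} {φ φ₁ φ₂ φ' φ₁' φ₂' : E → ℝ → ℝ}

lemma HasEdgeDerivs.sub (hf : HasEdgeDerivs f φ φ₁ φ₂) (hf' : HasEdgeDerivs f' φ' φ₁' φ₂') :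
    HasEdgeDerivs (fun x => f x - f' x) (fun e t => φ e t - φ' e t)
      (fun e t => φ₁ e t - φ₁' e t) (fun e t => φ₂ e t - φ₂' e t) where
  eqOn e t ht := by rw [hf.eqOn e t ht, hf'.eqOn e t ht]
  deriv e t := (hf.deriv e t).sub (hf'.deriv e t)
  deriv₁ e t := (hf.deriv₁ e t).sub (hf'.deriv₁ e t)
  cont e := (hf.cont e).sub (hf'.cont e)

lemma HasEdgeDerivs.sub_const (hf : HasEdgeDerivs f φ φ₁ φ₂) (c : ℝ) :
    HasEdgeDerivs (fun x => f x - c) (fun e t => φ e t - c) φ₁ φ₂ where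
  eqOn e t ht := by rw [hf.eqOn e t ht]
  deriv e t := (hf.deriv e t).sub_const c
  deriv₁ := hf.deriv₁
  cont := hf.cont

lemma HasEdgeDerivs.laplacePairing_sub_right (hf : HasEdgeDerivs f φ φ₁ φ₂)
    (hf' : HasEdgeDerivs f' φ' φ₁' φ₂') {h : Γ.Pt → ℝ} (hh : Γ.EdgeContinuous h) :
    Γ.laplacePairing h (fun x => f x - f' x)
      = Γ.laplacePairing h f - Γ.laplacePairing h f' := by
  rw [(hf.sub hf').laplacePairing_eq, hf.laplacePairing_eq, hf'.laplacePairing_eq,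
    ← Finset.sum_sub_distrib]
  refine Finset.sum_congr rfl fun e _ => ?_
  have i : ∀ ψ : ℝ → ℝ, Continuous ψ →
      IntervalIntegrable (fun t => h (Γ.edgePt e t) * ψ t) volume 0 (Γ.len e) := fun ψ hψ =>
    ((hh e).mul hψ).intervalIntegrable _ _
  simp only [mul_sub]
  rw [intervalIntegral.integral_sub (i _ (hf.cont e)) (i _ (hf'.cont e))]
  ring

/-- The pairing is symmetric when its first argument is quadratic on the edges. -/
lemma HasEdgeDerivs.laplacePairing_left {κ : E → ℝ}
    (hf : HasEdgeDerivs f φ φ₁ (fun e _ => κ e)) {h : Γ.Pt → ℝ} (hh : Γ.IsTest h) :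
    Γ.laplacePairing f h = Γ.laplacePairing h f := by
  rw [hf.laplacePairing_eq]
  refine Finset.sum_congr rfl fun e _ => ?_
  have hL := (Γ.len_pos e).le
  have h1 : ∫ t in (0 : ℝ)..(Γ.len e), f (Γ.edgePt e t) * Γ.edgeDeriv2 h e t
      = ∫ t in (0 : ℝ)..(Γ.len e), φ e t * Γ.edgeDeriv2 h e t := by
    refine intervalIntegral.integral_congr fun t ht => ?_
    rw [uIcc_of_le hL] at ht
    simp only [hf.eqOn e t ht]
  rw [h1, hh.green_identity e le_rfl hL le_rfl (hf.deriv e) (hf.deriv₁ e),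
    ← hf.eqOn e _ ⟨le_rfl, hL⟩, ← hf.eqOn e _ ⟨hL, le_rfl⟩, edgePt_zero, edgePt_len,
    intervalIntegral.integral_mul_const]
  ring

end

lemma netFlow_grad_sum {ι : Type*} (s : Finset ι) (h : ι → V → ℝ) (x : V) :
    Γ.netFlow (Γ.grad (∑ i ∈ s, h i)) x = ∑ i ∈ s, Γ.netFlow (Γ.grad (h i)) x := by
  induction s using Finset.induction_on with
  | empty =>
    have : Γ.grad (0 : V → ℝ) = 0 := by ext e; simp [grad]
    simp [this, netFlow_zero]
  | insert a s ha ih =>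
    rw [Finset.sum_insert ha, Finset.sum_insert ha, grad_add, netFlow_add, ih]

/-- The discrete counterpart of the formula for the canonical measure: the Laplacian of the
diagonal of the Green function. -/
lemma netFlow_grad_green_diag (x : V) :
    Γ.netFlow (Γ.grad fun p => Γ.green p p) x = 2 * (1 - 1 / (Fintype.card V : ℝ)) - Γ.valency x
      + ((∑ e ∈ Finset.univ.filter (fun e => Γ.src e = x), Γ.edgeMass e)
        + ∑ e ∈ Finset.univ.filter (fun e => Γ.tgt e = x), Γ.edgeMass e) := by
  have h1 := Γ.netFlow_grad_green x x
  rw [if_pos rfl] at h1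
  rw [← h1, valency, degIn]
  simp only [netFlow]
  have hs : ∑ e ∈ Finset.univ.filter (fun e => Γ.src e = x), Γ.grad (fun p => Γ.green p p) e
      = ∑ e ∈ Finset.univ.filter (fun e => Γ.src e = x),
        (2 * Γ.grad (Γ.green x) e - 1 + Γ.edgeMass e) := by
    refine Finset.sum_congr rfl fun e he => ?_
    have hL := (Γ.len_pos e).ne'
    rw [← (Finset.mem_filter.1 he).2, grad, grad, edgeMass, effRes]
    field_simp; ring
  have ht : ∑ e ∈ Finset.univ.filter (fun e => Γ.tgt e = x), Γ.grad (fun p => Γ.green p p) e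
      = ∑ e ∈ Finset.univ.filter (fun e => Γ.tgt e = x),
        (2 * Γ.grad (Γ.green x) e + 1 - Γ.edgeMass e) := by
    refine Finset.sum_congr rfl fun e he => ?_
    have hL := (Γ.len_pos e).ne'
    rw [← (Finset.mem_filter.1 he).2, grad, grad, edgeMass, effRes,
      Γ.green_symm (Γ.tgt e) (Γ.src e)]
    field_simp; ring
  rw [hs, ht]
  simp only [Finset.sum_add_distrib, Finset.sum_sub_distrib, ← Finset.mul_sum, Finset.sum_const,
    nsmul_eq_mul, mul_one]
  push_cast
  ring

lemma sum_mul_sum_ends (h : V → ℝ) (m : E → ℝ) :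
    ∑ x, h x * ((∑ e ∈ Finset.univ.filter (fun e => Γ.src e = x), m e)
        + ∑ e ∈ Finset.univ.filter (fun e => Γ.tgt e = x), m e)
      = ∑ e, m e * (h (Γ.src e) + h (Γ.tgt e)) := by
  have key : ∀ s : E → V, ∑ x, h x * ∑ e ∈ Finset.univ.filter (fun e => s e = x), m e
      = ∑ e, m e * h (s e) := by
    intro s
    rw [← Finset.sum_fiberwise Finset.univ s (fun e => m e * h (s e))]
    refine Finset.sum_congr rfl fun x _ => ?_
    rw [Finset.mul_sum]
    refine Finset.sum_congr rfl fun e he => ?_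
    rw [(Finset.mem_filter.1 he).2]; ring
  simp only [mul_add, Finset.sum_add_distrib, key]

end MetrizedGraph

namespace PolarizedGraph

open MetrizedGraph

variable {V : Type*} {E : Type*} [Fintype V] [Fintype E] (Γ : PolarizedGraph V E)

/-- The admissible measure: `1/g` times the sum of `q` and of the absolutely continuous part of
the canonical measure of the graph. -/
def admMeasure : Measure Γ.Pt :=
  (∑ x, (Γ.q x / Γ.genus).toNNReal • Measure.dirac (Γ.vert x))
    + ∑ e, (Γ.edgeMass e / (Γ.genus * Γ.len e)).toNNReal •
      (volume.restrict (Ioc 0 (Γ.len e))).map (Γ.edgePt e)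

/-- The potential whose Laplacian is the difference of the admissible measure `μ` and the uniform
measure on the vertices; up to a constant it is `∫ greenFn(x, y) dμ(y)`. The explicit form makes
`G(x, x) + G(K, x)` constant for the Green function `G` corrected by it. -/
def admPotential (x : Γ.Pt) : ℝ :=
  (Γ.greenFn x x + ∑ p, Γ.K p * Γ.greenFn (Γ.vert p) x) / (2 * Γ.genus)

variable {Γ}

lemma genus_pos : 0 < Γ.genus := zero_lt_one.trans_le Γ.one_le_genus

lemma isProbabilityMeasure_admMeasure : IsProbabilityMeasure Γ.admMeasure := by
  constructor
  have hg := genus_pos (Γ := Γ)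
  have hmap : ∀ e, (volume.restrict (Ioc 0 (Γ.len e))).map (Γ.edgePt e) univ
      = ((Γ.len e).toNNReal : ENNReal) := fun e => by
    rw [Measure.map_apply (Γ.measurable_edgePt e) MeasurableSet.univ]
    simp [ENNReal.ofReal]
  have hsum : ∑ x, (Γ.q x / Γ.genus).toNNReal
      + ∑ e, (Γ.edgeMass e / (Γ.genus * Γ.len e)).toNNReal * (Γ.len e).toNNReal = 1 := by
    rw [← NNReal.coe_inj]
    push_cast
    have h1 : ∀ x, ((Γ.q x / Γ.genus).toNNReal : ℝ) = Γ.q x / Γ.genus := fun x =>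
      Real.coe_toNNReal _ (div_nonneg (Γ.q_nonneg x) hg.le)
    have h2 : ∀ e, ((Γ.edgeMass e / (Γ.genus * Γ.len e)).toNNReal : ℝ) * ((Γ.len e).toNNReal : ℝ)
        = Γ.edgeMass e / Γ.genus := fun e => by
      have hL := Γ.len_pos e
      rw [Real.coe_toNNReal _ (div_nonneg (Γ.edgeMass_nonneg e) (mul_pos hg hL).le),
        Real.coe_toNNReal _ hL.le]
      field_simp
    simp only [h1, h2, ← Finset.sum_div, sum_edgeMass, ← add_div]
    rw [div_eq_one_iff_eq hg.ne', genus]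
  simp only [admMeasure, Measure.add_apply, Measure.finsetSum_apply, Measure.smul_apply, hmap,
    measure_univ]
  have h := congrArg ((↑) : NNReal → ENNReal) hsum
  push_cast at h
  simpa [ENNReal.smul_def] using h

lemma integral_admMeasure {f : Γ.Pt → ℝ} (hf : Γ.EdgeContinuous f) :
    ∫ x, f x ∂Γ.admMeasure = (∑ x, Γ.q x / Γ.genus * f (Γ.vert x))
      + ∑ e, Γ.edgeMass e / (Γ.genus * Γ.len e)
        * ∫ t in (0 : ℝ)..(Γ.len e), f (Γ.edgePt e t) := by
  have hg := genus_pos (Γ := Γ)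
  have hfin : ∀ e, IsFiniteMeasure ((volume.restrict (Ioc 0 (Γ.len e))).map (Γ.edgePt e)) :=
    fun e => inferInstance
  have i1 : ∀ x ∈ (Finset.univ : Finset V), Integrable f
      ((Γ.q x / Γ.genus).toNNReal • Measure.dirac (Γ.vert x)) := fun x _ => hf.integrable _
  have i2 : ∀ e ∈ (Finset.univ : Finset E), Integrable f
      ((Γ.edgeMass e / (Γ.genus * Γ.len e)).toNNReal •
        (volume.restrict (Ioc 0 (Γ.len e))).map (Γ.edgePt e)) := fun e _ => hf.integrable _
  rw [admMeasure, integral_add_measure (integrable_finsetSum_measure.2 i1)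
    (integrable_finsetSum_measure.2 i2), integral_finsetSum_measure i1,
    integral_finsetSum_measure i2]
  congr 1
  · refine Finset.sum_congr rfl fun x _ => ?_
    rw [integral_smul_nnreal_measure, integral_dirac' _ _ hf.measurable.stronglyMeasurable,
      NNReal.smul_def, Real.coe_toNNReal _ (div_nonneg (Γ.q_nonneg x) hg.le), smul_eq_mul]
  · refine Finset.sum_congr rfl fun e _ => ?_
    rw [integral_smul_nnreal_measure, integral_map (Γ.measurable_edgePt e).aemeasurable
      hf.measurable.aestronglyMeasurable, NNReal.smul_def,
      Real.coe_toNNReal _ (div_nonneg (Γ.edgeMass_nonneg e) (mul_pos hg (Γ.len_pos e)).le),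
      smul_eq_mul, intervalIntegral.integral_of_le (Γ.len_pos e).le]

lemma netFlow_grad_admPotential (x : V) :
    Γ.netFlow (Γ.grad fun p => Γ.admPotential (Γ.vert p)) x
      = Γ.q x / Γ.genus - 1 / (Fintype.card V : ℝ)
        + 1 / (2 * Γ.genus) * ((∑ e ∈ Finset.univ.filter (fun e => Γ.src e = x), Γ.edgeMass e)
          + ∑ e ∈ Finset.univ.filter (fun e => Γ.tgt e = x), Γ.edgeMass e) := by
  have hg := (genus_pos (Γ := Γ)).ne'
  have hn := Γ.card_pos.ne'
  have h1 : (fun p => Γ.admPotential (Γ.vert p))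
      = (1 / (2 * Γ.genus)) • ((fun p => Γ.green p p) + ∑ q, Γ.K q • Γ.green q) := by
    ext p
    simp only [admPotential, greenFn_vert_left, interp_vert, Pi.smul_apply, Pi.add_apply,
      Finset.sum_apply, smul_eq_mul]
    ring
  have h2 : Γ.netFlow (Γ.grad (∑ q, Γ.K q • Γ.green q)) x
      = Γ.K x - (2 * Γ.genus - 2) / (Fintype.card V : ℝ) := by
    rw [netFlow_grad_sum]
    simp only [grad_smul, netFlow_smul, netFlow_grad_green, mul_sub, Finset.sum_sub_distrib,
      ← Finset.sum_mul, sum_K]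
    simp
    ring
  rw [h1, grad_smul, netFlow_smul, grad_add, netFlow_add, netFlow_grad_green_diag, h2, K]
  field_simp
  ring

lemma admPotential_hasEdgeDerivs : HasEdgeDerivs Γ.admPotential
    (fun e t => Γ.admPotential (Γ.vert (Γ.src e))
      + (-Γ.grad (fun p => Γ.admPotential (Γ.vert p)) e + Γ.edgeMass e / (2 * Γ.genus)) * t
      + -Γ.edgeMass e / (2 * Γ.genus * Γ.len e) * t ^ 2)
    (fun e t => -Γ.grad (fun p => Γ.admPotential (Γ.vert p)) e + Γ.edgeMass e / (2 * Γ.genus)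
      + 2 * (-Γ.edgeMass e / (2 * Γ.genus * Γ.len e)) * t)
    (fun e _ => 2 * (-Γ.edgeMass e / (2 * Γ.genus * Γ.len e))) :=
  HasEdgeDerivs.of_quadratic _ _ _ fun e t ht => by
    have hg := (genus_pos (Γ := Γ)).ne'
    have hL := (Γ.len_pos e).ne'
    have h1 : ∑ p, Γ.K p * Γ.greenFn (Γ.vert p) (Γ.edgePt e t)
        = (1 - t / Γ.len e) * (∑ p, Γ.K p * Γ.green p (Γ.src e))
          + t / Γ.len e * (∑ p, Γ.K p * Γ.green p (Γ.tgt e)) := by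
      rw [Finset.mul_sum, Finset.mul_sum, ← Finset.sum_add_distrib]
      refine Finset.sum_congr rfl fun p _ => ?_
      rw [greenFn_vert_left, interp_edgePt _ ht]; ring
    rw [admPotential, h1, greenFn_self_edgePt ht]
    simp only [admPotential, grad, greenFn_vert_left, interp_vert]
    field_simp
    ring

lemma admPotential_edgeContinuous : Γ.EdgeContinuous Γ.admPotential :=
  (admPotential_hasEdgeDerivs (Γ := Γ)).isTest.edgeContinuous

/-- The Laplacian of the potential is the difference of the admissible measure and the uniform
measure on the vertices. -/
lemma laplacePairing_admPotential {h : Γ.Pt → ℝ} (hh : Γ.EdgeContinuous h) :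
    Γ.laplacePairing h Γ.admPotential
      = ∫ x, h x ∂Γ.admMeasure - 1 / (Fintype.card V : ℝ) * ∑ p, h (Γ.vert p) := by
  have hg := (genus_pos (Γ := Γ)).ne'
  rw [integral_admMeasure hh, admPotential_hasEdgeDerivs.laplacePairing_eq]
  have h1 := Γ.sum_mul_netFlow (fun p => h (Γ.vert p))
    (Γ.grad fun p => Γ.admPotential (Γ.vert p))
  simp only [netFlow_grad_admPotential, mul_add, mul_sub, Finset.sum_add_distrib,
    Finset.sum_sub_distrib] at h1
  have h2 := sum_mul_sum_ends (Γ := Γ.toMetrizedGraph) (fun p => h (Γ.vert p)) Γ.edgeMass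
  simp only [mul_add, Finset.sum_add_distrib] at h2
  have h3 : ∀ e, (-(∫ t in (0 : ℝ)..(Γ.len e), h (Γ.edgePt e t)
        * (2 * (-Γ.edgeMass e / (2 * Γ.genus * Γ.len e))))
      - h (Γ.vert (Γ.src e)) * (-Γ.grad (fun p => Γ.admPotential (Γ.vert p)) e
          + Γ.edgeMass e / (2 * Γ.genus) + 2 * (-Γ.edgeMass e / (2 * Γ.genus * Γ.len e)) * 0)
      + h (Γ.vert (Γ.tgt e)) * (-Γ.grad (fun p => Γ.admPotential (Γ.vert p)) e
          + Γ.edgeMass e / (2 * Γ.genus)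
          + 2 * (-Γ.edgeMass e / (2 * Γ.genus * Γ.len e)) * Γ.len e))
      = Γ.edgeMass e / (Γ.genus * Γ.len e) * (∫ t in (0 : ℝ)..(Γ.len e), h (Γ.edgePt e t))
        + (h (Γ.vert (Γ.src e)) - h (Γ.vert (Γ.tgt e)))
          * Γ.grad (fun p => Γ.admPotential (Γ.vert p)) e
        - 1 / (2 * Γ.genus) * (Γ.edgeMass e * h (Γ.vert (Γ.src e))
          + Γ.edgeMass e * h (Γ.vert (Γ.tgt e))) := fun e => by
    have hL := (Γ.len_pos e).ne'
    rw [intervalIntegral.integral_mul_const]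
    field_simp
    ring
  simp only [h3, Finset.sum_add_distrib, Finset.sum_sub_distrib, ← h1, ← Finset.mul_sum]
  have h4 : ∀ s : V → ℝ, ∑ x, h (Γ.vert x) * (1 / (2 * Γ.genus) * s x)
      = 1 / (2 * Γ.genus) * ∑ x, h (Γ.vert x) * s x := fun s => by
    rw [Finset.mul_sum]
    exact Finset.sum_congr rfl fun _ _ => by ring
  have h5 : ∑ x, h (Γ.vert x) * (Γ.q x / Γ.genus) = ∑ x, Γ.q x / Γ.genus * h (Γ.vert x) :=
    Finset.sum_congr rfl fun _ _ => mul_comm _ _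
  have h6 : ∑ x, h (Γ.vert x) * (1 / (Fintype.card V : ℝ))
      = 1 / (Fintype.card V : ℝ) * ∑ x, h (Γ.vert x) := by
    rw [← Finset.sum_mul, mul_comm]
  rw [h4, h4, h5, h6]
  linear_combination (1 / (2 * Γ.genus)) * h2

lemma exists_isAdmissible : ∃ (μ : Measure Γ.Pt) (G : Γ.Pt → Γ.Pt → ℝ), Γ.IsAdmissible μ G := by
  have hg := (genus_pos (Γ := Γ)).ne'
  have hprob := isProbabilityMeasure_admMeasure (Γ := Γ)
  obtain ⟨o⟩ := Γ.nonempty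
  let H : Γ.Pt → Γ.Pt → ℝ := fun x y => Γ.greenFn x y - Γ.admPotential y - Γ.admPotential x
  have hHs : ∀ x y, H x y = H y x := fun x y => by
    simp only [H]; rw [greenFn_symm x y]; ring
  have hgs : ∀ x, Γ.EdgeContinuous fun y => Γ.greenFn x y - Γ.admPotential y := fun x =>
    (greenFn_edgeContinuous x).sub admPotential_edgeContinuous
  have hHc : ∀ x, Γ.EdgeContinuous (H x) := fun x => (hgs x).sub (.const _)
  have hHl : ∀ x, Γ.LaplacianEq (H x) x Γ.admMeasure := by
    intro x f hf
    rw [laplacePairing_sub (hgs x) (.const _) hf, laplacePairing_const _ hf,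
      laplacePairing_sub (greenFn_edgeContinuous x) admPotential_edgeContinuous hf,
      laplacePairing_greenFn x hf, admPotential_hasEdgeDerivs.laplacePairing_left hf,
      laplacePairing_admPotential hf.edgeContinuous]
    ring
  -- The Laplace equation for `H(x, ·)`, tested with `H(o, ·)`, shows that the mean of `H(x, ·)`
  -- does not depend on `x`.
  have hmean : ∀ x, ∫ y, H x y ∂Γ.admMeasure = ∫ y, H (Γ.vert o) y ∂Γ.admMeasure := by
    intro x
    have hd := (interp_hasEdgeDerivs (Γ := Γ.toMetrizedGraph) (Γ.green o)).sub
      (admPotential_hasEdgeDerivs (Γ := Γ))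
    have hd' := hd.sub_const (Γ.admPotential (Γ.vert o))
    have hHo : H (Γ.vert o) = fun y => Γ.interp (Γ.green o) y - Γ.admPotential y
        - Γ.admPotential (Γ.vert o) := by
      funext y; simp only [H, greenFn_vert_left]
    have h1 := hHl x (H (Γ.vert o)) (by rw [hHo]; exact hd'.isTest)
    have h2 : Γ.laplacePairing (H x) (H (Γ.vert o))
        = H x (Γ.vert o) - ∫ y, H x y ∂Γ.admMeasure := by
      rw [hHo, hd'.laplacePairing_eq, ← hd.laplacePairing_eq,
        (interp_hasEdgeDerivs (Γ.green o)).laplacePairing_sub_right admPotential_hasEdgeDerivs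
          (hHc x), laplacePairing_interp_right, laplacePairing_admPotential (hHc x)]
      simp only [netFlow_grad_green, mul_sub, Finset.sum_sub_distrib, ← Finset.sum_mul]
      simp
      ring
    have h3 := hHs x (Γ.vert o)
    linarith
  set c := ∫ y, H (Γ.vert o) y ∂Γ.admMeasure with hc
  refine ⟨Γ.admMeasure, fun x y => H x y - c, hprob, ?_, fun x y => by rw [hHs], ?_, ?_, ?_⟩
  · intro e e'
    have h1 := greenFn_jointlyContinuous (Γ := Γ.toMetrizedGraph) e e'
    have h2 := (admPotential_edgeContinuous (Γ := Γ) e').comp (continuous_snd (X := ℝ))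
    have h3 := (admPotential_edgeContinuous (Γ := Γ) e).comp (continuous_fst (Y := ℝ))
    exact ((h1.sub h2).sub h3).sub continuous_const
  · intro x f hf
    rw [laplacePairing_sub (hHc x) (.const c) hf, laplacePairing_const _ hf, sub_zero]
    exact hHl x f hf
  · intro x
    rw [integral_sub ((hHc x).integrable _) (integrable_const _), hmean x]
    simp
  · refine ⟨-(∑ p, Γ.K p * Γ.admPotential (Γ.vert p)) - (2 * Γ.genus - 1) * c, fun x => ?_⟩
    have h1 : ∑ p, Γ.K p * (H (Γ.vert p) x - c)
        = (∑ p, Γ.K p * Γ.greenFn (Γ.vert p) x) - (2 * Γ.genus - 2) * (Γ.admPotential x + c)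
          - ∑ p, Γ.K p * Γ.admPotential (Γ.vert p) := by
      rw [← sum_K, Finset.sum_mul, ← Finset.sum_sub_distrib, ← Finset.sum_sub_distrib]
      refine Finset.sum_congr rfl fun p _ => ?_
      simp only [H]; ring
    have h2 : 2 * Γ.genus * Γ.admPotential x
        = Γ.greenFn x x + ∑ p, Γ.K p * Γ.greenFn (Γ.vert p) x := by
      rw [admPotential]; field_simp
    simp only [h1, H]
    linear_combination -h2

end PolarizedGraph

namespace MetrizedGraph

/-! ### Functions on sets of edges -/

section

variable {E : Type*}

/-- Extension by zero of a function on a set of edges, as a linear map. -/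
def extendZero (F : Finset E) : (F → ℝ) →ₗ[ℝ] (E → ℝ) where
  toFun φ e := if h : e ∈ F then φ ⟨e, h⟩ else 0
  map_add' φ ψ := by ext e; by_cases h : e ∈ F <;> simp [h]
  map_smul' c φ := by ext e; by_cases h : e ∈ F <;> simp [h]

lemma extendZero_of_mem {F : Finset E} (φ : F → ℝ) {e : E} (h : e ∈ F) :
    extendZero F φ e = φ ⟨e, h⟩ := dif_pos h

lemma extendZero_of_notMem {F : Finset E} (φ : F → ℝ) {e : E} (h : e ∉ F) :
    extendZero F φ e = 0 := dif_neg h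

/-- The restriction of a flow to a set of edges. -/
def restrict (C : Finset E) (θ : E → ℝ) (e : E) : ℝ := if e ∈ C then θ e else 0

lemma restrict_of_mem {C : Finset E} {e : E} (he : e ∈ C) (θ : E → ℝ) :
    restrict C θ e = θ e := if_pos he

lemma restrict_of_notMem {C : Finset E} {e : E} (he : e ∉ C) (θ : E → ℝ) :
    restrict C θ e = 0 := if_neg he

lemma restrict_add (C : Finset E) (θ η : E → ℝ) :
    restrict C (θ + η) = restrict C θ + restrict C η := by
  ext e; by_cases h : e ∈ C <;> simp [restrict, h]

lemma restrict_sub (C : Finset E) (θ η : E → ℝ) :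
    restrict C (θ - η) = restrict C θ - restrict C η := by
  ext e; by_cases h : e ∈ C <;> simp [restrict, h]

lemma restrict_eq_self {C : Finset E} {θ : E → ℝ} (h : ∀ e, e ∉ C → θ e = 0) :
    restrict C θ = θ := by
  ext e; by_cases he : e ∈ C <;> simp [restrict, he, h]

/-- The balance of a flow at a vertex of valency two, with outgoing edges `A` and incoming edges
`B`: the flow has the same absolute value on both ends. -/
lemma abs_eq_of_card_add_card_eq_two {ι : Type*} {A B : Finset ι} (h : A.card + B.card = 2)
    {φ : ι → ℝ} (hφ : ∑ e ∈ A, φ e - ∑ e ∈ B, φ e = 0) {e e' : ι} (he : e ∈ A ∨ e ∈ B)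
    (he' : e' ∈ A ∨ e' ∈ B) : |φ e| = |φ e'| := by
  have hA : A.card ≤ 2 := by omega
  interval_cases hA' : A.card
  · rw [Finset.card_eq_zero] at hA'
    obtain ⟨a, b, hab, rfl⟩ := Finset.card_eq_two.1 (by omega : B.card = 2)
    rw [hA', Finset.sum_empty, Finset.sum_pair hab] at hφ
    have : φ b = -φ a := by linarith
    simp only [hA', Finset.notMem_empty, false_or, Finset.mem_insert,
      Finset.mem_singleton] at he he'
    rcases he with rfl | rfl <;> rcases he' with rfl | rfl <;> simp [this]
  · obtain ⟨a, rfl⟩ := Finset.card_eq_one.1 hA'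
    obtain ⟨b, rfl⟩ := Finset.card_eq_one.1 (by omega : B.card = 1)
    rw [Finset.sum_singleton, Finset.sum_singleton] at hφ
    have : φ b = φ a := by linarith
    simp only [Finset.mem_singleton] at he he'
    rcases he with rfl | rfl <;> rcases he' with rfl | rfl <;> simp [this]
  · have hB : B = ∅ := Finset.card_eq_zero.1 (by omega)
    obtain ⟨a, b, hab, rfl⟩ := Finset.card_eq_two.1 hA'
    rw [hB, Finset.sum_empty, Finset.sum_pair hab] at hφ
    have : φ b = -φ a := by linarith
    simp only [hB, Finset.notMem_empty, or_false, Finset.mem_insert,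
      Finset.mem_singleton] at he he'
    rcases he with rfl | rfl <;> rcases he' with rfl | rfl <;> simp [this]

end

variable {V : Type*} {E : Type*} [Fintype V] [Fintype E] {Γ : MetrizedGraph V E}

/-! ### Paths and path flows -/

lemma Reach.refl (F : Finset E) (a : V) : Γ.Reach F a a := Relation.ReflTransGen.refl

lemma Reach.trans {F : Finset E} {a b c : V} (h : Γ.Reach F a b) (h' : Γ.Reach F b c) :
    Γ.Reach F a c := Relation.ReflTransGen.trans h h'

lemma Reach.symm {F : Finset E} {a b : V} (h : Γ.Reach F a b) : Γ.Reach F b a := by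
  induction h with
  | refl => exact .refl _ _
  | tail _ hstep ih =>
    obtain ⟨e, he, h⟩ := hstep
    exact Relation.ReflTransGen.head ⟨e, he, h.symm⟩ ih

lemma reach_edge {F : Finset E} {e : E} (he : e ∈ F) : Γ.Reach F (Γ.src e) (Γ.tgt e) :=
  Relation.ReflTransGen.single ⟨e, he, Or.inl ⟨rfl, rfl⟩⟩

lemma reach_src_iff {F : Finset E} {e : E} (he : e ∈ F) (a : V) :
    Γ.Reach F a (Γ.src e) ↔ Γ.Reach F a (Γ.tgt e) :=
  ⟨fun h => h.trans (reach_edge he), fun h => h.trans (reach_edge he).symm⟩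

lemma netFlow_single (e : E) (x : V) : Γ.netFlow (Pi.single e 1) x
    = (if x = Γ.src e then 1 else 0) - (if x = Γ.tgt e then 1 else 0) := by
  simp only [netFlow, Finset.sum_pi_single', Finset.mem_filter, Finset.mem_univ, true_and,
    eq_comm (a := x)]

lemma Reach.exists_flow {F : Finset E} {a b : V} (h : Γ.Reach F a b) :
    ∃ θ : E → ℝ, (∀ e, e ∉ F → θ e = 0) ∧
      ∀ x, Γ.netFlow θ x = (if x = a then 1 else 0) - (if x = b then 1 else 0) := by
  induction h with
  | refl => exact ⟨0, fun _ _ => rfl, fun x => by rw [netFlow_zero]; ring⟩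
  | tail _ hstep ih =>
    obtain ⟨θ, h0, hθ⟩ := ih
    obtain ⟨e, he, hst⟩ := hstep
    have hs : ∀ e', e' ∉ F → (Pi.single e 1 : E → ℝ) e' = 0 := fun e' he' =>
      Pi.single_eq_of_ne (fun h => he' (by rw [h]; exact he)) _
    rcases hst with ⟨rfl, rfl⟩ | ⟨rfl, rfl⟩
    · refine ⟨θ + Pi.single e 1, fun e' he' => ?_, fun x => ?_⟩
      · rw [Pi.add_apply, h0 e' he', hs e' he', add_zero]
      · rw [netFlow_add, hθ, netFlow_single]; ring
    · refine ⟨θ - Pi.single e 1, fun e' he' => ?_, fun x => ?_⟩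
      · rw [Pi.sub_apply, h0 e' he', hs e' he', sub_zero]
      · rw [netFlow_sub, hθ, netFlow_single]; ring

/-! ### Circulations and circles -/

variable (Γ) in
/-- A circulation: a flow without sources and sinks. -/
def IsCirculation (θ : E → ℝ) : Prop := ∀ x, Γ.netFlow θ x = 0

lemma IsCirculation.sub_smul {θ η : E → ℝ} (hθ : Γ.IsCirculation θ) (hη : Γ.IsCirculation η)
    (c : ℝ) : Γ.IsCirculation (θ - c • η) := fun x => by
  rw [netFlow_sub, netFlow_smul, hθ, hη]; ring

lemma netFlow_eq_of_support {F : Finset E} {θ : E → ℝ} (h : ∀ e, e ∉ F → θ e = 0) (x : V) :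
    Γ.netFlow θ x = ∑ e ∈ F.filter (fun e => Γ.src e = x), θ e
      - ∑ e ∈ F.filter (fun e => Γ.tgt e = x), θ e := by
  have key : ∀ s : E → V, ∑ e ∈ Finset.univ.filter (fun e => s e = x), θ e
      = ∑ e ∈ F.filter (fun e => s e = x), θ e := fun s =>
    (Finset.sum_subset (Finset.filter_subset_filter _ (Finset.subset_univ F))
      fun e he he' => h e fun heF =>
        he' (Finset.mem_filter.2 ⟨heF, (Finset.mem_filter.1 he).2⟩)).symm
  rw [netFlow, key, key]

lemma degIn_ne_zero_iff {F : Finset E} {x : V} :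
    Γ.degIn F x ≠ 0 ↔ ∃ e ∈ F, Γ.src e = x ∨ Γ.tgt e = x := by
  rw [degIn, Ne, Nat.add_eq_zero_iff, Finset.card_eq_zero, Finset.card_eq_zero,
    Finset.filter_eq_empty_iff, Finset.filter_eq_empty_iff]
  constructor
  · intro h
    by_contra! h'
    exact h ⟨fun e he => (h' e he).1, fun e he => (h' e he).2⟩
  · rintro ⟨e, he, h | h⟩ ⟨h1, h2⟩
    · exact h1 he h
    · exact h2 he h

lemma netFlow_eq_zero_of_degIn {F : Finset E} {θ : E → ℝ} (h : ∀ e, e ∉ F → θ e = 0) {x : V}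
    (hx : Γ.degIn F x = 0) : Γ.netFlow θ x = 0 := by
  rw [degIn, Nat.add_eq_zero_iff, Finset.card_eq_zero, Finset.card_eq_zero] at hx
  rw [netFlow_eq_of_support h, hx.1, hx.2]; simp

/-- A flow in `F` that is balanced away from one vertex is a circulation. -/
lemma isCirculation_of_forall_ne {F : Finset E} {θ : E → ℝ} (h : ∀ e, e ∉ F → θ e = 0) (x₀ : V)
    (hx : ∀ x, Γ.degIn F x ≠ 0 → x ≠ x₀ → Γ.netFlow θ x = 0) : Γ.IsCirculation θ := by
  have h1 : ∀ x, x ≠ x₀ → Γ.netFlow θ x = 0 := fun x hne => by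
    by_cases hd : Γ.degIn F x = 0
    · exact netFlow_eq_zero_of_degIn h hd
    · exact hx x hd hne
  intro x
  by_cases hne : x = x₀
  · have h2 := Γ.sum_netFlow θ
    rw [Finset.sum_eq_single x₀ (fun y _ hy => h1 y hy) (by simp)] at h2
    rw [hne, h2]
  · exact h1 x hne

variable (Γ) in
/-- `netFlow` at a vertex, as a linear functional. -/
def netFlowₗ (x : V) : (E → ℝ) →ₗ[ℝ] ℝ where
  toFun θ := Γ.netFlow θ x
  map_add' θ η := Γ.netFlow_add θ η x
  map_smul' c θ := Γ.netFlow_smul c θ x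

/-- If a circulation in `F` is determined by its value on one edge, then `F` has at most as many
edges as vertices. -/
lemma card_le_card_verts {F : Finset E} {e₀ : E} (he₀ : e₀ ∈ F)
    (huniq : ∀ φ : E → ℝ, Γ.IsCirculation φ → (∀ e, e ∉ F → φ e = 0) → φ e₀ = 0 → φ = 0) :
    F.card ≤ (Finset.univ.filter fun x => Γ.degIn F x ≠ 0).card := by
  set W := Finset.univ.filter fun x => Γ.degIn F x ≠ 0 with hW
  have hx₀ : Γ.src e₀ ∈ W :=
    Finset.mem_filter.2 ⟨Finset.mem_univ _, degIn_ne_zero_iff.2 ⟨e₀, he₀, Or.inl rfl⟩⟩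
  let T : (F → ℝ) →ₗ[ℝ] (W → ℝ) := LinearMap.pi fun x =>
    if (x : V) = Γ.src e₀ then LinearMap.proj ⟨e₀, he₀⟩ else (Γ.netFlowₗ x).comp (extendZero F)
  have hT : Function.Injective T := by
    rw [injective_iff_map_eq_zero]
    intro φ hφ
    have h1 : ∀ x : W, T φ x = 0 := fun x => by rw [hφ]; rfl
    have h2 : extendZero F φ = 0 := by
      refine huniq _ (isCirculation_of_forall_ne (fun e he => extendZero_of_notMem φ he)
        (Γ.src e₀) fun x hx hne => ?_) (fun e he => extendZero_of_notMem φ he) ?_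
      · have := h1 ⟨x, Finset.mem_filter.2 ⟨Finset.mem_univ _, hx⟩⟩
        simpa [T, hne, netFlowₗ] using this
      · have := h1 ⟨Γ.src e₀, hx₀⟩
        rw [extendZero_of_mem φ he₀]
        simpa [T] using this
    ext e
    have := congrFun h2 e.1
    rwa [extendZero_of_mem φ e.2] at this
  have := LinearMap.finrank_le_finrank_of_injective hT
  simpa using this

/-- If `F` has at least as many edges as vertices, it carries a circulation. -/
lemma exists_circulation_of_card_le {F : Finset E} (hF : F.Nonempty)
    (hcard : (Finset.univ.filter fun x => Γ.degIn F x ≠ 0).card ≤ F.card) :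
    ∃ φ : E → ℝ, Γ.IsCirculation φ ∧ (∀ e, e ∉ F → φ e = 0) ∧ φ ≠ 0 := by
  obtain ⟨e₀, he₀⟩ := hF
  set W := Finset.univ.filter fun x => Γ.degIn F x ≠ 0 with hW
  have hx₀ : Γ.src e₀ ∈ W :=
    Finset.mem_filter.2 ⟨Finset.mem_univ _, degIn_ne_zero_iff.2 ⟨e₀, he₀, Or.inl rfl⟩⟩
  let T : (F → ℝ) →ₗ[ℝ] (W.erase (Γ.src e₀) → ℝ) := LinearMap.pi fun x =>
    (Γ.netFlowₗ x).comp (extendZero F)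
  have hlt : Module.finrank ℝ (W.erase (Γ.src e₀) → ℝ) < Module.finrank ℝ (F → ℝ) := by
    have h1 := Finset.card_erase_lt_of_mem hx₀
    simp only [Module.finrank_fintype_fun_eq_card, Fintype.card_coe]
    omega
  obtain ⟨φ, hφ, hne⟩ := Submodule.exists_mem_ne_zero_of_ne_bot
    (LinearMap.ker_ne_bot_of_finrank_lt (f := T) hlt)
  refine ⟨extendZero F φ, isCirculation_of_forall_ne (fun e he => extendZero_of_notMem φ he)
    (Γ.src e₀) fun x hx hne' => ?_, fun e he => extendZero_of_notMem φ he, fun h => hne ?_⟩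
  · exact congrFun (LinearMap.mem_ker.1 hφ)
      ⟨x, Finset.mem_erase.2 ⟨hne', Finset.mem_filter.2 ⟨Finset.mem_univ _, hx⟩⟩⟩
  · ext e
    have := congrFun h e.1
    rwa [extendZero_of_mem φ e.2] at this

/-- The support of a circulation has no vertex of degree one. -/
lemma IsCirculation.degIn_ne_one {F : Finset E} {σ : E → ℝ} (hσ : Γ.IsCirculation σ)
    (hF : ∀ e, σ e ≠ 0 ↔ e ∈ F) (x : V) : Γ.degIn F x ≠ 1 := by
  intro h
  have h1 := hσ x
  rw [netFlow_eq_of_support (F := F) (fun e he => not_not.1 (mt (hF e).1 he))] at h1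
  rw [degIn, Nat.add_eq_one_iff] at h
  rcases h with ⟨ha, hb⟩ | ⟨ha, hb⟩
  · rw [Finset.card_eq_zero] at ha
    obtain ⟨e, he⟩ := Finset.card_eq_one.1 hb
    have hmem : e ∈ F := (Finset.mem_filter.1 (he ▸ Finset.mem_singleton_self e)).1
    rw [ha, he] at h1
    exact (hF e).2 hmem (by simpa using h1)
  · rw [Finset.card_eq_zero] at hb
    obtain ⟨e, he⟩ := Finset.card_eq_one.1 ha
    have hmem : e ∈ F := (Finset.mem_filter.1 (he ▸ Finset.mem_singleton_self e)).1
    rw [hb, he] at h1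
    exact (hF e).2 hmem (by simpa using h1)

/-- The restriction of a circulation in `F` to a connected component of `F` is a circulation. -/
lemma IsCirculation.restrict_component {F : Finset E} {σ : E → ℝ} (hσ : Γ.IsCirculation σ)
    (hF : ∀ e, e ∉ F → σ e = 0) (a : V) :
    Γ.IsCirculation fun e => if Γ.Reach F a (Γ.src e) then σ e else 0 := by
  intro x
  have h0 : ∀ e, e ∉ F → (if Γ.Reach F a (Γ.src e) then σ e else 0) = 0 := fun e he => by
    rw [hF e he, ite_self]
  have hx := hσ x
  rw [netFlow_eq_of_support hF] at hx
  rw [netFlow_eq_of_support h0]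
  have hite : ∀ D : Finset E, ∑ e ∈ D, (if Γ.Reach F a x then σ e else 0)
      = if Γ.Reach F a x then ∑ e ∈ D, σ e else 0 := fun D => by
    split_ifs
    · rfl
    · exact Finset.sum_const_zero
  have hs : ∑ e ∈ F.filter (fun e => Γ.src e = x), (if Γ.Reach F a (Γ.src e) then σ e else 0)
      = if Γ.Reach F a x then ∑ e ∈ F.filter (fun e => Γ.src e = x), σ e else 0 := by
    refine Eq.trans (Finset.sum_congr rfl fun e he => ?_) (hite _)
    rw [(Finset.mem_filter.1 he).2]
  have ht : ∑ e ∈ F.filter (fun e => Γ.tgt e = x), (if Γ.Reach F a (Γ.src e) then σ e else 0)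
      = if Γ.Reach F a x then ∑ e ∈ F.filter (fun e => Γ.tgt e = x), σ e else 0 := by
    refine Eq.trans (Finset.sum_congr rfl fun e he => ?_) (hite _)
    rw [reach_src_iff (Finset.mem_filter.1 he).1, (Finset.mem_filter.1 he).2]
  rw [hs, ht]
  split_ifs
  · exact hx
  · ring

/-- The support of every nonzero circulation contains a circle: the support of a circulation with
minimal support is one, because a count of dimensions forces all its valencies to be two. -/
lemma IsCirculation.exists_circle {θ : E → ℝ} (hθ : Γ.IsCirculation θ) (hne : θ ≠ 0) :
    ∃ C, Γ.IsCircle C ∧ (∃ σ, Γ.IsCirculation σ ∧ ∀ e, σ e ≠ 0 ↔ e ∈ C) ∧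
      ∀ e ∈ C, θ e ≠ 0 := by
  let S : Finset (Finset E) := Finset.univ.filter fun F => F.Nonempty ∧ (∀ e ∈ F, θ e ≠ 0) ∧
    ∃ σ, Γ.IsCirculation σ ∧ ∀ e, σ e ≠ 0 ↔ e ∈ F
  have hS : S.Nonempty := by
    refine ⟨Finset.univ.filter fun e => θ e ≠ 0, Finset.mem_filter.2 ⟨Finset.mem_univ _, ?_,
      fun e he => (Finset.mem_filter.1 he).2, θ, hθ, fun e => by simp⟩⟩
    obtain ⟨e, he⟩ := Function.ne_iff.1 hne
    exact ⟨e, Finset.mem_filter.2 ⟨Finset.mem_univ _, he⟩⟩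
  obtain ⟨F, hFS, hmin⟩ := S.exists_min_image Finset.card hS
  obtain ⟨-, hFne, hFθ, σ, hσ, hσF⟩ := Finset.mem_filter.1 hFS
  have hσ0 : ∀ e, e ∉ F → σ e = 0 := fun e he => not_not.1 (mt (hσF e).1 he)
  have huniq : ∀ φ : E → ℝ, Γ.IsCirculation φ → (∀ e, e ∉ F → φ e = 0) →
      ∀ e₀ ∈ F, φ e₀ = 0 → φ = 0 := by
    intro φ hφ hφF e₀ he₀ hφe
    by_contra hφne
    obtain ⟨e₁, he₁⟩ := Function.ne_iff.1 hφne
    have hsub : (Finset.univ.filter fun e => φ e ≠ 0) ⊂ F := by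
      refine Finset.ssubset_iff_subset_ne.2 ⟨fun e he => ?_, fun h => ?_⟩
      · by_contra h
        exact (Finset.mem_filter.1 he).2 (hφF e h)
      · rw [← h] at he₀
        exact (Finset.mem_filter.1 he₀).2 hφe
    have hmem : (Finset.univ.filter fun e => φ e ≠ 0) ∈ S :=
      Finset.mem_filter.2 ⟨Finset.mem_univ _,
        ⟨e₁, Finset.mem_filter.2 ⟨Finset.mem_univ _, he₁⟩⟩,
        fun e he => hFθ e (hsub.1 he), φ, hφ, fun e => by simp⟩
    exact absurd (hmin _ hmem) (not_le.2 (Finset.card_lt_card hsub))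
  refine ⟨F, ⟨hFne, ?_, ?_⟩, ⟨σ, hσ, hσF⟩, hFθ⟩
  · obtain ⟨e₀, he₀⟩ := hFne
    set W := Finset.univ.filter fun x => Γ.degIn F x ≠ 0 with hW
    have h1 : F.card ≤ W.card :=
      card_le_card_verts he₀ fun φ hφ hφF => huniq φ hφ hφF e₀ he₀
    have h2 : ∀ x ∈ W, 2 ≤ Γ.degIn F x := fun x hx => by
      have h3 := (Finset.mem_filter.1 hx).2
      have h4 := hσ.degIn_ne_one hσF x
      omega
    have h3 : ∑ x ∈ W, Γ.degIn F x = 2 * F.card := by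
      rw [← sum_degIn (Γ := Γ) F, hW, Finset.sum_filter_ne_zero]
    intro x
    by_contra! hx
    have hxW : x ∈ W := Finset.mem_filter.2 ⟨Finset.mem_univ _, hx.1⟩
    have h4 : ∑ _x ∈ W, 2 < ∑ x ∈ W, Γ.degIn F x :=
      Finset.sum_lt_sum h2 ⟨x, hxW, lt_of_le_of_ne (h2 x hxW) (Ne.symm hx.2)⟩
    rw [h3, Finset.sum_const, smul_eq_mul] at h4
    omega
  · intro x y hx hy
    obtain ⟨e, he, hex⟩ := degIn_ne_zero_iff.1 (by rw [hx]; norm_num : Γ.degIn F x ≠ 0)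
    obtain ⟨e', he', hey⟩ := degIn_ne_zero_iff.1 (by rw [hy]; norm_num : Γ.degIn F y ≠ 0)
    have hxe : Γ.Reach F x (Γ.src e) := by
      rcases hex with rfl | rfl
      · exact .refl _ _
      · exact (reach_edge he).symm
    have h1 := huniq _ ((hσ.restrict_component hσ0 x).sub_smul hσ 1) (fun e he => by
      simp [hσ0 e he]) e he (by simp [hxe])
    have h2 := congrFun h1 e'
    have h3 : Γ.Reach F x (Γ.src e') := by
      by_contra hcon
      simp only [Pi.sub_apply, if_neg hcon, one_smul, Pi.zero_apply, zero_sub, neg_eq_zero] at h2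
      exact (hσF e').2 he' h2
    rcases hey with rfl | rfl
    · exact h3
    · exact h3.trans (reach_edge he')

/-- Circulations are sums of circulations around circles. -/
lemma IsCirculation.induction {P : (E → ℝ) → Prop} (h0 : P 0)
    (hadd : ∀ θ σ C, Γ.IsCirculation θ → Γ.IsCircle C → Γ.IsCirculation σ →
      (∀ e, σ e ≠ 0 ↔ e ∈ C) → P θ → P (θ + σ)) {θ : E → ℝ} (hθ : Γ.IsCirculation θ) : P θ := by
  induction hn : (Finset.univ.filter fun e => θ e ≠ 0).card using Nat.strong_induction_on
    generalizing θ with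
  | _ n ih =>
    by_cases hne : θ = 0
    · rw [hne]; exact h0
    obtain ⟨C, hC, ⟨σ, hσ, hσC⟩, hCθ⟩ := hθ.exists_circle hne
    obtain ⟨e, he⟩ := hC.1
    have hσe := (hσC e).2 he
    set c := θ e / σ e with hc
    have hc0 : c ≠ 0 := div_ne_zero (hCθ e he) hσe
    have hθ' := hθ.sub_smul hσ c
    have hlt : (Finset.univ.filter fun e => (θ - c • σ) e ≠ 0).card < n := by
      rw [← hn]
      refine Finset.card_lt_card (Finset.ssubset_iff_subset_ne.2 ⟨fun f hf => ?_, fun h => ?_⟩)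
      · refine Finset.mem_filter.2 ⟨Finset.mem_univ _, fun hf0 => (Finset.mem_filter.1 hf).2 ?_⟩
        have : f ∉ C := fun h => hCθ f h hf0
        simp [hf0, not_not.1 (mt (hσC f).1 this)]
      · have : e ∈ Finset.univ.filter fun e => θ e ≠ 0 :=
          Finset.mem_filter.2 ⟨Finset.mem_univ _, hCθ e he⟩
        rw [← h] at this
        refine (Finset.mem_filter.1 this).2 ?_
        simp only [Pi.sub_apply, Pi.smul_apply, smul_eq_mul, hc]
        field_simp; ring
    have := hadd _ (c • σ) C hθ' hC (fun x => by rw [netFlow_smul, hσ, mul_zero])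
      (fun f => by simp [hc0, ← hσC f]) (ih _ hlt hθ' rfl)
    simpa using this

/-- A circulation around a circle has constant absolute value. -/
lemma IsCircle.abs_eq {C : Finset E} (hC : Γ.IsCircle C) {φ : E → ℝ} (hφ : Γ.IsCirculation φ)
    (hφC : ∀ e, e ∉ C → φ e = 0) {e e' : E} (he : e ∈ C) (he' : e' ∈ C) : |φ e'| = |φ e| := by
  have hdeg : ∀ f ∈ C, ∀ x, Γ.src f = x ∨ Γ.tgt f = x → Γ.degIn C x = 2 := fun f hf x hx =>
    (hC.2.1 x).resolve_left (degIn_ne_zero_iff.2 ⟨f, hf, hx⟩)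
  have hloc : ∀ x, ∀ f ∈ C, ∀ f' ∈ C, (Γ.src f = x ∨ Γ.tgt f = x) →
      (Γ.src f' = x ∨ Γ.tgt f' = x) → |φ f| = |φ f'| := by
    intro x f hf f' hf' hx hx'
    have h1 := hφ x
    rw [netFlow_eq_of_support hφC] at h1
    exact abs_eq_of_card_add_card_eq_two (hdeg f hf x hx) h1
      (by simpa [hf] using hx) (by simpa [hf'] using hx')
  have key : ∀ x, Γ.Reach C (Γ.src e) x → ∀ f ∈ C, (Γ.src f = x ∨ Γ.tgt f = x) →
      |φ f| = |φ e| := by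
    intro x hx
    induction hx with
    | refl => exact fun f hf hfx => hloc _ f hf e he hfx (Or.inl rfl)
    | tail _ hstep ih =>
      obtain ⟨k, hk, hst⟩ := hstep
      intro f hf hfx
      rw [← ih k hk (by tauto)]
      exact hloc _ f hf k hk hfx (by tauto)
  exact key _ (hC.2.2 _ _ (hdeg e he _ (Or.inl rfl)) (hdeg e' he' _ (Or.inl rfl))) e' he'
    (Or.inl rfl)

/-- A circulation around a circle that vanishes on one edge vanishes. -/
lemma IsCircle.eq_zero {C : Finset E} (hC : Γ.IsCircle C) {φ : E → ℝ} (hφ : Γ.IsCirculation φ)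
    (hφC : ∀ e, e ∉ C → φ e = 0) {e : E} (he : e ∈ C) (h : φ e = 0) : φ = 0 := by
  ext f
  by_cases hf : f ∈ C
  · have := hC.abs_eq hφ hφC he hf
    rw [h, abs_zero, abs_eq_zero] at this
    exact this
  · exact hφC f hf

/-- A circle carries a circulation with values `±1`, its orientation. -/
lemma IsCircle.exists_orientation {C : Finset E} (hC : Γ.IsCircle C) :
    ∃ σ : E → ℝ, Γ.IsCirculation σ ∧ (∀ e, e ∉ C → σ e = 0) ∧ ∀ e ∈ C, σ e ^ 2 = 1 := by
  have hcard : (Finset.univ.filter fun x => Γ.degIn C x ≠ 0).card ≤ C.card := by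
    have h1 : ∑ x ∈ Finset.univ.filter (fun x => Γ.degIn C x ≠ 0), Γ.degIn C x = 2 * C.card :=
      (Finset.sum_filter_ne_zero _).trans (sum_degIn C)
    have h2 : ∑ x ∈ Finset.univ.filter (fun x => Γ.degIn C x ≠ 0), Γ.degIn C x
        = ∑ x ∈ Finset.univ.filter (fun x => Γ.degIn C x ≠ 0), 2 :=
      Finset.sum_congr rfl fun x hx => (hC.2.1 x).resolve_left (Finset.mem_filter.1 hx).2
    rw [h1, Finset.sum_const, smul_eq_mul] at h2
    omega
  obtain ⟨φ, hφ, hφC, hne⟩ := exists_circulation_of_card_le hC.1 hcard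
  obtain ⟨e, he⟩ := hC.1
  have h0 : φ e ≠ 0 := fun h => hne (hC.eq_zero hφ hφC he h)
  refine ⟨(φ e)⁻¹ • φ, fun x => by rw [netFlow_smul, hφ, mul_zero],
    fun f hf => by simp [hφC f hf], fun f hf => ?_⟩
  have h1 := (sq_eq_sq_iff_abs_eq_abs _ _).2 (hC.abs_eq hφ hφC he hf)
  simp only [Pi.smul_apply, smul_eq_mul, mul_pow, h1]
  field_simp

/-! ### Bridges -/

lemma reach_erase_src_or_tgt (e : E) (x : V) :
    Γ.Reach (Finset.univ.erase e) (Γ.src e) x ∨ Γ.Reach (Finset.univ.erase e) (Γ.tgt e) x := by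
  have h := Γ.connected (Γ.src e) x
  induction h with
  | refl => exact Or.inl (.refl _ _)
  | tail _ hstep ih =>
    obtain ⟨f, hf⟩ := hstep
    by_cases hfe : f = e
    · subst hfe
      rcases hf with ⟨-, rfl⟩ | ⟨rfl, -⟩
      · exact Or.inr (.refl _ _)
      · exact Or.inl (.refl _ _)
    · have hmem : f ∈ Finset.univ.erase e := Finset.mem_erase.2 ⟨hfe, Finset.mem_univ _⟩
      rcases hf with ⟨rfl, rfl⟩ | ⟨rfl, rfl⟩
      · exact ih.imp (·.trans (reach_edge hmem)) (·.trans (reach_edge hmem))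
      · exact ih.imp (·.trans (reach_edge hmem).symm) (·.trans (reach_edge hmem).symm)

lemma IsBridge.reach_tgt_iff {e : E} (he : Γ.IsBridge e) (x : V) :
    Γ.Reach (Finset.univ.erase e) (Γ.tgt e) x
      ↔ ¬ Γ.Reach (Finset.univ.erase e) (Γ.src e) x :=
  ⟨fun h h' => he (h'.trans h.symm), fun h => (reach_erase_src_or_tgt e x).resolve_left h⟩

/-- The flow through a bridge equals the net flow out of the side of its source. -/
lemma IsBridge.flow_eq {e : E} (he : Γ.IsBridge e) (θ : E → ℝ) :
    θ e = ∑ x, (if Γ.Reach (Finset.univ.erase e) (Γ.src e) x then 1 else 0) * Γ.netFlow θ x := by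
  rw [sum_mul_netFlow, Finset.sum_eq_single e]
  · rw [if_pos (Reach.refl _ _), if_neg he]; ring
  · intro f _ hf
    have hmem : f ∈ Finset.univ.erase e := Finset.mem_erase.2 ⟨hf, Finset.mem_univ _⟩
    simp only [reach_src_iff hmem, sub_self, zero_mul]
  · simp

lemma IsBridge.circulation_eq_zero {e : E} (he : Γ.IsBridge e) {θ : E → ℝ}
    (hθ : Γ.IsCirculation θ) : θ e = 0 := by
  rw [he.flow_eq θ]
  exact Finset.sum_eq_zero fun x _ => by rw [hθ x, mul_zero]

lemma IsCircle.not_isBridge {C : Finset E} (hC : Γ.IsCircle C) {e : E} (he : e ∈ C) :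
    ¬ Γ.IsBridge e := by
  intro hb
  obtain ⟨σ, hσ, -, hσ1⟩ := hC.exists_orientation
  have := hσ1 e he
  rw [hb.circulation_eq_zero hσ] at this
  norm_num at this

lemma exists_circle_of_not_isBridge {e : E} (he : ¬ Γ.IsBridge e) :
    ∃ C, Γ.IsCircle C ∧ e ∈ C := by
  obtain ⟨θ, hθ, hθf⟩ := (not_not.1 he : Γ.Reach _ _ _).exists_flow
  have hcirc : Γ.IsCirculation (Pi.single e 1 - (1 : ℝ) • θ) := fun x => by
    rw [netFlow_sub, netFlow_smul, netFlow_single, hθf]; ring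
  have h1 : (Pi.single e 1 - (1 : ℝ) • θ : E → ℝ) e ≠ 0 := by simp [hθ e (by simp)]
  refine hcirc.induction (P := fun θ => θ e ≠ 0 → ∃ C, Γ.IsCircle C ∧ e ∈ C) (fun h => ?_)
    (fun θ σ C _ hC _ hσC ih h => ?_) h1
  · exact absurd rfl h
  · by_cases heC : e ∈ C
    · exact ⟨C, hC, heC⟩
    · refine ih fun h0 => h ?_
      simp [h0, not_not.1 (mt (hσC e).1 heC)]

/-! ### Elementary graphs -/

lemma mem_circles {C : Finset E} : C ∈ Γ.circles ↔ Γ.IsCircle C := by simp [circles]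

/-- In an elementary graph, circulations can be restricted to a circle. -/
lemma IsElementary.restrict_circulation (hΓ : Γ.IsElementary) {C : Finset E} (hC : Γ.IsCircle C)
    {θ : E → ℝ} (hθ : Γ.IsCirculation θ) : Γ.IsCirculation (restrict C θ) := by
  refine hθ.induction (P := fun θ => Γ.IsCirculation (restrict C θ)) ?_ ?_
  · intro x
    rw [restrict_eq_self (θ := 0) fun _ _ => rfl, netFlow_zero]
  · intro θ σ C' _ hC' hσ hσC' ih x
    rw [restrict_add, netFlow_add, ih x, zero_add]
    have hσ0 : ∀ e, e ∉ C' → σ e = 0 := fun e he => not_not.1 (mt (hσC' e).1 he)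
    by_cases hCC : C = C'
    · subst hCC
      rw [restrict_eq_self hσ0]
      exact hσ x
    · have : restrict C σ = 0 := by
        ext e
        by_cases he : e ∈ C
        · rw [restrict_of_mem he]
          exact hσ0 e fun he' => hCC (hΓ C (mem_circles.2 hC) C' (mem_circles.2 hC') e he he')
        · exact restrict_of_notMem he σ
      rw [this, netFlow_zero]

/-- In an elementary graph, the edges are the bridges and the edges of the circles, each in one
circle. -/
lemma IsElementary.sum_edges (hΓ : Γ.IsElementary) (f : E → ℝ) :
    ∑ e, f e = ∑ e ∈ Finset.univ.filter (fun e => Γ.IsBridge e), f e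
      + ∑ C ∈ Γ.circles, ∑ e ∈ C, f e := by
  rw [← Finset.sum_filter_add_sum_filter_not Finset.univ (fun e => Γ.IsBridge e)]
  congr 1
  rw [← Finset.sum_biUnion]
  · refine Finset.sum_congr ?_ fun _ _ => rfl
    ext e
    simp only [Finset.mem_filter, Finset.mem_univ, true_and, Finset.mem_biUnion, mem_circles]
    constructor
    · intro h
      obtain ⟨C, hC, he⟩ := exists_circle_of_not_isBridge h
      exact ⟨C, hC, he⟩
    · rintro ⟨C, hC, he⟩
      exact hC.not_isBridge he
  · intro C hC C' hC' hne
    rw [Function.onFun, Finset.disjoint_left]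
    exact fun e he he' => hne (hΓ C hC C' hC' e he he')

end MetrizedGraph

namespace MetrizedGraph

variable {V : Type*} {E : Type*} [Fintype V] [Fintype E] {Γ : MetrizedGraph V E}

/-! ### Currents in elementary graphs -/

lemma current_isCirculation_sub {a b : V} {θ : E → ℝ}
    (hθ : ∀ x, Γ.netFlow θ x = (if x = a then 1 else 0) - (if x = b then 1 else 0)) :
    Γ.IsCirculation (Γ.current a b - θ) := fun x => by
  rw [netFlow_sub, netFlow_current, hθ, sub_self]

/-- The current between two points that are joined outside a circle does not enter the circle. -/
lemma IsElementary.current_eq_zero (hΓ : Γ.IsElementary) {C : Finset E} (hC : Γ.IsCircle C)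
    {a b : V} (hab : Γ.Reach (Finset.univ \ C) a b) {e : E} (he : e ∈ C) :
    Γ.current a b e = 0 := by
  obtain ⟨θ, hθC, hθ⟩ := hab.exists_flow
  have hθ0 : restrict C θ = 0 := by
    ext f
    by_cases hf : f ∈ C
    · rw [restrict_of_mem hf, hθC f (by simp [hf]), Pi.zero_apply]
    · exact restrict_of_notMem hf θ
  have hcirc : Γ.IsCirculation (restrict C (Γ.current a b)) := by
    have := hΓ.restrict_circulation hC (current_isCirculation_sub hθ)
    rwa [restrict_sub, hθ0, sub_zero] at this
  have hen := Γ.sum_len_current_mul a b (restrict C (Γ.current a b))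
  simp only [hcirc _, mul_zero, Finset.sum_const_zero] at hen
  have hnn : ∀ f ∈ (Finset.univ : Finset E),
      0 ≤ Γ.len f * (Γ.current a b f * restrict C (Γ.current a b) f) := fun f _ => by
    refine mul_nonneg (Γ.len_pos f).le ?_
    by_cases hf : f ∈ C
    · rw [restrict_of_mem hf]; exact mul_self_nonneg _
    · rw [restrict_of_notMem hf, mul_zero]
  have h1 := (Finset.sum_eq_zero_iff_of_nonneg hnn).1 hen e (Finset.mem_univ e)
  rw [restrict_of_mem he] at h1
  simpa [(Γ.len_pos e).ne'] using h1

/-- The current between two vertices of a circle restricts to a unit flow in the circle. -/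
lemma IsElementary.netFlow_restrict_current (hΓ : Γ.IsElementary) {C : Finset E}
    (hC : Γ.IsCircle C) {a b : V} (ha : Γ.degIn C a = 2) (hb : Γ.degIn C b = 2) (x : V) :
    Γ.netFlow (restrict C (Γ.current a b)) x
      = (if x = a then 1 else 0) - (if x = b then 1 else 0) := by
  obtain ⟨θ, hθC, hθ⟩ := (hC.2.2 a b ha hb).exists_flow
  have := hΓ.restrict_circulation hC (current_isCirculation_sub hθ) x
  rw [restrict_sub, netFlow_sub, restrict_eq_self hθC, hθ] at this
  linarith

lemma sum_len_restrict (C : Finset E) (θ η : E → ℝ) :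
    ∑ e, Γ.len e * (θ e * restrict C η e) = ∑ e ∈ C, Γ.len e * (θ e * η e) := by
  simp only [restrict, mul_ite, mul_zero, Finset.sum_ite_mem, Finset.univ_inter]

/-- Thomson's principle: the current between two vertices of a circle minimizes the energy among
the unit flows in the circle. -/
lemma IsElementary.resistance_eq (hΓ : Γ.IsElementary) {C : Finset E} (hC : Γ.IsCircle C)
    {a b : V} (ha : Γ.degIn C a = 2) (hb : Γ.degIn C b = 2) :
    Γ.resistance C a b = ∑ e ∈ C, Γ.len e * Γ.current a b e ^ 2 := by
  set I := restrict C (Γ.current a b) with hI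
  have hInet := hΓ.netFlow_restrict_current hC ha hb
  have hIen : ∑ e, Γ.len e * I e ^ 2 = ∑ e ∈ C, Γ.len e * Γ.current a b e ^ 2 := by
    simp only [pow_two]
    rw [sum_len_restrict]
    exact Finset.sum_congr rfl fun e he => by rw [hI, restrict_of_mem he]
  have hleast : IsLeast {w : ℝ | ∃ θ : E → ℝ, (∀ e, e ∉ C → θ e = 0) ∧
      (∀ x, Γ.netFlow θ x = (if x = a then 1 else 0) - (if x = b then 1 else 0)) ∧
      w = ∑ e, Γ.len e * θ e ^ 2} (∑ e ∈ C, Γ.len e * Γ.current a b e ^ 2) := by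
    refine ⟨⟨I, fun e he => restrict_of_notMem he _, hInet, hIen.symm⟩, ?_⟩
    rintro w ⟨θ, hθC, hθ, rfl⟩
    have hz : Γ.IsCirculation (θ - I) := fun x => by rw [netFlow_sub, hθ, hInet, sub_self]
    have hzC : restrict C (θ - I) = θ - I := restrict_eq_self fun e he => by
      rw [Pi.sub_apply, hθC e he, hI, restrict_of_notMem he, sub_zero]
    have horth : ∑ e, Γ.len e * (I e * (θ - I) e) = 0 := by
      have h1 := Γ.sum_len_current_mul a b (θ - I)
      simp only [hz _, mul_zero, Finset.sum_const_zero] at h1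
      rw [← h1]
      refine Finset.sum_congr rfl fun e _ => ?_
      by_cases he : e ∈ C
      · rw [hI, restrict_of_mem he]
      · rw [← hzC, restrict_of_notMem he]; ring
    rw [← hIen]
    have h2 : ∑ e, Γ.len e * θ e ^ 2
        = ∑ e, Γ.len e * I e ^ 2 + 2 * ∑ e, Γ.len e * (I e * (θ - I) e)
          + ∑ e, Γ.len e * (θ - I) e ^ 2 := by
      rw [Finset.mul_sum, ← Finset.sum_add_distrib, ← Finset.sum_add_distrib]
      refine Finset.sum_congr rfl fun e _ => ?_
      simp only [Pi.sub_apply]; ring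
    have h3 : 0 ≤ ∑ e, Γ.len e * (θ - I) e ^ 2 :=
      Finset.sum_nonneg fun e _ => mul_nonneg (Γ.len_pos e).le (sq_nonneg _)
    rw [h2, horth]
    linarith
  exact hleast.csInf_eq

lemma IsElementary.resistance_nonneg (hΓ : Γ.IsElementary) {C : Finset E} (hC : Γ.IsCircle C)
    {a b : V} (ha : Γ.degIn C a = 2) (hb : Γ.degIn C b = 2) : 0 ≤ Γ.resistance C a b := by
  rw [hΓ.resistance_eq hC ha hb]
  exact Finset.sum_nonneg fun e _ => mul_nonneg (Γ.len_pos e).le (sq_nonneg _)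

lemma IsElementary.resistance_self (hΓ : Γ.IsElementary) {C : Finset E} (hC : Γ.IsCircle C)
    {a : V} (ha : Γ.degIn C a = 2) : Γ.resistance C a a = 0 := by
  rw [hΓ.resistance_eq hC ha ha]
  simp [current]

lemma IsElementary.resistance_pos (hΓ : Γ.IsElementary) {C : Finset E} (hC : Γ.IsCircle C)
    {a b : V} (ha : Γ.degIn C a = 2) (hb : Γ.degIn C b = 2) (hab : a ≠ b) :
    0 < Γ.resistance C a b := by
  refine lt_of_le_of_ne (hΓ.resistance_nonneg hC ha hb) fun h0 => ?_
  rw [hΓ.resistance_eq hC ha hb, eq_comm, Finset.sum_eq_zero_iff_of_nonneg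
    fun e _ => mul_nonneg (Γ.len_pos e).le (sq_nonneg _)] at h0
  have h1 : restrict C (Γ.current a b) = 0 := by
    ext e
    by_cases he : e ∈ C
    · rw [restrict_of_mem he]
      simpa [(Γ.len_pos e).ne'] using h0 e he
    · exact restrict_of_notMem he _
  have h2 := hΓ.netFlow_restrict_current hC ha hb a
  rw [h1, netFlow_zero, if_pos rfl, if_neg hab] at h2
  norm_num at h2

/-! ### The projection to a circle -/

lemma IsCircle.exists_projection {C : Finset E} (hC : Γ.IsCircle C) (x : V) :
    ∃ a, Γ.degIn C a = 2 ∧ Γ.Reach (Finset.univ \ C) a x := by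
  have hdeg : ∀ f ∈ C, ∀ x, Γ.src f = x ∨ Γ.tgt f = x → Γ.degIn C x = 2 := fun f hf x hx =>
    (hC.2.1 x).resolve_left (degIn_ne_zero_iff.2 ⟨f, hf, hx⟩)
  obtain ⟨e, he⟩ := hC.1
  have h := Γ.connected (Γ.src e) x
  induction h with
  | refl => exact ⟨_, hdeg e he _ (Or.inl rfl), .refl _ _⟩
  | tail _ hstep ih =>
    obtain ⟨f, hf⟩ := hstep
    obtain ⟨a, ha, hax⟩ := ih
    by_cases hfC : f ∈ C
    · exact ⟨_, hdeg f hfC _ (by tauto), .refl _ _⟩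
    · have hmem : f ∈ Finset.univ \ C := by simp [hfC]
      refine ⟨a, ha, hax.trans ?_⟩
      rcases hf with ⟨rfl, rfl⟩ | ⟨rfl, rfl⟩
      · exact reach_edge hmem
      · exact (reach_edge hmem).symm

/-- The point of the circle `C` at which the component of `Γ \ C` containing `x` is attached. -/
def proj {C : Finset E} (hC : Γ.IsCircle C) (x : V) : V := (hC.exists_projection x).choose

lemma degIn_proj {C : Finset E} (hC : Γ.IsCircle C) (x : V) : Γ.degIn C (proj hC x) = 2 :=
  (hC.exists_projection x).choose_spec.1

lemma reach_proj {C : Finset E} (hC : Γ.IsCircle C) (x : V) :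
    Γ.Reach (Finset.univ \ C) (proj hC x) x :=
  (hC.exists_projection x).choose_spec.2

/-- In an elementary graph, distinct vertices of a circle are not joined outside the circle. -/
lemma IsElementary.eq_of_reach (hΓ : Γ.IsElementary) {C : Finset E} (hC : Γ.IsCircle C) {a b : V}
    (ha : Γ.degIn C a = 2) (hb : Γ.degIn C b = 2) (hab : Γ.Reach (Finset.univ \ C) a b) :
    a = b := by
  by_contra hne
  have h1 := hΓ.resistance_pos hC ha hb hne
  rw [hΓ.resistance_eq hC ha hb, Finset.sum_eq_zero fun e he => by
    rw [hΓ.current_eq_zero hC hab he]; ring] at h1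
  exact lt_irrefl _ h1

lemma IsElementary.proj_eq_iff (hΓ : Γ.IsElementary) {C : Finset E} (hC : Γ.IsCircle C) {a : V}
    (ha : Γ.degIn C a = 2) (x : V) : proj hC x = a ↔ Γ.Reach (Finset.univ \ C) a x :=
  ⟨fun h => h ▸ reach_proj hC x, fun h =>
    (hΓ.eq_of_reach hC ha (degIn_proj hC x) (h.trans (reach_proj hC x).symm)).symm⟩

lemma IsElementary.current_proj (hΓ : Γ.IsElementary) {C : Finset E} (hC : Γ.IsCircle C)
    (x y : V) {e : E} (he : e ∈ C) :
    Γ.current x y e = Γ.current (proj hC x) (proj hC y) e := by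
  have h1 := congrFun (Γ.current_add (proj hC x) x y) e
  have h2 := congrFun (Γ.current_add (proj hC x) y (proj hC y)) e
  have h3 := hΓ.current_eq_zero hC (reach_proj hC x) he
  have h4 := hΓ.current_eq_zero hC (reach_proj hC y).symm he
  simp only [Pi.add_apply, h3, h4] at h1 h2
  linarith

/-! ### The canonical measure and the tau constant of an elementary graph -/

lemma edgeMass_isCirculation (e : E) :
    Γ.IsCirculation (Pi.single e 1 - Γ.current (Γ.src e) (Γ.tgt e)) := fun x => by
  rw [netFlow_sub, netFlow_single, netFlow_current, sub_self]

lemma IsBridge.edgeMass_eq_zero {e : E} (he : Γ.IsBridge e) : Γ.edgeMass e = 0 := by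
  have := he.circulation_eq_zero (edgeMass_isCirculation e)
  simpa [edgeMass_eq] using this

lemma IsElementary.edgeMass_mul (hΓ : Γ.IsElementary) {C : Finset E} (hC : Γ.IsCircle C) {e : E}
    (he : e ∈ C) : Γ.edgeMass e * ∑ f ∈ C, Γ.len f = Γ.len e := by
  obtain ⟨σ, hσ, hσC, hσ1⟩ := hC.exists_orientation
  set z : E → ℝ := Pi.single e 1 - Γ.current (Γ.src e) (Γ.tgt e) with hz
  have hze : z e = Γ.edgeMass e := by simp [hz, edgeMass_eq]
  -- On the circle, `z` is a multiple of the orientation `σ`.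
  have hzσ : ∀ f ∈ C, z f = z e * σ e * σ f := by
    intro f hf
    have hw := (hΓ.restrict_circulation hC (edgeMass_isCirculation e)).sub_smul hσ (z e * σ e)
    have h0 := hC.eq_zero hw (fun f hf => by
      rw [Pi.sub_apply, restrict_of_notMem hf, Pi.smul_apply, hσC f hf]; simp) he (by
      rw [Pi.sub_apply, restrict_of_mem he, Pi.smul_apply, smul_eq_mul]
      have := hσ1 e he
      linear_combination (-z e) * this)
    have h1 := congrFun h0 f
    rw [Pi.sub_apply, restrict_of_mem hf, Pi.smul_apply, smul_eq_mul, Pi.zero_apply] at h1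
    linarith
  -- The voltage law around the circle.
  have h1 : ∑ f, Γ.len f * (z f * σ f) = Γ.len e * σ e := by
    have h2 := Γ.sum_len_current_mul (Γ.src e) (Γ.tgt e) σ
    simp only [hσ _, mul_zero, Finset.sum_const_zero] at h2
    simp only [hz, Pi.sub_apply, sub_mul, mul_sub, Finset.sum_sub_distrib, h2, sub_zero]
    rw [Finset.sum_eq_single e (fun f _ hf => by simp [Pi.single_eq_of_ne hf]) (by simp)]
    simp
  have h3 : ∑ f, Γ.len f * (z f * σ f) = z e * σ e * ∑ f ∈ C, Γ.len f := by
    rw [Finset.mul_sum, ← Finset.sum_subset (Finset.subset_univ C) fun f _ hf => by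
      rw [hσC f hf]; ring]
    refine Finset.sum_congr rfl fun f hf => ?_
    rw [hzσ f hf]
    linear_combination (Γ.len f * z e * σ e) * hσ1 f hf
  rw [← hze]
  have h4 := hσ1 e he
  linear_combination σ e * (h1.symm.trans h3).symm - (z e * ∑ f ∈ C, Γ.len f) * h4 + Γ.len e * h4

end MetrizedGraph

namespace MetrizedGraph

/-- Two numbers with sum zero have cubes with sum zero, for numbers indexed by the two ends at a
vertex of a circle. -/
lemma sum_cube_eq_zero {ι : Type*} {A B : Finset ι} (h : A.card + B.card = 2) {u v : ι → ℝ}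
    (huv : ∑ e ∈ A, u e + ∑ e ∈ B, v e = 0) : ∑ e ∈ A, u e ^ 3 + ∑ e ∈ B, v e ^ 3 = 0 := by
  have hA : A.card ≤ 2 := by omega
  interval_cases hA' : A.card
  · rw [Finset.card_eq_zero] at hA'
    obtain ⟨a, b, hab, rfl⟩ := Finset.card_eq_two.1 (by omega : B.card = 2)
    rw [hA', Finset.sum_empty, Finset.sum_pair hab] at huv ⊢
    rw [show v a = -v b by linarith]; ring
  · obtain ⟨a, rfl⟩ := Finset.card_eq_one.1 hA'
    obtain ⟨b, rfl⟩ := Finset.card_eq_one.1 (by omega : B.card = 1)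
    rw [Finset.sum_singleton, Finset.sum_singleton] at huv ⊢
    rw [show u a = -v b by linarith]; ring
  · have hB : B = ∅ := Finset.card_eq_zero.1 (by omega)
    obtain ⟨a, b, hab, rfl⟩ := Finset.card_eq_two.1 hA'
    rw [hB, Finset.sum_empty, Finset.sum_pair hab] at huv ⊢
    rw [show u a = -u b by linarith]; ring

variable {V : Type*} {E : Type*} [Fintype V] [Fintype E] {Γ : MetrizedGraph V E}

lemma current_self (a : V) : Γ.current a a = 0 := by simp [current]

lemma IsElementary.sum_cube_slopes (hΓ : Γ.IsElementary) {C : Finset E} (hC : Γ.IsCircle C)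
    (p x : V) (hx : Γ.degIn C x = 2) :
    ∑ e ∈ C.filter (fun e => Γ.src e = x), (1 + 2 * Γ.current p x e) ^ 3
      + ∑ e ∈ C.filter (fun e => Γ.tgt e = x), (1 - 2 * Γ.current p x e) ^ 3
      = if x = proj hC p then 2 else 0 := by
  have hcard : (((C.filter fun e => Γ.src e = x).card : ℝ)
      + ((C.filter fun e => Γ.tgt e = x).card : ℝ)) = 2 := by exact_mod_cast hx
  have hpx : proj hC x = x := (hΓ.proj_eq_iff hC hx x).2 (.refl _ _)
  split_ifs with h
  · have h0 : ∀ e ∈ C, Γ.current p x e = 0 := fun e he => by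
      rw [hΓ.current_proj hC p x he, hpx, ← h, current_self, Pi.zero_apply]
    have hs : ∀ e ∈ C.filter (fun e => Γ.src e = x), (1 + 2 * Γ.current p x e) ^ 3 = 1 :=
      fun e he => by rw [h0 e (Finset.mem_filter.1 he).1]; norm_num
    have ht : ∀ e ∈ C.filter (fun e => Γ.tgt e = x), (1 - 2 * Γ.current p x e) ^ 3 = 1 :=
      fun e he => by rw [h0 e (Finset.mem_filter.1 he).1]; norm_num
    rw [Finset.sum_congr rfl hs, Finset.sum_congr rfl ht]
    simpa using hcard
  · refine sum_cube_eq_zero hx ?_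
    have h1 := hΓ.netFlow_restrict_current hC (degIn_proj hC p) hx x
    rw [if_neg h, if_pos rfl, netFlow_eq_of_support (F := C)
      (fun e he => restrict_of_notMem he _)] at h1
    have h2 : ∀ e ∈ C, restrict C (Γ.current (proj hC p) x) e = Γ.current p x e := fun e he => by
      rw [restrict_of_mem he, hΓ.current_proj hC p x he, hpx]
    rw [Finset.sum_congr rfl fun e he => h2 e (Finset.mem_filter.1 he).1,
      Finset.sum_congr rfl fun e he => h2 e (Finset.mem_filter.1 he).1] at h1
    simp only [Finset.sum_add_distrib, Finset.sum_sub_distrib, ← Finset.mul_sum, Finset.sum_const,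
      nsmul_eq_mul, mul_one]
    linarith

/-- The contribution of a circle to the energy of the resistance to `p`. On each edge this energy is
a difference of cubes of the slopes at the ends, and by Kirchhoff's law the cubes cancel at all
vertices of the circle except the projection of `p`, where both slopes are `1`. -/
lemma IsElementary.resEnergy_circle (hΓ : Γ.IsElementary) {C : Finset E} (hC : Γ.IsCircle C)
    (p : V) : ∑ e ∈ C, ((Γ.effRes p (Γ.tgt e) - Γ.effRes p (Γ.src e)) ^ 2 / Γ.len e
      + Γ.edgeMass e ^ 2 * Γ.len e / 3) = (∑ e ∈ C, Γ.len e) / 3 := by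
  set L := ∑ e ∈ C, Γ.len e with hL
  have hedge : ∀ e ∈ C, (Γ.effRes p (Γ.tgt e) - Γ.effRes p (Γ.src e)) ^ 2 / Γ.len e
      + Γ.edgeMass e ^ 2 * Γ.len e / 3
      = L / 6 * ((1 + 2 * Γ.current p (Γ.src e) e) ^ 3
        + (1 - 2 * Γ.current p (Γ.tgt e) e) ^ 3) := by
    intro e he
    have hlen := Γ.len_pos e
    have hm : Γ.edgeMass e * L = Γ.len e := hΓ.edgeMass_mul hC he
    have h1 := Γ.two_mul_len_mul_current_src p e
    have h2 := Γ.two_mul_len_mul_current_tgt p e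
    rw [effRes_src_tgt] at h1 h2
    set d := (Γ.effRes p (Γ.tgt e) - Γ.effRes p (Γ.src e)) / Γ.len e with hd
    have hd' : Γ.effRes p (Γ.tgt e) - Γ.effRes p (Γ.src e) = Γ.len e * d := by
      rw [hd]; field_simp
    rw [hd'] at h1 h2
    have h3 : 1 + 2 * Γ.current p (Γ.src e) e = Γ.edgeMass e + d := by
      apply mul_left_cancel₀ hlen.ne'; linarith
    have h4 : 1 - 2 * Γ.current p (Γ.tgt e) e = Γ.edgeMass e - d := by
      apply mul_left_cancel₀ hlen.ne'; linarith
    rw [h3, h4, hd']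
    have h5 : (Γ.len e * d) ^ 2 / Γ.len e = Γ.len e * d ^ 2 := by field_simp
    rw [h5]
    linear_combination (-(Γ.edgeMass e ^ 2 / 3) - d ^ 2) * hm
  rw [Finset.sum_congr rfl hedge, ← Finset.mul_sum, Finset.sum_add_distrib]
  have hs : ∀ (s : E → V) (u : V → E → ℝ), ∑ e ∈ C, u (s e) e
      = ∑ x, ∑ e ∈ C.filter (fun e => s e = x), u x e := fun s u => by
    rw [← Finset.sum_fiberwise C s]
    exact Finset.sum_congr rfl fun x _ => Finset.sum_congr rfl fun e he => by
      rw [(Finset.mem_filter.1 he).2]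
  rw [hs Γ.src fun x e => (1 + 2 * Γ.current p x e) ^ 3,
    hs Γ.tgt fun x e => (1 - 2 * Γ.current p x e) ^ 3, ← Finset.sum_add_distrib]
  have hx : ∀ x, ∑ e ∈ C.filter (fun e => Γ.src e = x), (1 + 2 * Γ.current p x e) ^ 3
      + ∑ e ∈ C.filter (fun e => Γ.tgt e = x), (1 - 2 * Γ.current p x e) ^ 3
      = if x = proj hC p then 2 else 0 := by
    intro x
    rcases hC.2.1 x with h0 | h2
    · have hne : x ≠ proj hC p := fun h => by
        rw [h, degIn_proj] at h0; norm_num at h0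
      rw [degIn, Nat.add_eq_zero_iff, Finset.card_eq_zero, Finset.card_eq_zero] at h0
      rw [h0.1, h0.2, if_neg hne]; simp
    · exact hΓ.sum_cube_slopes hC p x h2
  simp only [hx, Finset.sum_ite_eq', Finset.mem_univ, if_true]
  ring

/-- The current through a bridge is the difference of the indicators of the side of the source. -/
lemma IsBridge.current_eq {e : E} (he : Γ.IsBridge e) (x y : V) : Γ.current x y e
    = (if Γ.Reach (Finset.univ.erase e) (Γ.src e) x then 1 else 0)
      - (if Γ.Reach (Finset.univ.erase e) (Γ.src e) y then 1 else 0) := by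
  rw [he.flow_eq (Γ.current x y)]
  simp only [netFlow_current, mul_sub, mul_ite, mul_one, mul_zero, Finset.sum_sub_distrib,
    Finset.sum_ite_eq', Finset.mem_univ, if_true]

lemma IsBridge.resEnergy_edge {e : E} (he : Γ.IsBridge e) (p : V) :
    (Γ.effRes p (Γ.tgt e) - Γ.effRes p (Γ.src e)) ^ 2 / Γ.len e
      + Γ.edgeMass e ^ 2 * Γ.len e / 3 = Γ.len e := by
  have hlen := (Γ.len_pos e).ne'
  have h1 := Γ.two_mul_len_mul_current_src p e
  rw [effRes_src_tgt, he.edgeMass_eq_zero, he.current_eq, if_pos (Reach.refl _ _)] at h1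
  have h2 : Γ.effRes p (Γ.tgt e) - Γ.effRes p (Γ.src e) = Γ.len e * (2 *
      ((if Γ.Reach (Finset.univ.erase e) (Γ.src e) p then 1 else 0) - 1) + 1) := by linarith
  rw [h2, he.edgeMass_eq_zero]
  split_ifs <;> field_simp <;> ring

lemma IsElementary.resEnergy_eq (hΓ : Γ.IsElementary) (p : V) :
    Γ.resEnergy p = ∑ e ∈ Finset.univ.filter (fun e => Γ.IsBridge e), Γ.len e
      + ∑ C ∈ Γ.circles, (∑ e ∈ C, Γ.len e) / 3 := by
  rw [resEnergy, hΓ.sum_edges]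
  congr 1
  · exact Finset.sum_congr rfl fun e he => (Finset.mem_filter.1 he).2.resEnergy_edge p
  · exact Finset.sum_congr rfl fun C hC => hΓ.resEnergy_circle (mem_circles.1 hC) p

/-! ### Genera of components -/

lemma mem_compVerts {F : Finset E} {a x : V} : x ∈ Γ.compVerts F a ↔ Γ.Reach F a x := by
  simp [compVerts]

lemma sum_degIn_compVerts (F : Finset E) (a : V) :
    ∑ x ∈ Γ.compVerts F a, Γ.degIn F x = 2 * (Γ.compEdges F a).card := by
  rw [← sum_degIn (Γ := Γ) (Γ.compEdges F a), compVerts, Finset.sum_filter]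
  refine Finset.sum_congr rfl fun x _ => ?_
  have hs : (Γ.compEdges F a).filter (fun e => Γ.src e = x)
      = if Γ.Reach F a x then F.filter (fun e => Γ.src e = x) else ∅ := by
    ext e
    split_ifs with h
    · simp only [compEdges, Finset.mem_filter]
      exact ⟨fun h' => ⟨h'.1.1, h'.2⟩, fun h' => ⟨⟨h'.1, h'.2 ▸ h⟩, h'.2⟩⟩
    · simp only [compEdges, Finset.mem_filter, Finset.notMem_empty, iff_false]
      exact fun h' => h (h'.2 ▸ h'.1.2)
  have ht : (Γ.compEdges F a).filter (fun e => Γ.tgt e = x)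
      = if Γ.Reach F a x then F.filter (fun e => Γ.tgt e = x) else ∅ := by
    ext e
    split_ifs with h
    · simp only [compEdges, Finset.mem_filter]
      exact ⟨fun h' => ⟨h'.1.1, h'.2⟩,
        fun h' => ⟨⟨h'.1, (reach_src_iff h'.1 a).2 (h'.2 ▸ h)⟩, h'.2⟩⟩
    · simp only [compEdges, Finset.mem_filter, Finset.notMem_empty, iff_false]
      exact fun h' => h (h'.2 ▸ (reach_src_iff h'.1.1 a).1 h'.1.2)
  rw [degIn, degIn, hs, ht]
  split_ifs <;> simp

end MetrizedGraph

namespace PolarizedGraph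

open MetrizedGraph

variable {V : Type*} {E : Type*} [Fintype V] [Fintype E] {Γ : PolarizedGraph V E}

lemma two_mul_compGenus (F : Finset E) (a : V) : 2 * Γ.compGenus F a
    = ∑ x ∈ Γ.compVerts F a, (2 * Γ.q x + Γ.degIn F x - 2) + 2 := by
  have h : ∑ x ∈ Γ.compVerts F a, (Γ.degIn F x : ℝ) = 2 * (Γ.compEdges F a).card := by
    exact_mod_cast sum_degIn_compVerts (Γ := Γ.toMetrizedGraph) F a
  rw [compGenus, Finset.sum_sub_distrib, Finset.sum_add_distrib, h, ← Finset.mul_sum]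
  simp
  ring

lemma two_mul_hangingGenus (hΓ : Γ.IsElementary) {C : Finset E} (hC : Γ.IsCircle C) {a : V}
    (ha : Γ.degIn C a = 2) :
    2 * Γ.hangingGenus C a = ∑ x ∈ Γ.compVerts (Finset.univ \ C) a, Γ.K x := by
  have hval : ∀ x, (Γ.valency x : ℝ) = Γ.degIn (Finset.univ \ C) x + Γ.degIn C x := by
    intro x
    have hs : ∀ s : E → V, (Finset.univ.filter fun e => s e = x).card
        = ((Finset.univ \ C).filter fun e => s e = x).card + (C.filter fun e => s e = x).card := by
      intro s
      rw [← Finset.card_union_of_disjoint, ← Finset.filter_union,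
        Finset.sdiff_union_of_subset (Finset.subset_univ C)]
      exact Finset.disjoint_filter_filter Finset.sdiff_disjoint
    rw [valency, degIn, degIn, degIn, hs, hs]
    push_cast; ring
  have hdeg : ∑ x ∈ Γ.compVerts (Finset.univ \ C) a, (Γ.degIn C x : ℝ) = 2 := by
    rw [Finset.sum_eq_single a]
    · rw [ha]; norm_num
    · intro x hx hne
      rcases hC.2.1 x with h | h
      · rw [h]; norm_num
      · exact absurd (hΓ.eq_of_reach hC ha h (mem_compVerts.1 hx)).symm hne
    · exact fun h => absurd (mem_compVerts.2 (Reach.refl _ _)) h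
  have hK : ∀ x, Γ.K x = (2 * Γ.q x + Γ.degIn (Finset.univ \ C) x - 2) + Γ.degIn C x := fun x => by
    rw [K, hval]; ring
  rw [hangingGenus, two_mul_compGenus]
  simp only [hK]
  rw [Finset.sum_add_distrib, hdeg]

lemma two_mul_compGenus_bridge {e : E} (he : Γ.IsBridge e) :
    2 * Γ.compGenus (Finset.univ.erase e) (Γ.src e)
        = ∑ x ∈ Γ.compVerts (Finset.univ.erase e) (Γ.src e), Γ.K x + 1 ∧
      2 * Γ.compGenus (Finset.univ.erase e) (Γ.tgt e)
        = ∑ x ∈ Γ.compVerts (Finset.univ.erase e) (Γ.tgt e), Γ.K x + 1 := by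
  have hval : ∀ x, (Γ.valency x : ℝ) = Γ.degIn (Finset.univ.erase e) x
      + ((if Γ.src e = x then 1 else 0) + (if Γ.tgt e = x then 1 else 0)) := by
    intro x
    have hs : ∀ s : E → V, ((Finset.univ.filter fun f => s f = x).card : ℝ)
        = (((Finset.univ.erase e).filter fun f => s f = x).card : ℝ)
          + (if s e = x then 1 else 0) := by
      intro s
      have : Finset.univ.filter (fun f => s f = x)
          = (insert e (Finset.univ.erase e)).filter fun f => s f = x := by
        rw [Finset.insert_erase (Finset.mem_univ e)]
      rw [this, Finset.filter_insert]
      split_ifs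
      · rw [Finset.card_insert_of_notMem (by simp)]; push_cast; rfl
      · ring
    rw [valency, degIn, degIn]
    push_cast
    rw [hs Γ.src, hs Γ.tgt]
    ring
  have hK : ∀ x, Γ.K x = (2 * Γ.q x + Γ.degIn (Finset.univ.erase e) x - 2)
      + ((if Γ.src e = x then 1 else 0) + (if Γ.tgt e = x then 1 else 0)) := fun x => by
    rw [K, hval]; ring
  have h1 : Γ.tgt e ∉ Γ.compVerts (Finset.univ.erase e) (Γ.src e) := fun h =>
    he (mem_compVerts.1 h)
  have h2 : Γ.src e ∉ Γ.compVerts (Finset.univ.erase e) (Γ.tgt e) := fun h =>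
    he (mem_compVerts.1 h).symm
  have h3 : ∀ a : V, a ∈ Γ.compVerts (Finset.univ.erase e) a := fun a =>
    mem_compVerts.2 (.refl _ _)
  constructor <;>
  · rw [two_mul_compGenus]
    simp only [hK, Finset.sum_add_distrib, Finset.sum_ite_eq, h1, h2, h3, if_true, if_false]
    ring

lemma compGenus_bridge_add {e : E} (he : Γ.IsBridge e) :
    Γ.compGenus (Finset.univ.erase e) (Γ.src e) + Γ.compGenus (Finset.univ.erase e) (Γ.tgt e)
      = Γ.genus := by
  obtain ⟨h1, h2⟩ := two_mul_compGenus_bridge he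
  have h3 : ∑ x ∈ Γ.compVerts (Finset.univ.erase e) (Γ.src e), Γ.K x
      + ∑ x ∈ Γ.compVerts (Finset.univ.erase e) (Γ.tgt e), Γ.K x = ∑ x, Γ.K x := by
    rw [← Finset.sum_filter_add_sum_filter_not Finset.univ
      (fun x => Γ.Reach (Finset.univ.erase e) (Γ.src e) x), compVerts, compVerts]
    simp only [he.reach_tgt_iff]
  rw [sum_K] at h3
  linarith

lemma compGenus_bridge_pos {e : E} (he : Γ.IsBridge e) :
    0 < Γ.compGenus (Finset.univ.erase e) (Γ.src e) ∧
      0 < Γ.compGenus (Finset.univ.erase e) (Γ.tgt e) := by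
  obtain ⟨h1, h2⟩ := two_mul_compGenus_bridge he
  have h := fun a : V => Finset.sum_nonneg fun x
    (_ : x ∈ Γ.compVerts (Finset.univ.erase e) a) => K_nonneg (Γ := Γ) x
  constructor
  · linarith [h (Γ.src e)]
  · linarith [h (Γ.tgt e)]

/-! ### The resistance of the canonical divisor -/

lemma sum_K_mul_current_bridge {e : E} (he : Γ.IsBridge e) :
    ∑ x, ∑ y, Γ.K x * Γ.K y * Γ.current x y e ^ 2
      = 2 * (2 * Γ.compGenus (Finset.univ.erase e) (Γ.src e) - 1)
        * (2 * Γ.compGenus (Finset.univ.erase e) (Γ.tgt e) - 1) := by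
  obtain ⟨h1, h2⟩ := two_mul_compGenus_bridge he
  set s : V → ℝ := fun x =>
    if Γ.Reach (Finset.univ.erase e) (Γ.src e) x then 1 else 0 with hs
  set t : V → ℝ := fun x =>
    if Γ.Reach (Finset.univ.erase e) (Γ.tgt e) x then 1 else 0 with ht
  have hcur : ∀ x y, Γ.current x y e ^ 2 = s x * t y + t x * s y := by
    intro x y
    rw [he.current_eq]
    simp only [hs, ht, he.reach_tgt_iff]
    split_ifs <;> norm_num
  have hS : ∑ x, Γ.K x * s x = 2 * Γ.compGenus (Finset.univ.erase e) (Γ.src e) - 1 := by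
    simp only [hs, mul_ite, mul_one, mul_zero, ← Finset.sum_filter]
    rw [h1, compVerts]; ring
  have hT : ∑ x, Γ.K x * t x = 2 * Γ.compGenus (Finset.univ.erase e) (Γ.tgt e) - 1 := by
    simp only [ht, mul_ite, mul_one, mul_zero, ← Finset.sum_filter]
    rw [h2, compVerts]; ring
  have hxy : ∀ x y, Γ.K x * Γ.K y * Γ.current x y e ^ 2
      = (Γ.K x * s x) * (Γ.K y * t y) + (Γ.K x * t x) * (Γ.K y * s y) := fun x y => by
    rw [hcur]; ring
  simp only [hxy, Finset.sum_add_distrib, ← Finset.mul_sum, ← Finset.sum_mul, hS, hT]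
  ring

/-- A point of a circle outside the support of the canonical divisor has nothing attached. -/
lemma hangingGenus_eq_zero (hΓ : Γ.IsElementary) {C : Finset E} (hC : Γ.IsCircle C) {a : V}
    (ha : Γ.degIn C a = 2) (hK : Γ.K a = 0) : Γ.hangingGenus C a = 0 := by
  have hval : Γ.degIn C a ≤ Γ.valency a :=
    add_le_add (Finset.card_le_card (Finset.filter_subset_filter _ (Finset.subset_univ C)))
      (Finset.card_le_card (Finset.filter_subset_filter _ (Finset.subset_univ C)))
  have h2 : (2 : ℝ) ≤ Γ.valency a := by rw [ha] at hval; exact_mod_cast hval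
  have h3 : (Γ.valency a : ℝ) = 2 := by
    have := Γ.q_nonneg a
    rw [K] at hK
    linarith
  have h4 : Γ.valency a = 2 := by exact_mod_cast h3
  -- All ends at `a` belong to `C`, so the component of `a` outside `C` is the point `a`.
  have hend : ∀ e, Γ.src e = a ∨ Γ.tgt e = a → e ∈ C := by
    have hs := Finset.filter_subset_filter (fun e => Γ.src e = a) (Finset.subset_univ C)
    have ht := Finset.filter_subset_filter (fun e => Γ.tgt e = a) (Finset.subset_univ C)
    have hs₁ := Finset.card_le_card hs
    have ht₁ := Finset.card_le_card ht
    rw [degIn] at ha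
    rw [valency, degIn] at h4
    have hs₂ := Finset.eq_of_subset_of_card_le hs (by omega)
    have ht₂ := Finset.eq_of_subset_of_card_le ht (by omega)
    rintro e (he | he)
    · have : e ∈ Finset.univ.filter fun e => Γ.src e = a := by simp [he]
      rw [← hs₂] at this
      exact (Finset.mem_filter.1 this).1
    · have : e ∈ Finset.univ.filter fun e => Γ.tgt e = a := by simp [he]
      rw [← ht₂] at this
      exact (Finset.mem_filter.1 this).1
  have hcomp : ∀ x ∈ Γ.compVerts (Finset.univ \ C) a, Γ.K x = 0 := by
    intro x hx
    have : a = x := by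
      rcases (mem_compVerts.1 hx).cases_head with h | ⟨y, ⟨e, he, hst⟩, _⟩
      · exact h
      · exact absurd (hend e (by tauto)) (Finset.mem_sdiff.1 he).2
    rw [← this, hK]
  have := two_mul_hangingGenus hΓ hC ha
  rw [Finset.sum_eq_zero hcomp] at this
  linarith

lemma hangingGenus_pos (hΓ : Γ.IsElementary) {C : Finset E} (hC : Γ.IsCircle C) {a : V}
    (ha : a ∈ Γ.circleVerts C) : 0 < Γ.hangingGenus C a := by
  obtain ⟨-, h2, hK⟩ := Finset.mem_filter.1 ha
  have h := two_mul_hangingGenus hΓ hC h2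
  have h1 : Γ.K a ≤ ∑ x ∈ Γ.compVerts (Finset.univ \ C) a, Γ.K x :=
    Finset.single_le_sum (fun x _ => K_nonneg x) (mem_compVerts.2 (Reach.refl _ a))
  have h3 := lt_of_le_of_ne (K_nonneg a) (Ne.symm hK)
  linarith

lemma sum_K_mul_proj (hΓ : Γ.IsElementary) {C : Finset E} (hC : Γ.IsCircle C) (f : V → ℝ) :
    ∑ x, Γ.K x * f (proj hC x) = ∑ a ∈ Γ.circleVerts C, 2 * Γ.hangingGenus C a * f a := by
  have h1 : ∑ x, Γ.K x * f (proj hC x)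
      = ∑ a ∈ Finset.univ.filter (fun a => Γ.degIn C a = 2), 2 * Γ.hangingGenus C a * f a := by
    rw [← Finset.sum_fiberwise_of_maps_to (g := proj hC)
      (t := Finset.univ.filter fun a => Γ.degIn C a = 2)
      fun x _ => Finset.mem_filter.2 ⟨Finset.mem_univ _, degIn_proj hC x⟩]
    refine Finset.sum_congr rfl fun a ha => ?_
    have ha' := (Finset.mem_filter.1 ha).2
    rw [two_mul_hangingGenus hΓ hC ha', Finset.sum_mul]
    refine Finset.sum_congr ?_ fun x hx => ?_
    · ext x
      rw [Finset.mem_filter, mem_compVerts, hΓ.proj_eq_iff hC ha']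
      simp
    · rw [(hΓ.proj_eq_iff hC ha' x).2 (mem_compVerts.1 hx)]
  rw [h1]
  refine (Finset.sum_subset (fun a ha => ?_) fun a ha ha' => ?_).symm
  · exact Finset.mem_filter.2 ⟨Finset.mem_univ _, (Finset.mem_filter.1 ha).2.1⟩
  · have h2 := (Finset.mem_filter.1 ha).2
    have hK : Γ.K a = 0 := by
      by_contra hne
      exact ha' (Finset.mem_filter.2 ⟨Finset.mem_univ _, h2, hne⟩)
    rw [hangingGenus_eq_zero hΓ hC h2 hK]; ring

lemma sum_K_mul_current_circle (hΓ : Γ.IsElementary) {C : Finset E} (hC : Γ.IsCircle C) :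
    ∑ e ∈ C, Γ.len e * ∑ x, ∑ y, Γ.K x * Γ.K y * Γ.current x y e ^ 2
      = 4 * ∑ a ∈ Γ.circleVerts C, ∑ b ∈ Γ.circleVerts C,
          Γ.hangingGenus C a * Γ.hangingGenus C b * Γ.resistance C a b := by
  have h1 : ∑ e ∈ C, Γ.len e * ∑ x, ∑ y, Γ.K x * Γ.K y * Γ.current x y e ^ 2
      = ∑ x, Γ.K x * ∑ y, Γ.K y * Γ.resistance C (proj hC x) (proj hC y) := by
    simp only [Finset.mul_sum]
    rw [Finset.sum_comm]
    refine Finset.sum_congr rfl fun x _ => ?_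
    rw [Finset.sum_comm]
    refine Finset.sum_congr rfl fun y _ => ?_
    rw [hΓ.resistance_eq hC (degIn_proj hC x) (degIn_proj hC y), Finset.mul_sum, Finset.mul_sum]
    refine Finset.sum_congr rfl fun e he => ?_
    rw [hΓ.current_proj hC x y he]; ring
  rw [h1, Finset.sum_congr rfl fun x _ => by
    rw [sum_K_mul_proj hΓ hC fun b => Γ.resistance C (proj hC x) b],
    sum_K_mul_proj hΓ hC fun a => ∑ b ∈ Γ.circleVerts C,
      2 * Γ.hangingGenus C b * Γ.resistance C a b, Finset.mul_sum]
  refine Finset.sum_congr rfl fun a _ => ?_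
  rw [Finset.mul_sum, Finset.mul_sum]
  refine Finset.sum_congr rfl fun b _ => ?_
  ring

lemma canonicalRes_eq (hΓ : Γ.IsElementary) : Γ.canonicalRes
    = ∑ e ∈ Finset.univ.filter (fun e => Γ.IsBridge e),
        Γ.len e * (2 * (2 * Γ.compGenus (Finset.univ.erase e) (Γ.src e) - 1)
          * (2 * Γ.compGenus (Finset.univ.erase e) (Γ.tgt e) - 1))
      + ∑ C ∈ Γ.circles, 4 * ∑ a ∈ Γ.circleVerts C, ∑ b ∈ Γ.circleVerts C,
          Γ.hangingGenus C a * Γ.hangingGenus C b * Γ.resistance C a b := by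
  have h1 : Γ.canonicalRes
      = ∑ e, Γ.len e * ∑ x, ∑ y, Γ.K x * Γ.K y * Γ.current x y e ^ 2 := by
    simp only [canonicalRes, effRes_eq_energy, Finset.mul_sum]
    rw [Finset.sum_comm (s := (Finset.univ : Finset E))]
    refine Finset.sum_congr rfl fun x _ => ?_
    rw [Finset.sum_comm (s := (Finset.univ : Finset E))]
    refine Finset.sum_congr rfl fun y _ => Finset.sum_congr rfl fun e _ => ?_
    ring
  rw [h1, hΓ.sum_edges]
  congr 1
  · exact Finset.sum_congr rfl fun e he => by
      rw [sum_K_mul_current_bridge (Finset.mem_filter.1 he).2]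
  · exact Finset.sum_congr rfl fun C hC => sum_K_mul_current_circle hΓ (mem_circles.1 hC)

/-! ### The lengths of the types -/

lemma sum_ell_eq (c : ℝ → ℝ) :
    ∑ᶠ i ∈ Ioc (0 : ℝ) (Γ.genus / 2), c i * Γ.ell i
      = ∑ e ∈ Finset.univ.filter (fun e => Γ.IsBridge e), c (Γ.bridgeType e) * Γ.len e := by
  set B := Finset.univ.filter (fun e => Γ.IsBridge e) with hB
  have hell : ∀ i, Γ.ell i = ∑ e ∈ B.filter (fun e => Γ.bridgeType e = i), Γ.len e := fun i => by
    rw [ell, hB, Finset.filter_filter]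
  have hT : ∀ e ∈ B, Γ.bridgeType e ∈ Ioc (0 : ℝ) (Γ.genus / 2) := by
    intro e he
    have hb := (Finset.mem_filter.1 he).2
    have h1 := compGenus_bridge_add hb
    obtain ⟨h2, h3⟩ := compGenus_bridge_pos hb
    refine ⟨lt_min h2 h3, ?_⟩
    rw [bridgeType]
    rcases le_total (Γ.compGenus (Finset.univ.erase e) (Γ.src e))
      (Γ.compGenus (Finset.univ.erase e) (Γ.tgt e)) with h | h
    · rw [min_eq_left h]; linarith
    · rw [min_eq_right h]; linarith
  rw [finsum_mem_eq_sum_of_inter_support_eq (t := B.image Γ.bridgeType)]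
  · rw [← Finset.sum_fiberwise_of_maps_to (g := Γ.bridgeType) (t := B.image Γ.bridgeType)
      fun e he => Finset.mem_image_of_mem _ he]
    refine Finset.sum_congr rfl fun i _ => ?_
    rw [hell, Finset.mul_sum]
    refine Finset.sum_congr rfl fun e he => ?_
    rw [(Finset.mem_filter.1 he).2]
  · ext i
    simp only [mem_inter_iff, Function.mem_support, Finset.coe_image, mem_image, Finset.mem_coe]
    refine and_congr_left fun hi => ⟨fun _ => ?_, ?_⟩
    · by_contra! h
      refine hi ?_
      rw [hell, Finset.filter_eq_empty_iff.2 fun {e} he => h e he]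
      simp
    · rintro ⟨e, he, rfl⟩
      exact hT e he

lemma bridgeType_mul {e : E} (he : Γ.IsBridge e) :
    Γ.bridgeType e * (Γ.genus - Γ.bridgeType e)
      = Γ.compGenus (Finset.univ.erase e) (Γ.src e)
        * Γ.compGenus (Finset.univ.erase e) (Γ.tgt e) := by
  have h := compGenus_bridge_add he
  rw [bridgeType, ← h]
  rcases le_total (Γ.compGenus (Finset.univ.erase e) (Γ.src e))
    (Γ.compGenus (Finset.univ.erase e) (Γ.tgt e)) with h | h
  · rw [min_eq_left h]; ring
  · rw [min_eq_right h]; ring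

lemma ell0_eq (hΓ : Γ.IsElementary) : Γ.ell0 = ∑ C ∈ Γ.circles, ∑ e ∈ C, Γ.len e := by
  have h1 := hΓ.sum_edges Γ.len
  have h2 := Finset.sum_filter_add_sum_filter_not Finset.univ (fun e => Γ.IsBridge e) Γ.len
  rw [ell0]
  linarith

end PolarizedGraph

namespace PolarizedGraph

open MetrizedGraph

variable {V : Type*} {E : Type*} [Fintype V] [Fintype E] {Γ : PolarizedGraph V E}

/-! ### The invariants of elementary graphs -/

variable (Γ) in
/-- The sum over the circles of the resistances between the points of the canonical divisor on the
circle, weighted by the genera attached to them. -/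
def circleRes : ℝ := ∑ C ∈ Γ.circles, ∑ a ∈ Γ.circleVerts C, ∑ b ∈ Γ.circleVerts C,
  Γ.hangingGenus C a * Γ.hangingGenus C b * Γ.resistance C a b

lemma sum_circleRes_div (c : ℝ) :
    ∑ C ∈ Γ.circles, ∑ a ∈ Γ.circleVerts C, ∑ b ∈ Γ.circleVerts C,
      Γ.hangingGenus C a * Γ.hangingGenus C b / c * Γ.resistance C a b = Γ.circleRes / c := by
  simp only [circleRes, Finset.sum_div]
  refine Finset.sum_congr rfl fun C _ => Finset.sum_congr rfl fun a _ =>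
    Finset.sum_congr rfl fun b _ => ?_
  ring

lemma circleRes_term_nonneg (hΓ : Γ.IsElementary) {C : Finset E} (hC : C ∈ Γ.circles) {a b : V}
    (ha : a ∈ Γ.circleVerts C) (hb : b ∈ Γ.circleVerts C) :
    0 ≤ Γ.hangingGenus C a * Γ.hangingGenus C b * Γ.resistance C a b := by
  have hC' := mem_circles.1 hC
  exact mul_nonneg (mul_nonneg (hangingGenus_pos hΓ hC' ha).le (hangingGenus_pos hΓ hC' hb).le)
    (hΓ.resistance_nonneg hC' (Finset.mem_filter.1 ha).2.1 (Finset.mem_filter.1 hb).2.1)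

lemma circleRes_nonneg (hΓ : Γ.IsElementary) : 0 ≤ Γ.circleRes :=
  Finset.sum_nonneg fun _ hC => Finset.sum_nonneg fun _ ha => Finset.sum_nonneg fun _ hb =>
    circleRes_term_nonneg hΓ hC ha hb

lemma circleRes_eq_zero_iff (hΓ : Γ.IsElementary) :
    Γ.circleRes = 0 ↔ ∀ C ∈ Γ.circles, (Γ.circleVerts C).card ≤ 1 := by
  rw [circleRes, Finset.sum_eq_zero_iff_of_nonneg fun C hC => Finset.sum_nonneg fun a ha =>
    Finset.sum_nonneg fun b hb => circleRes_term_nonneg hΓ hC ha hb]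
  refine forall₂_congr fun C hC => ?_
  have hC' := mem_circles.1 hC
  rw [Finset.sum_eq_zero_iff_of_nonneg fun a ha => Finset.sum_nonneg fun b hb =>
    circleRes_term_nonneg hΓ hC ha hb, Finset.card_le_one]
  refine forall₂_congr fun a ha => ?_
  rw [Finset.sum_eq_zero_iff_of_nonneg fun b hb => circleRes_term_nonneg hΓ hC ha hb]
  refine forall₂_congr fun b hb => ?_
  have ha' := (Finset.mem_filter.1 ha).2.1
  have hb' := (Finset.mem_filter.1 hb).2.1
  constructor
  · intro h
    by_contra hne
    have := mul_pos (mul_pos (hangingGenus_pos hΓ hC' ha) (hangingGenus_pos hΓ hC' hb))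
      (hΓ.resistance_pos hC' ha' hb' hne)
    exact this.ne' h
  · rintro rfl
    rw [hΓ.resistance_self hC' ha', mul_zero]

variable (Γ) in
/-- The sum of `i (g - i)` over the bridges, weighted by their lengths. -/
def bridgeSum : ℝ := ∑ e ∈ Finset.univ.filter (fun e => Γ.IsBridge e),
  Γ.compGenus (Finset.univ.erase e) (Γ.src e) * Γ.compGenus (Finset.univ.erase e) (Γ.tgt e)
    * Γ.len e

lemma sum_ell_eq_bridgeSum (c : ℝ) :
    ∑ᶠ i ∈ Ioc (0 : ℝ) (Γ.genus / 2), c * (i * (Γ.genus - i)) * Γ.ell i = c * Γ.bridgeSum := by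
  rw [sum_ell_eq fun i => c * (i * (Γ.genus - i)), bridgeSum, Finset.mul_sum]
  refine Finset.sum_congr rfl fun e he => ?_
  rw [bridgeType_mul (Finset.mem_filter.1 he).2]; ring

/-- The invariants `φ` and `λ` of an elementary graph. -/
lemma IsAdmissible.phi_lam_eq (hΓ : Γ.IsElementary) {μ : Measure Γ.Pt} {G : Γ.Pt → Γ.Pt → ℝ}
    (h : Γ.IsAdmissible μ G) :
    Γ.phi μ G = (Γ.genus - 1) / (6 * Γ.genus) * Γ.ell0 + 2 / Γ.genus * Γ.bridgeSum
        + Γ.circleRes / Γ.genus ∧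
      Γ.lam μ G = Γ.genus / (8 * Γ.genus + 4) * Γ.ell0 + 1 / (2 * Γ.genus + 1) * Γ.bridgeSum
        + Γ.circleRes / (4 * Γ.genus + 2) := by
  have hg := genus_pos (Γ := Γ)
  obtain ⟨p⟩ := Γ.nonempty
  obtain ⟨hphi, heps⟩ := h.phi_eps_eq p
  set B := ∑ e ∈ Finset.univ.filter (fun e => Γ.IsBridge e), Γ.len e with hB
  have hlen : Γ.length = B + Γ.ell0 := by
    rw [ell0_eq hΓ, length, hΓ.sum_edges]
  have hT : Γ.resEnergy p = B + Γ.ell0 / 3 := by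
    rw [hΓ.resEnergy_eq p, ell0_eq hΓ, Finset.sum_div]
  have hS : Γ.canonicalRes = 8 * Γ.bridgeSum - (4 * Γ.genus - 2) * B + 4 * Γ.circleRes := by
    rw [canonicalRes_eq hΓ, ← Finset.mul_sum, ← circleRes, bridgeSum, hB, Finset.mul_sum,
      Finset.mul_sum, ← Finset.sum_sub_distrib]
    congr 1
    refine Finset.sum_congr rfl fun e he => ?_
    rw [← compGenus_bridge_add (Finset.mem_filter.1 he).2]
    ring
  have hphi' : Γ.phi μ G = (Γ.genus - 1) / (6 * Γ.genus) * Γ.ell0 + 2 / Γ.genus * Γ.bridgeSum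
        + Γ.circleRes / Γ.genus := by
    rw [hphi, hlen, hT, hS]
    field_simp
    ring
  refine ⟨hphi', ?_⟩
  have h1 : 2 * Γ.genus + 1 ≠ 0 := by positivity
  have h2 : 8 * Γ.genus + 4 = 4 * (2 * Γ.genus + 1) := by ring
  have h3 : 4 * Γ.genus + 2 = 2 * (2 * Γ.genus + 1) := by ring
  rw [lam, hphi', heps, hlen, hT, hS, h2, h3]
  field_simp
  ring

end PolarizedGraph

end

theorem theorem1p4p3 {V : Type*} {E : Type*} [Fintype V] [Fintype E]
    (Γ : PolarizedGraph V E) (hΓ : Γ.IsElementary) :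
    (∃ (μ : Measure Γ.Pt) (G : Γ.Pt → Γ.Pt → ℝ), Γ.IsAdmissible μ G) ∧
    ∀ (μ : Measure Γ.Pt) (G : Γ.Pt → Γ.Pt → ℝ), Γ.IsAdmissible μ G →
      ((Γ.genus - 1) / (6 * Γ.genus) * Γ.ell0
          + ∑ᶠ i ∈ Ioc (0 : ℝ) (Γ.genus / 2), 2 * i * (Γ.genus - i) / Γ.genus * Γ.ell i
        ≤ Γ.phi μ G) ∧
      (Γ.phi μ G = (Γ.genus - 1) / (6 * Γ.genus) * Γ.ell0
          + ∑ᶠ i ∈ Ioc (0 : ℝ) (Γ.genus / 2), 2 * i * (Γ.genus - i) / Γ.genus * Γ.ell i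
        ↔ ∀ C ∈ Γ.circles, (Γ.circleVerts C).card ≤ 1) ∧
      Γ.phi μ G = (Γ.genus - 1) / (6 * Γ.genus) * Γ.ell0
          + ∑ᶠ i ∈ Ioc (0 : ℝ) (Γ.genus / 2), 2 * i * (Γ.genus - i) / Γ.genus * Γ.ell i
          + ∑ C ∈ Γ.circles, ∑ a ∈ Γ.circleVerts C, ∑ b ∈ Γ.circleVerts C,
              Γ.hangingGenus C a * Γ.hangingGenus C b / Γ.genus * Γ.resistance C a b ∧
      Γ.lam μ G = Γ.genus / (8 * Γ.genus + 4) * Γ.ell0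
          + ∑ᶠ i ∈ Ioc (0 : ℝ) (Γ.genus / 2), i * (Γ.genus - i) / (2 * Γ.genus + 1) * Γ.ell i
          + ∑ C ∈ Γ.circles, ∑ a ∈ Γ.circleVerts C, ∑ b ∈ Γ.circleVerts C,
              Γ.hangingGenus C a * Γ.hangingGenus C b / (4 * Γ.genus + 2)
                * Γ.resistance C a b := by
  refine ⟨PolarizedGraph.exists_isAdmissible, fun μ G h => ?_⟩
  obtain ⟨hphi, hlam⟩ := h.phi_lam_eq hΓ
  have hg := PolarizedGraph.genus_pos (Γ := Γ)
  have h1 : ∑ᶠ i ∈ Ioc (0 : ℝ) (Γ.genus / 2), 2 * i * (Γ.genus - i) / Γ.genus * Γ.ell i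
      = 2 / Γ.genus * Γ.bridgeSum := by
    rw [← PolarizedGraph.sum_ell_eq_bridgeSum]
    refine finsum_congr fun i => finsum_congr fun _ => ?_
    ring
  have h2 : ∑ᶠ i ∈ Ioc (0 : ℝ) (Γ.genus / 2), i * (Γ.genus - i) / (2 * Γ.genus + 1) * Γ.ell i
      = 1 / (2 * Γ.genus + 1) * Γ.bridgeSum := by
    rw [← PolarizedGraph.sum_ell_eq_bridgeSum]
    refine finsum_congr fun i => finsum_congr fun _ => ?_
    ring
  rw [h1, h2, PolarizedGraph.sum_circleRes_div, PolarizedGraph.sum_circleRes_div]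
  refine ⟨?_, ?_, hphi, hlam⟩
  · rw [hphi]
    have := div_nonneg (PolarizedGraph.circleRes_nonneg hΓ) hg.le
    linarith
  · rw [hphi, ← PolarizedGraph.circleRes_eq_zero_iff hΓ, add_eq_left, div_eq_zero_iff]
    simp [hg.ne']
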